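/- **Setting.** Let $G$ be a metric graph with finitely many vertices and edges, finite edge lengths, and no loops or multiple edges; the edge $\alpha$ is identified with $[0,\ell_\alpha]$, functions on $G$ are families of functions on the closed edges, $d$ is the path distance on $G$ and $l_0$ the length of the shortest edge. Let $U$ be a real potential that is smooth on $G$: it is $C^\infty$ on every closed edge, all its odd derivatives vanish at every vertex, and its even derivatives at a vertex agree along all adjacent edges. Let $D=-(\partial_x^2+U)$ with self-adjoint non-Robin conditions $A_v\vec f_v+B_v\vec f_v{}'=0$ at every vertex $v$ (derivatives oriented away from $v$): $A_vB_v^*$ is Hermitian, $(A_v\,|\,B_v)$ has full rank, and $\sigma_v=-(A_v+ikB_v)^{-1}(A_v-ikB_v)$ does not depend on $k\in\mathbb R\setminus\{0\}$. A heat kernel $e(t,x,y)$ is a function, continuous on $(0,\infty)\times G\times G$ edge by edge, $C^1$ in $t$ and $C^2$ in $y$ on closed edges, such that $(\partial_t+D_y)e=0$, $\overline{e(t,x,\cdot)}$ satisfies the boundary conditions (the conjugation is irrelevant for real conditions), and $\int_G e(t,x,y)\psi(y)\,dy\to\psi(x)$ as $t\to0^+$ for $x$ in the interior of an edge and $\psi$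 continuous on the closed edges. **Parametrix.** For a potential $W$ on $\mathbb R$ put $u_0=1$ and, for $l\ge 1$, $u_l(x,y)=-(y-x)^{-l}\int_x^y(z-x)^{l-1}D_zu_{l-1}(x,z)\,dz$, extended continuously to $y=x$ (here $D=-(\partial^2+W)$), and $h_k(t,x,y)=\frac{1}{\sqrt{4\pi t}}e^{-(x-y)^2/4t}\sum_{l=0}^k u_l(x,y)t^l$. For edges $\alpha,\beta$ at a vertex $v$, with coordinates starting at $v$, let $h_k^{\alpha\beta}$ be $h_k$ for the potential equal to $U_\alpha(z)$ for $z\ge0$ and to $U_\beta(-z)$ for $z\le0$, and put $$h_k^v(t,x_\alpha,y_\beta)=\delta_{\alpha\beta}h_k^{\alpha\alpha}(t,x_\alpha,y_\alpha)+\sigma_v^{\alpha\beta}h_k^{\alpha\beta}(t,x_\alpha,-y_\beta).$$ Let $\eta:\mathbb R\to[0,1]$ be any smooth function with $\eta=1$ on $(-\infty,\frac13]$, $\eta=0$ on $[\frac23,\infty)$ and $\eta(1-x)=1-\eta(x)$. For $x$ on an edge $\alpha$ adjacent to $v$ let $\chi_v(x)=\eta(x_\alpha/\ell_\alpha)$,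 where $x_\alpha$ is the distance from $v$ along $\alpha$, and $\chi_v(x)=0$ otherwise. Put $$\tilde h_k(t,x,y)=\eta\big(2l_0^{-1}d(x,y)\big)\sum_v\chi_v(x)h_k^v(t,x,y),$$ with the summand understood as $0$ unless $x$ and $y$ both lie on edges adjacent to $v$, and with the cut-off factor understood as $0$ if $d(x,y)=\infty$. **Theorem.** (1) For every $k\ge1$, $e(t,x,y)=\tilde h_k(t,x,y)+O(t^k)$ uniformly in $x,y\in G$, i.e. there are $C$ and $T>0$ with $|e-\tilde h_k|\le Ct^k$ for all $0<t\le T$ and $x,y\in G$. (2) As $t\to0^+$ the heat trace has the asymptotic expansion $$\int_G e(t,x,x)\,dx\sim\frac1{\sqrt{4\pi t}}\sum_{n=0}^\infty\int_G a_n(x)\,dx\;t^n+\frac14\sum_{v}\sum_{\alpha\sim v}\sigma_v^{\alpha\alpha}\sum_{n=0,\frac12,1,\frac32,\dots}a_n^b(v)\,t^n,$$ meaning that for each $N\in\mathbb{N}$ the difference of the left side and the right side, with both sums restricted to $n\le N$, is $O(t^{N+1/2})$. The coefficients are local and universal: $a_n(x)$ and $a_n^b(v)$ are polynomials in $U$ and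 finitely many of its derivatives at $x$ resp. at $v$, these polynomials are the same for all graphs, potentials and boundary conditions, and the polynomial for $a_n(x)$ does not depend on the direction in which the edge is parametrized. -/

import Mathlib

open Set Filter Topology
open scoped ContDiff ENNReal Matrix

universe u v

/-- A compact metric graph with finitely many vertices and edges, without loops and without multiple
edges. The edge `α` is the interval `[0, len α]`, glued at `0` to `src α` and at `len α` to `tgt α`;
this choice of direction is only a choice of coordinate. -/
structure MetricGraph (V : Type u) (E : Type v) where
  src : E → V
  tgt : E → V
  len : E → ℝ
  len_pos : ∀ α, 0 < len α
  no_loops : ∀ α, src α ≠ tgt α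
  no_multi : Function.Injective fun α => s(src α, tgt α)

namespace MetricGraph

variable {V : Type u} {E : Type v} (Γ : MetricGraph V E)

/-- `α ∼ w`: the edge `α` is adjacent to the vertex `w`. -/
def Incident (α : E) (w : V) : Prop := Γ.src α = w ∨ Γ.tgt α = w

instance [DecidableEq V] (α : E) (w : V) : Decidable (Γ.Incident α w) :=
  inferInstanceAs (Decidable (_ ∨ _))

/-- The edges adjacent to the vertex `w`. -/
abbrev EdgesAt (w : V) : Type v := {α : E // Γ.Incident α w}

/-- The change of coordinate on the edge `α` (adjacent to `w`) between the fixed coordinate and the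
coordinate that vanishes at `w`, i.e. the distance to `w` along the edge. It is an involution. -/
def coord [DecidableEq V] (w : V) (α : E) (x : ℝ) : ℝ :=
  if Γ.src α = w then x else Γ.len α - x

/-- The length `l₀` of the shortest edge. -/
noncomputable def minLen : ℝ := ⨅ α, Γ.len α

/-- `Γ.IsPathLength a b r`: there is a path of edges of total length `r` from `a` to `b`. -/
inductive IsPathLength : V → V → ℝ → Prop
  | refl (a : V) : IsPathLength a a 0
  | cons {a b c : V} {r : ℝ} (α : E) (ha : Γ.Incident α a) (hb : Γ.Incident α b) (hab : a ≠ b)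
      (h : IsPathLength b c r) : IsPathLength a c (Γ.len α + r)

/-- The path distance between two vertices (`⊤` if they lie in different components). -/
noncomputable def vertexDist (a b : V) : ℝ≥0∞ :=
  ⨅ (r : ℝ) (_ : Γ.IsPathLength a b r), ENNReal.ofReal r

/-- The path distance on the graph between the point of `α` with coordinate `x` and the point of `β`
with coordinate `y`: the shortest path either stays on one edge or leaves through an endpoint `a` of
`α` and arrives through an endpoint `b` of `β`. -/
noncomputable def pointDist [DecidableEq V] (α : E) (x : ℝ) (β : E) (y : ℝ) : ℝ≥0∞ :=
  (⨅ (_ : α = β), ENNReal.ofReal |x - y|) ⊓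
    ⨅ (a : V) (_ : Γ.Incident α a) (b : V) (_ : Γ.Incident β b),
      ENNReal.ofReal (Γ.coord a α x) + Γ.vertexDist a b + ENNReal.ofReal (Γ.coord b β y)

/-- The function `f` on the edge `α`, written in the coordinate that starts at the vertex `w`.
Functions on the graph are families of functions on the closed edges (they may take different
values at a vertex along different edges). -/
def atVertex [DecidableEq V] {R : Type*} (f : E → ℝ → R) (w : V) (α : E) : ℝ → R :=
  fun s => f α (Γ.coord w α s)

/-- The `j`-th derivative of `f` along `α` at the vertex `w`, oriented away from `w`. -/
noncomputable def vertexDeriv [DecidableEq V] {R : Type*} [NormedAddCommGroup R] [NormedSpace ℝ R]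
    (f : E → ℝ → R) (w : V) (α : E) (j : ℕ) : R :=
  iteratedDerivWithin j (Γ.atVertex f w α) (Icc 0 (Γ.len α)) 0

/-- Potentials that are smooth on the graph: smooth on the closed edges, with all odd derivatives
vanishing at the vertices and all even derivatives continuous at the vertices. -/
structure IsSmoothPotential [DecidableEq V] (U : E → ℝ → ℝ) : Prop where
  smooth : ∀ α, ContDiffOn ℝ ∞ (U α) (Icc 0 (Γ.len α))
  odd : ∀ (w : V) (α : E), Γ.Incident α w → ∀ l : ℕ, Γ.vertexDeriv U w α (2 * l + 1) = 0
  even : ∀ (w : V) (α β : E), Γ.Incident α w → Γ.Incident β w → ∀ l : ℕ,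
    Γ.vertexDeriv U w α (2 * l) = Γ.vertexDeriv U w β (2 * l)

/-- The integral of a function over the graph. -/
noncomputable def integral [Fintype E] {R : Type*} [NormedAddCommGroup R] [NormedSpace ℝ R]
    (f : E → ℝ → R) : R :=
  ∑ α, ∫ x in (0 : ℝ)..(Γ.len α), f α x

/-- Self-adjoint non-Robin boundary conditions `A_w f(w) + B_w f'(w) = 0` at all vertices. -/
structure BoundaryConditions [Fintype E] [DecidableEq V] [DecidableEq E] where
  A : ∀ w : V, Matrix (Γ.EdgesAt w) (Γ.EdgesAt w) ℂ
  B : ∀ w : V, Matrix (Γ.EdgesAt w) (Γ.EdgesAt w) ℂ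
  selfAdjoint : ∀ w, (A w * (B w)ᴴ).IsHermitian
  fullRank : ∀ w, (Matrix.fromCols (A w) (B w)).rank = Fintype.card (Γ.EdgesAt w)
  /-- The matrix `-(A + ikB)⁻¹ (A - ikB)` does not depend on `k`. -/
  nonRobin : ∀ w, ∀ k k' : ℝ, k ≠ 0 → k' ≠ 0 →
    -((A w + (Complex.I * k) • B w)⁻¹ * (A w - (Complex.I * k) • B w)) =
      -((A w + (Complex.I * k') • B w)⁻¹ * (A w - (Complex.I * k') • B w))

namespace BoundaryConditions

variable {Γ} [Fintype E] [DecidableEq V] [DecidableEq E] (bc : Γ.BoundaryConditions)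

/-- The matrix `σ^w = -(A_w + ikB_w)⁻¹ (A_w - ikB_w)`; it does not depend on `k`, so it is taken
at `k = 1`. -/
noncomputable def sigma (w : V) : Matrix (Γ.EdgesAt w) (Γ.EdgesAt w) ℂ :=
  -((bc.A w + Complex.I • bc.B w)⁻¹ * (bc.A w - Complex.I • bc.B w))

/-- The function `f` satisfies the boundary conditions at all vertices. -/
def Holds (f : E → ℝ → ℂ) : Prop :=
  ∀ w : V, bc.A w *ᵥ (fun α : Γ.EdgesAt w => Γ.atVertex f w α 0) +
    bc.B w *ᵥ (fun α : Γ.EdgesAt w => Γ.vertexDeriv f w α 1) = 0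

/-- `e` is a heat kernel of `D = -(∂² + U)` with the given boundary conditions; `e t α x β y` is the
value at time `t` and the points `x` of the edge `α` and `y` of the edge `β`. It solves
`(∂_t + D_y) e = 0`, satisfies the boundary conditions in `y` and tends to `δ_x(y)` as `t → 0⁺`.

The complex conjugate in `boundary` is the usual one for an integral kernel acting by
`ψ ↦ ∫ e(t,x,y) ψ(y) dy`, as in `∑ exp (-λ t) θ(x) (conj θ(y))`; it plays no role
for real boundary conditions.
The limit is tested at interior points `x` of edges, the values at the vertices then follow by
continuity (at a Dirichlet vertex, say, `e t α x β y` vanishes). -/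
structure IsHeatKernel (U : E → ℝ → ℝ) (e : ℝ → E → ℝ → E → ℝ → ℂ) : Prop where
  continuous : ∀ α β, ContinuousOn (fun p : ℝ × ℝ × ℝ => e p.1 α p.2.1 β p.2.2)
    (Ioi 0 ×ˢ Icc 0 (Γ.len α) ×ˢ Icc 0 (Γ.len β))
  differentiable_time : ∀ α β, ∀ x ∈ Icc 0 (Γ.len α), ∀ y ∈ Icc 0 (Γ.len β),
    DifferentiableOn ℝ (fun t => e t α x β y) (Ioi 0)
  continuous_deriv_time : ∀ α β, ∀ x ∈ Icc 0 (Γ.len α),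
    ContinuousOn (fun p : ℝ × ℝ => deriv (fun t => e t α x β p.2) p.1)
      (Ioi 0 ×ˢ Icc 0 (Γ.len β))
  contDiff_space : ∀ t > 0, ∀ α β, ∀ x ∈ Icc 0 (Γ.len α),
    ContDiffOn ℝ 2 (fun y => e t α x β y) (Icc 0 (Γ.len β))
  heat_equation : ∀ t > 0, ∀ α β, ∀ x ∈ Icc 0 (Γ.len α), ∀ y ∈ Icc 0 (Γ.len β),
    deriv (fun s => e s α x β y) t -
      (iteratedDerivWithin 2 (fun z => e t α x β z) (Icc 0 (Γ.len β)) y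
        + (U β y : ℂ) * e t α x β y) = 0
  boundary : ∀ t > 0, ∀ α, ∀ x ∈ Icc 0 (Γ.len α),
    bc.Holds (fun β y => starRingEnd ℂ (e t α x β y))
  initial : ∀ α, ∀ x ∈ Ioo 0 (Γ.len α), ∀ ψ : E → ℝ → ℂ,
    (∀ β, ContinuousOn (ψ β) (Icc 0 (Γ.len β))) →
      Tendsto (fun t => Γ.integral fun β y => e t α x β y * ψ β y) (𝓝[>] 0) (𝓝 (ψ α x))

end BoundaryConditions

end MetricGraph

/-! ### The parametrix -/

/-- The heat kernel `(4πt)^{-1/2} exp(-(x-y)²/4t)` of the Laplacian on the real line. -/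
noncomputable def gaussKernel (t x y : ℝ) : ℝ :=
  1 / Real.sqrt (4 * Real.pi * t) * Real.exp (-(x - y) ^ 2 / (4 * t))

/-- The functions `u_l(x,y)` on the real line for the potential `W`: `u_0 = 1` and
`u_l(x,y) = -(y-x)^{-l} ∫_x^y (z-x)^{l-1} D_z u_{l-1}(x,z) dz` with `D = -(∂² + W)`. The integral is
written after the substitution `z = x + s (y - x)`, which includes the continuous extension to
`y = x`; for `y ≠ x` see `transportCoeff_succ_of_ne`. -/
noncomputable def transportCoeff (W : ℝ → ℝ) : ℕ → ℝ → ℝ → ℝ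
  | 0 => fun _ _ => 1
  | l + 1 => fun x y => -∫ s in (0 : ℝ)..1, s ^ l *
      -(deriv (deriv (transportCoeff W l x)) (x + s * (y - x))
        + W (x + s * (y - x)) * transportCoeff W l x (x + s * (y - x)))

theorem transportCoeff_succ_of_ne (W : ℝ → ℝ) (l : ℕ) {x y : ℝ} (h : y ≠ x) :
    transportCoeff W (l + 1) x y = -((y - x) ^ (l + 1))⁻¹ * ∫ z in x..y, (z - x) ^ l *
      -(deriv (deriv (transportCoeff W l x)) z + W z * transportCoeff W l x z) := by
  have hc : y - x ≠ 0 := sub_ne_zero.2 h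
  have key := intervalIntegral.smul_integral_comp_add_mul (a := 0) (b := 1)
    (fun z => (z - x) ^ l *
      -(deriv (deriv (transportCoeff W l x)) z + W z * transportCoeff W l x z)) (y - x) x
  have e1 : x + (y - x) * 0 = x := by ring
  have e2 : x + (y - x) * 1 = y := by ring
  rw [e1, e2] at key
  rw [← key, smul_eq_mul, ← mul_assoc, ← intervalIntegral.integral_const_mul,
    show transportCoeff W (l + 1) x y = -∫ s in (0 : ℝ)..1, s ^ l *
      -(deriv (deriv (transportCoeff W l x)) (x + s * (y - x))
        + W (x + s * (y - x)) * transportCoeff W l x (x + s * (y - x))) from rfl,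
    ← intervalIntegral.integral_neg]
  congr 1
  ext s
  rw [mul_comm (y - x) s, add_sub_cancel_left, mul_pow, pow_succ (y - x)]
  field_simp

/-- The parametrix `h_k` on the real line for the potential `W`. -/
noncomputable def lineParametrix (W : ℝ → ℝ) (k : ℕ) (t x y : ℝ) : ℝ :=
  gaussKernel t x y * ∑ l ∈ Finset.range (k + 1), transportCoeff W l x y * t ^ l

/-- The smooth cut-off functions that enter the parametrix on the graph. -/
structure IsCutoff (η : ℝ → ℝ) : Prop where
  smooth : ContDiff ℝ ∞ η
  mem_Icc : ∀ x, η x ∈ Icc (0 : ℝ) 1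
  eq_one : ∀ x ≤ 1 / 3, η x = 1
  eq_zero : ∀ x, 2 / 3 ≤ x → η x = 0
  symmetric : ∀ x, η (1 - x) = 1 - η x

namespace MetricGraph

variable {V : Type u} {E : Type v} [DecidableEq V] (Γ : MetricGraph V E)

/-- The potential on the real line that is `U_α(z)` for `z ≥ 0` and `U_β(-z)` for `z ≤ 0`, in the
coordinates that start at the vertex `w`. -/
noncomputable def glue (U : E → ℝ → ℝ) (w : V) (α β : E) (z : ℝ) : ℝ :=
  if 0 ≤ z then Γ.atVertex U w α z else Γ.atVertex U w β (-z)

/-- The factor `η(2 d(x,y) / l₀)`, which is `0` if `x` and `y` lie in different components. -/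
noncomputable def distCutoff (η : ℝ → ℝ) (α : E) (x : ℝ) (β : E) (y : ℝ) : ℝ :=
  if Γ.pointDist α x β y = ⊤ then 0
  else η (2 * (Γ.minLen)⁻¹ * (Γ.pointDist α x β y).toReal)

/-- The function `χ_w` on an edge `α` adjacent to `w`. -/
noncomputable def chi (η : ℝ → ℝ) (w : V) (α : E) (x : ℝ) : ℝ :=
  η ((Γ.len α)⁻¹ * Γ.coord w α x)

namespace BoundaryConditions

variable {Γ} [Fintype E] [DecidableEq E] (bc : Γ.BoundaryConditions)

/-- The star graph parametrix `h_k^w(t, x_α, y_β)` at the vertex `w`, in the coordinates `x`, `y` on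
the edges `α`, `β` that start at `w`. -/
noncomputable def starParametrix (U : E → ℝ → ℝ) (k : ℕ) (w : V) (t : ℝ)
    (α : Γ.EdgesAt w) (x : ℝ) (β : Γ.EdgesAt w) (y : ℝ) : ℂ :=
  (if α = β then (lineParametrix (Γ.glue U w α α) k t x y : ℂ) else 0) +
    bc.sigma w α β * (lineParametrix (Γ.glue U w α β) k t x (-y) : ℂ)

/-- The parametrix `h̃_k(t,x,y) = η(2 d(x,y) / l₀) ∑_w χ_w(x) h_k^w(t,x,y)` on the graph. The sum runs
over the vertices `w` adjacent to both edges. -/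
noncomputable def graphParametrix [Fintype V] (U : E → ℝ → ℝ) (η : ℝ → ℝ) (k : ℕ) (t : ℝ)
    (α : E) (x : ℝ) (β : E) (y : ℝ) : ℂ :=
  (Γ.distCutoff η α x β y : ℂ) * ∑ w : V,
    if h : Γ.Incident α w ∧ Γ.Incident β w then
      (Γ.chi η w α x : ℂ) *
        bc.starParametrix U k w t ⟨α, h.1⟩ (Γ.coord w α x) ⟨β, h.2⟩ (Γ.coord w β y)
    else 0

/-- The partial sum of the heat trace expansion: interior terms
`(4πt)^{-1/2} ∑_{n ≤ N} (∫_G a_n) t^n` and vertex terms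
`(1/4) ∑_w ∑_{α ∼ w} σ_w^{αα} ∑_{n = 0, 1/2, 1, …, N} a_n^b(w) t^n`. Here `a_n(x) = a n (U(x), U'(x), …)`
and `a_{m/2}^b(w) = b m (U(w), U'(w), …)`; for a smooth potential the derivatives of `U` at `w`
are the same along all edges `α ∼ w`. -/
noncomputable def traceExpansion [Fintype V] (U : E → ℝ → ℝ) (a b : ℕ → MvPolynomial ℕ ℝ)
    (N : ℕ) (t : ℝ) : ℂ :=
  ((1 / Real.sqrt (4 * Real.pi * t) * ∑ n ∈ Finset.range (N + 1),
      (Γ.integral fun α x =>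
        MvPolynomial.eval (fun j => iteratedDerivWithin j (U α) (Icc 0 (Γ.len α)) x) (a n)) * t ^ n
      : ℝ) : ℂ) +
    1 / 4 * ∑ w : V, ∑ α : Γ.EdgesAt w, bc.sigma w α α *
      ((∑ m ∈ Finset.range (2 * N + 1),
        MvPolynomial.eval (fun j => Γ.vertexDeriv U w α j) (b m) * t ^ ((m : ℝ) / 2) : ℝ) : ℂ)

end BoundaryConditions

end MetricGraph

/-!
The heat kernel is compared with an explicit parametrix by Duhamel's principle, and the heat trace
is read off from the parametrix.

*The parametrix.* On the line the transport equations for the coefficients `u_l` make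
`lineParametrix W k` a solution of the heat equation up to an error `O(t^{k-1/2})`
(`exists_cutDefect_le`). Smoothness of the potential on the graph says that the potentials of two
edges, glued at a vertex, extend to a smooth function on the line
(`IsSmoothPotential.exists_extension`). The non-Robin conditions give `σ² = 1` and `σ* = σ`, and
turn the boundary conditions into `σ F = F` for the values and `σ F' = -F'` for the derivatives
(`sigma_mulVec_of_boundary`). At a vertex the line parametrices for the different glued potentials
agree together with their first derivatives, because `u_l(x, y)` only depends on the potential
between `x` and `y`; hence the sum of a direct and a reflected part satisfies the boundary
conditions. The parametrix `graphParametrix` of the theorem is cut off by a function of the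
distance, which is not smooth. The function `assemble` uses instead a smooth cut-off in the
coordinate of the second point, so that it satisfies the boundary conditions exactly and solves
the heat equation up to `O(t^{k-1/2})` (`isParametrix_assemble`). The two parametrices differ by
less than any power of `t` (`exists_graphParametrix_sub_le`), since their cut-off functions only
differ where the Gauss kernel is that small.

*The comparison.* For two solutions `f(s, ·)` and `g(s, ·)` of the heat equation up to small
errors, `∫ f(s, z) conj g(t - s, z) dz` is almost constant in `s` by Green's formula, and its
limits at `s = 0` and `s = t` are the values of `g` and `f` at the two base points
(`HeatFlow.duhamel`). Weak convergence to Dirac measures is enough for these limits, since it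
implies a bound in `L¹` by the Banach–Steinhaus theorem. Applied twice to the heat kernel `e`,
this shows that `e` is Hermitian. Applied to `e` and a parametrix, it bounds their difference by
the defect of the parametrix times the `L¹` norm of `e(s, y, ·)`, and this norm is bounded
uniformly by the same inequality, integrated over one of the points. The result is an error
`O(t^{k+1/2})` (`IsParametrix.exists_norm_sub_le`).

*The trace.* The derivatives `∂_y^j u_l(x, y)` at `y = x` are universal polynomials `diagPoly l j`
in the derivatives of the potential at `x`, by the recursion that the transport equation gives
(`eval_diagPoly`). The direct parts of the parametrix contribute `(4πt)^{-1/2} u_l(x, x) t^l`, and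
the cut-off functions of the two ends of an edge add up to `1`. The reflected part at a vertex
contributes `∫ (4πt)^{-1/2} exp(-s²/t) u_l(s, -s) t^l ds`; a Taylor expansion of `u_l(s, -s)` at
`s = 0` (`exists_reflected_sub_le`) and the moments of the Gauss kernel turn it into a series in
half-integer powers of `t` (`exists_reflected_integral_le`).
-/

open MeasureTheory

/-! ### Smoothness of the transport coefficients -/

/-- `u x y` is smooth in `y`, and all its `y`-derivatives are jointly continuous in `(x, y)`. The
transport coefficients are used with `x` as a parameter only, so no `x`-derivatives are needed. -/
def FiberSmooth (u : ℝ → ℝ → ℝ) : Prop :=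
  (∀ x, ContDiff ℝ ∞ (u x)) ∧ ∀ j : ℕ, Continuous fun p : ℝ × ℝ => iteratedDeriv j (u p.1) p.2

namespace FiberSmooth

variable {u q : ℝ → ℝ → ℝ}

theorem continuous (h : FiberSmooth u) : Continuous fun p : ℝ × ℝ => u p.1 p.2 := by
  simpa using h.2 0

theorem deriv (h : FiberSmooth u) : FiberSmooth fun x => deriv (u x) := by
  refine ⟨fun x => (contDiff_infty_iff_deriv.1 (h.1 x)).2, fun j => ?_⟩
  simpa only [iteratedDeriv_succ'] using h.2 (j + 1)

theorem differentiableAt (h : FiberSmooth u) (x y : ℝ) : DifferentiableAt ℝ (u x) y :=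
  (h.1 x).contDiffAt.differentiableAt (by simp)

theorem hasDerivAt (h : FiberSmooth u) (x y : ℝ) : HasDerivAt (u x) (_root_.deriv (u x) y) y :=
  (h.differentiableAt x y).hasDerivAt

theorem add (h : FiberSmooth u) (h' : FiberSmooth q) : FiberSmooth fun x y => u x y + q x y := by
  refine ⟨fun x => (h.1 x).add (h'.1 x), fun j => ?_⟩
  have : (fun p : ℝ × ℝ => iteratedDeriv j (fun y => u p.1 y + q p.1 y) p.2) =
      fun p => iteratedDeriv j (u p.1) p.2 + iteratedDeriv j (q p.1) p.2 := by
    ext p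
    exact iteratedDeriv_fun_add ((h.1 _).contDiffAt.of_le (by exact_mod_cast le_top))
      ((h'.1 _).contDiffAt.of_le (by exact_mod_cast le_top))
  rw [this]
  exact (h.2 j).add (h'.2 j)

theorem potential_mul {W : ℝ → ℝ} (hW : ContDiff ℝ ∞ W) (h : FiberSmooth u) :
    FiberSmooth fun x y => W y * u x y := by
  refine ⟨fun x => hW.mul (h.1 x), fun j => ?_⟩
  have : (fun p : ℝ × ℝ => iteratedDeriv j (fun y => W y * u p.1 y) p.2) =
      fun p => ∑ i ∈ Finset.range (j + 1),
        (j.choose i : ℝ) * iteratedDeriv i W p.2 * iteratedDeriv (j - i) (u p.1) p.2 := by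
    ext p
    exact iteratedDeriv_fun_mul (hW.contDiffAt.of_le (by exact_mod_cast le_top))
      ((h.1 _).contDiffAt.of_le (by exact_mod_cast le_top))
  rw [this]
  refine continuous_finsetSum _ fun i _ => ?_
  exact (continuous_const.mul ((hW.continuous_iteratedDeriv i
    (by exact_mod_cast le_top)).comp continuous_snd)).mul (h.2 _)

end FiberSmooth

/-- The weighted average `∫₀¹ sˡ q(x, x + s (y - x)) ds` over the segment from `x` to `y`. -/
noncomputable def segAvg (l : ℕ) (q : ℝ → ℝ → ℝ) (x y : ℝ) : ℝ :=
  ∫ s in (0 : ℝ)..1, s ^ l * q x (x + s * (y - x))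

theorem continuous_segAvg (l : ℕ) {q : ℝ → ℝ → ℝ}
    (hq : Continuous fun p : ℝ × ℝ => q p.1 p.2) :
    Continuous fun p : ℝ × ℝ => segAvg l q p.1 p.2 := by
  refine intervalIntegral.continuous_parametric_intervalIntegral_of_continuous'
    (f := fun (p : ℝ × ℝ) s => s ^ l * q p.1 (p.1 + s * (p.2 - p.1))) ?_ 0 1
  have : Continuous fun r : (ℝ × ℝ) × ℝ => q r.1.1 (r.1.1 + r.2 * (r.1.2 - r.1.1)) :=
    hq.comp (f := fun r : (ℝ × ℝ) × ℝ => (r.1.1, r.1.1 + r.2 * (r.1.2 - r.1.1))) (by fun_prop)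
  exact (continuous_snd.pow l).mul this

theorem hasDerivAt_segAvg (l : ℕ) {q : ℝ → ℝ → ℝ} (hq : FiberSmooth q) (x y : ℝ) :
    HasDerivAt (segAvg l q x) (segAvg (l + 1) (fun x => deriv (q x)) x y) y := by
  have hd : Continuous (deriv (q x)) := (hq.deriv.1 x).continuous
  have hc : Continuous (q x) := (hq.1 x).continuous
  have hF : Continuous fun r : ℝ × ℝ => r.2 ^ (l + 1) * deriv (q x) (x + r.2 * (r.1 - x)) := by
    fun_prop
  obtain ⟨C, hC⟩ := ((isCompact_closedBall y 1).prod
    (isCompact_Icc (a := (0 : ℝ)) (b := 1))).exists_bound_of_continuousOn hF.continuousOn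
  refine (intervalIntegral.hasDerivAt_integral_of_dominated_loc_of_deriv_le
    (F := fun z s => s ^ l * q x (x + s * (z - x)))
    (F' := fun z s => s ^ (l + 1) * deriv (q x) (x + s * (z - x)))
    (bound := fun _ => C) (Metric.closedBall_mem_nhds y one_pos) ?_ ?_ ?_ ?_ ?_ ?_).2
  · exact Eventually.of_forall fun z => Continuous.aestronglyMeasurable (by fun_prop)
  · exact Continuous.intervalIntegrable (by fun_prop) _ _
  · exact Continuous.aestronglyMeasurable (by fun_prop)
  · refine Eventually.of_forall fun s hs z hz => hC (z, s) ⟨hz, ?_⟩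
    rw [uIoc_of_le zero_le_one] at hs
    exact ⟨hs.1.le, hs.2⟩
  · exact intervalIntegrable_const
  · refine Eventually.of_forall fun s _ z _ => ?_
    have h1 : HasDerivAt (fun z => x + s * (z - x)) s z := by
      simpa using (((hasDerivAt_id z).sub_const x).const_mul s).const_add x
    have h2 := ((hq.hasDerivAt x (x + s * (z - x))).comp z h1).const_mul (s ^ l)
    refine h2.congr_deriv ?_
    ring

theorem iteratedDeriv_segAvg (j l : ℕ) {q : ℝ → ℝ → ℝ} (hq : FiberSmooth q) (x : ℝ) :
    iteratedDeriv j (segAvg l q x) = segAvg (l + j) (fun x => iteratedDeriv j (q x)) x := by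
  induction j generalizing l q with
  | zero => simp
  | succ j ih =>
    rw [iteratedDeriv_succ',
      show deriv (segAvg l q x) = segAvg (l + 1) (fun x => deriv (q x)) x from
      funext fun y => (hasDerivAt_segAvg l hq x y).deriv, ih _ hq.deriv]
    simp only [iteratedDeriv_succ']
    congr 1
    ring

theorem FiberSmooth.segAvg (l : ℕ) {q : ℝ → ℝ → ℝ} (hq : FiberSmooth q) :
    FiberSmooth (segAvg l q) := by
  have hi (j : ℕ) : FiberSmooth fun x => iteratedDeriv j (q x) := by
    induction j with
    | zero => simpa using hq
    | succ j ih => simpa only [iteratedDeriv_succ] using ih.deriv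
  refine ⟨fun x => contDiff_of_differentiable_iteratedDeriv fun j _ => ?_, fun j => ?_⟩
  · rw [iteratedDeriv_segAvg j l hq]
    exact fun y => (hasDerivAt_segAvg _ (hi j) x y).differentiableAt
  · simp only [iteratedDeriv_segAvg j l hq]
    exact continuous_segAvg _ (hi j).continuous

/-- The function `-D_y u_l = ∂_y² u_l + W u_l` that drives the transport equation. -/
noncomputable def transportSource (W : ℝ → ℝ) (l : ℕ) (x y : ℝ) : ℝ :=
  deriv (deriv (transportCoeff W l x)) y + W y * transportCoeff W l x y

theorem transportCoeff_succ (W : ℝ → ℝ) (l : ℕ) (x y : ℝ) :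
    transportCoeff W (l + 1) x y = segAvg l (transportSource W l) x y := by
  rw [show transportCoeff W (l + 1) x y = -∫ s in (0 : ℝ)..1, s ^ l *
      -(deriv (deriv (transportCoeff W l x)) (x + s * (y - x))
        + W (x + s * (y - x)) * transportCoeff W l x (x + s * (y - x))) from rfl,
    ← intervalIntegral.integral_neg]
  simp only [segAvg, transportSource]
  congr 1
  ext s
  ring

theorem transportCoeff_zero (W : ℝ → ℝ) (x y : ℝ) : transportCoeff W 0 x y = 1 := rfl

section smooth

variable {W : ℝ → ℝ} (hW : ContDiff ℝ ∞ W)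

include hW

theorem fiberSmooth_transportCoeff (l : ℕ) : FiberSmooth (transportCoeff W l) := by
  induction l with
  | zero =>
    refine ⟨fun x => contDiff_const (c := (1 : ℝ)), fun j => ?_⟩
    have : (fun p : ℝ × ℝ => iteratedDeriv j (transportCoeff W 0 p.1) p.2) =
        fun _ => if j = 0 then (1 : ℝ) else 0 := by
      ext p
      exact iteratedDeriv_const
    rw [this]
    exact continuous_const
  | succ l ih =>
    rw [show transportCoeff W (l + 1) = segAvg l (transportSource W l) from
      funext₂ (transportCoeff_succ W l)]
    exact (ih.deriv.deriv.add (ih.potential_mul hW)).segAvg l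

theorem fiberSmooth_transportSource (l : ℕ) : FiberSmooth (transportSource W l) :=
  have h := fiberSmooth_transportCoeff hW l
  h.deriv.deriv.add (h.potential_mul hW)

/-- The transport equation `(l + 1) u_{l+1} + (y - x) ∂_y u_{l+1} = ∂_y² u_l + W u_l`. -/
theorem transport_equation (l : ℕ) (x y : ℝ) :
    (l + 1) * transportCoeff W (l + 1) x y + (y - x) * deriv (transportCoeff W (l + 1) x) y =
      transportSource W l x y := by
  have hS := fiberSmooth_transportSource hW l
  have hc : Continuous (transportSource W l x) := (hS.1 x).continuous
  have hd : Continuous (deriv (transportSource W l x)) := (hS.deriv.1 x).continuous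
  rw [show transportCoeff W (l + 1) x = segAvg l (transportSource W l) x from
    funext (transportCoeff_succ W l x), (hasDerivAt_segAvg l hS x y).deriv]
  -- both terms together are the integral of the derivative of `s^{l+1} q(x + s (y - x))`
  have h (s : ℝ) : HasDerivAt (fun s => s ^ (l + 1) * transportSource W l x (x + s * (y - x)))
      ((l + 1) * (s ^ l * transportSource W l x (x + s * (y - x))) +
        (y - x) * (s ^ (l + 1) * deriv (transportSource W l x) (x + s * (y - x)))) s := by
    have h1 : HasDerivAt (fun s => x + s * (y - x)) (y - x) s := by
      simpa using ((hasDerivAt_id s).mul_const (y - x)).const_add x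
    have h2 := (hasDerivAt_pow (l + 1) s).mul ((hS.hasDerivAt x (x + s * (y - x))).comp s h1)
    refine h2.congr_deriv ?_
    simp
    ring
  have hint := intervalIntegral.integral_eq_sub_of_hasDerivAt (a := 0) (b := 1) (fun s _ => h s)
    (Continuous.intervalIntegrable (by fun_prop) _ _)
  rw [intervalIntegral.integral_add (Continuous.intervalIntegrable (by fun_prop) _ _)
    (Continuous.intervalIntegrable (by fun_prop) _ _), intervalIntegral.integral_const_mul,
    intervalIntegral.integral_const_mul] at hint
  simpa [segAvg] using hint

theorem exists_bound_iteratedDeriv_transportCoeff (k n : ℕ) (L : ℝ) :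
    ∃ C, 0 ≤ C ∧ ∀ l ≤ k, ∀ j ≤ n, ∀ x ∈ Icc (-L) L, ∀ y ∈ Icc (-L) L,
      |iteratedDeriv j (transportCoeff W l x) y| ≤ C := by
  have h (l j : ℕ) : ∃ C, ∀ p ∈ Icc (-L) L ×ˢ Icc (-L) L,
      ‖iteratedDeriv j (transportCoeff W l p.1) p.2‖ ≤ C :=
    (isCompact_Icc.prod isCompact_Icc).exists_bound_of_continuousOn
      ((fiberSmooth_transportCoeff hW l).2 j).continuousOn
  choose C hC using h
  refine ⟨∑ l ∈ Finset.range (k + 1), ∑ j ∈ Finset.range (n + 1), |C l j|,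
    by positivity, fun l hl j hj x hx y hy => ?_⟩
  calc |iteratedDeriv j (transportCoeff W l x) y| ≤ |C l j| :=
        (hC l j (x, y) ⟨hx, hy⟩).trans (le_abs_self _)
    _ ≤ ∑ j ∈ Finset.range (n + 1), |C l j| :=
        Finset.single_le_sum (f := fun j => |C l j|) (fun _ _ => abs_nonneg _)
          (Finset.mem_range.2 (by omega))
    _ ≤ _ := Finset.single_le_sum (f := fun l => ∑ j ∈ Finset.range (n + 1), |C l j|)
          (fun _ _ => by positivity) (Finset.mem_range.2 (by omega))

end smooth

/-- The transport coefficients at `(x, y)` only depend on the potential between `x` and `y`. Here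
`W₁` is arbitrary outside `[a, b]`, and `y` may be an endpoint. -/
theorem transportCoeff_congr {W₁ W : ℝ → ℝ} {a b : ℝ} (h : EqOn W₁ W (Icc a b)) (l : ℕ) {x y : ℝ}
    (hx : x ∈ Ioo a b) (hy : y ∈ Icc a b) : transportCoeff W₁ l x y = transportCoeff W l x y := by
  induction l generalizing y with
  | zero => rfl
  | succ l ih =>
    simp only [transportCoeff_succ, segAvg]
    refine intervalIntegral.integral_congr_Ioo_of_le zero_le_one fun s hs => ?_
    have hz : x + s * (y - x) ∈ Ioo a b := by
      constructor
      · nlinarith [hx.1, hy.1, hs.1, hs.2, mul_pos hs.1 (sub_pos.2 hx.1),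
          mul_nonneg hs.1.le (sub_nonneg.2 hy.1), mul_pos (sub_pos.2 hs.2) (sub_pos.2 hx.1)]
      · nlinarith [hx.2, hy.2, hs.1, hs.2,
          mul_nonneg hs.1.le (sub_nonneg.2 hy.2), mul_pos (sub_pos.2 hs.2) (sub_pos.2 hx.2)]
    have he : transportCoeff W₁ l x =ᶠ[𝓝 (x + s * (y - x))] transportCoeff W l x := by
      filter_upwards [Ioo_mem_nhds hz.1 hz.2] with z hz using ih (Ioo_subset_Icc_self hz)
    simp only [transportSource, he.deriv.deriv_eq, he.eq_of_nhds, h (Ioo_subset_Icc_self hz)]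

theorem deriv_transportCoeff_congr {W₁ W : ℝ → ℝ} (hW₁ : ContDiff ℝ ∞ W₁) (hW : ContDiff ℝ ∞ W)
    {a b : ℝ}
    (h : EqOn W₁ W (Icc a b)) (l : ℕ) {x y : ℝ} (hx : x ∈ Ioo a b) (hy : y ∈ Icc a b) :
    deriv (transportCoeff W₁ l x) y = deriv (transportCoeff W l x) y := by
  have hu : UniqueDiffWithinAt ℝ (Icc a b) y := uniqueDiffOn_Icc (hx.1.trans hx.2) y hy
  rw [← ((fiberSmooth_transportCoeff hW₁ l).differentiableAt x y).derivWithin hu,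
    ← ((fiberSmooth_transportCoeff hW l).differentiableAt x y).derivWithin hu]
  exact derivWithin_congr (fun z hz => transportCoeff_congr h l hx hz)
    (transportCoeff_congr h l hx hy)

/-! ### The Gaussian kernel -/

theorem gaussKernel_nonneg (t x y : ℝ) : 0 ≤ gaussKernel t x y := by
  unfold gaussKernel
  positivity

theorem gaussKernel_eq_gaussianPDFReal {t : ℝ} (ht : 0 < t) (x y : ℝ) :
    gaussKernel t x y = ProbabilityTheory.gaussianPDFReal y (2 * t).toNNReal x := by
  simp only [gaussKernel, ProbabilityTheory.gaussianPDFReal, one_div,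
    Real.coe_toNNReal (2 * t) (by positivity)]
  congr 2
  · congr 1
    ring
  · congr 1
    ring

theorem integrable_gaussKernel {t : ℝ} (ht : 0 < t) (y : ℝ) :
    Integrable fun x => gaussKernel t x y := by
  simp only [gaussKernel_eq_gaussianPDFReal ht]
  exact ProbabilityTheory.integrable_gaussianPDFReal _ _

theorem integral_gaussKernel {t : ℝ} (ht : 0 < t) (y : ℝ) :
    ∫ x, gaussKernel t x y = 1 := by
  simp only [gaussKernel_eq_gaussianPDFReal ht]
  exact ProbabilityTheory.integral_gaussianPDFReal_eq_one _
    (fun h => (Real.toNNReal_pos.2 (by positivity : 0 < 2 * t)).ne' h)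

theorem gaussKernel_symm (t x y : ℝ) : gaussKernel t x y = gaussKernel t y x := by
  simp only [gaussKernel]
  congr 3
  ring

theorem intervalIntegral_gaussKernel_le {t : ℝ} (ht : 0 < t) {a b : ℝ} (hab : a ≤ b) (y : ℝ) :
    ∫ x in a..b, gaussKernel t x y ≤ 1 := by
  rw [intervalIntegral.integral_of_le hab, ← integral_gaussKernel ht y]
  exact setIntegral_le_integral (integrable_gaussKernel ht y)
    (Eventually.of_forall fun _ => gaussKernel_nonneg _ _ _)

theorem inv_sqrt_four_pi_le {t : ℝ} (ht : 0 < t) :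
    1 / Real.sqrt (4 * Real.pi * t) ≤ t ^ (-(1 / 2) : ℝ) := by
  rw [Real.rpow_neg ht.le, ← Real.sqrt_eq_rpow, one_div]
  gcongr
  nlinarith [Real.pi_gt_three]

theorem gaussKernel_le {t : ℝ} (ht : 0 < t) (x y : ℝ) : gaussKernel t x y ≤ t ^ (-(1 / 2) : ℝ) := by
  calc gaussKernel t x y ≤ 1 / Real.sqrt (4 * Real.pi * t) * 1 := by
        unfold gaussKernel
        gcongr
        rw [Real.exp_le_one_iff, neg_div]
        have : 0 ≤ (x - y) ^ 2 / (4 * t) := by positivity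
        linarith
    _ ≤ _ := by rw [mul_one]; exact inv_sqrt_four_pi_le ht

/-- Away from the diagonal, the heat kernel vanishes to infinite order as `t → 0`. -/
theorem exists_gaussKernel_le_pow {δ : ℝ} (hδ : 0 < δ) (n : ℕ) :
    ∃ C, 0 ≤ C ∧ ∀ t ∈ Ioc (0 : ℝ) 1, ∀ x y, δ ≤ |x - y| → gaussKernel t x y ≤ C * t ^ n := by
  refine ⟨(n + 1).factorial * (4 / δ ^ 2) ^ (n + 1), by positivity, fun t ht x y hxy => ?_⟩
  have ht0 := ht.1
  have h1 : δ ^ 2 / (4 * t) ≤ (x - y) ^ 2 / (4 * t) := by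
    refine div_le_div_of_nonneg_right ?_ (by positivity)
    rw [← sq_abs (x - y)]
    gcongr
  have h2 := Real.pow_div_factorial_le_exp (δ ^ 2 / (4 * t)) (by positivity) (n + 1)
  have h3 : Real.exp (-(x - y) ^ 2 / (4 * t)) ≤
      (n + 1).factorial * (4 * t / δ ^ 2) ^ (n + 1) := by
    rw [neg_div, Real.exp_neg]
    calc (Real.exp ((x - y) ^ 2 / (4 * t)))⁻¹ ≤
          ((δ ^ 2 / (4 * t)) ^ (n + 1) / (n + 1).factorial)⁻¹ := by
          gcongr
          exact h2.trans (Real.exp_le_exp.2 h1)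
      _ = _ := by
          rw [inv_div, div_eq_mul_inv, ← inv_pow, inv_div]
  have h4 : 1 / Real.sqrt (4 * Real.pi * t) ≤ t⁻¹ := by
    refine (inv_sqrt_four_pi_le ht0).trans ?_
    rw [← Real.rpow_neg_one]
    exact Real.rpow_le_rpow_of_exponent_ge ht0 ht.2 (by norm_num)
  calc gaussKernel t x y ≤ t⁻¹ * ((n + 1).factorial * (4 * t / δ ^ 2) ^ (n + 1)) := by
        unfold gaussKernel
        gcongr
    _ = _ := by
        rw [show 4 * t / δ ^ 2 = 4 / δ ^ 2 * t by ring, mul_pow, pow_succ t]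
        field_simp

/-- The heat kernel is an approximate identity, tested on an interval. -/
theorem tendsto_integral_gaussKernel {ℓ x : ℝ} (hx : x ∈ Ioo 0 ℓ) {φ : ℝ → ℂ}
    (hφ : ContinuousOn φ (Icc 0 ℓ)) :
    Tendsto (fun t => ∫ z in (0 : ℝ)..ℓ, (gaussKernel t x z : ℂ) * φ z) (𝓝[>] 0) (𝓝 (φ x)) := by
  have hℓ : (0 : ℝ) ≤ ℓ := (hx.1.trans hx.2).le
  set g : ℝ → ℂ := indicator (Icc 0 ℓ) φ
  have hg : Integrable g := (integrable_indicator_iff measurableSet_Icc).2 hφ.integrableOn_Icc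
  have hgx : ContinuousAt g x := by
    refine (hφ.continuousAt (Icc_mem_nhds hx.1 hx.2)).congr ?_
    filter_upwards [Icc_mem_nhds hx.1 hx.2] with z hz using (indicator_of_mem hz _).symm
  have key := tendsto_integral_comp_smul_smul_of_integrable' (μ := volume) (x₀ := x)
    (φ := fun w : ℝ => gaussKernel 1 w 0) (fun w => gaussKernel_nonneg _ _ _)
    (integral_gaussKernel one_pos 0) ?_ hg hgx
  · have hc : Tendsto (fun t : ℝ => (Real.sqrt t)⁻¹) (𝓝[>] 0) atTop := by
      refine tendsto_inv_nhdsGT_zero.comp (tendsto_nhdsWithin_iff.2 ⟨?_, ?_⟩)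
      · have := Real.continuous_sqrt.tendsto 0
        rw [Real.sqrt_zero] at this
        exact this.mono_left nhdsWithin_le_nhds
      · filter_upwards [self_mem_nhdsWithin] with t ht using Real.sqrt_pos.2 ht
    have hxg : g x = φ x := indicator_of_mem (Ioo_subset_Icc_self hx) _
    rw [hxg] at key
    refine (key.comp hc).congr' ?_
    filter_upwards [self_mem_nhdsWithin] with t ht
    have ht0 : (0 : ℝ) < t := ht
    rw [intervalIntegral.integral_of_le hℓ, ← integral_Icc_eq_integral_Ioc,
      ← integral_indicator measurableSet_Icc]
    simp only [Function.comp_def]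
    congr 1
    ext z
    by_cases hz : z ∈ Icc 0 ℓ
    · simp only [g, indicator_of_mem hz, Complex.real_smul]
      congr 2
      simp only [gaussKernel, Module.finrank_self, pow_one, smul_eq_mul, mul_one, sub_zero]
      rw [Real.sqrt_mul (by positivity) t, ← mul_assoc]
      congr 1
      · field_simp
      · congr 1
        rw [mul_pow, inv_pow, Real.sq_sqrt ht0.le]
        field_simp
    · simp [g, indicator_of_notMem hz]
  · have := (tendsto_rpow_abs_mul_exp_neg_mul_sq_cocompact (a := 1 / 4) (by norm_num) 1).const_mul
      (1 / Real.sqrt (4 * Real.pi))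
    rw [mul_zero] at this
    rw [Metric.cobounded_eq_cocompact]
    refine this.congr fun w => ?_
    simp only [gaussKernel, Module.finrank_self, pow_one, Real.rpow_one, mul_one, sub_zero,
      Real.norm_eq_abs]
    rw [show -(1 / 4) * w ^ 2 = -w ^ 2 / 4 by ring]
    ring

/-! ### The parametrix on the line -/

theorem hasDerivAt_gaussKernel_time {t : ℝ} (ht : 0 < t) (x y : ℝ) :
    HasDerivAt (fun t => gaussKernel t x y)
      (gaussKernel t x y * ((x - y) ^ 2 / (4 * t ^ 2) - 1 / (2 * t))) t := by
  have hp : 0 < 4 * Real.pi * t := by positivity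
  have hs := Real.sqrt_pos.2 hp
  have h1 : HasDerivAt (fun t => 4 * Real.pi * t) (4 * Real.pi) t := by
    simpa using (hasDerivAt_id t).const_mul (4 * Real.pi)
  have h2 : HasDerivAt (fun t => 4 * t) 4 t := by
    simpa using (hasDerivAt_id t).const_mul (4 : ℝ)
  have h3 := ((h1.sqrt hp.ne').inv hs.ne').mul
    ((((hasDerivAt_const t (-(x - y) ^ 2)).div h2 (by positivity))).exp)
  simp only [gaussKernel, one_div]
  refine h3.congr_deriv ?_
  have hsq : Real.sqrt (4 * Real.pi * t) ^ 2 = 4 * Real.pi * t := Real.sq_sqrt hp.le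
  simp only [Pi.inv_apply, Pi.div_apply]
  rw [hsq]
  field_simp
  ring

theorem hasDerivAt_gaussKernel_space (t x y : ℝ) :
    HasDerivAt (fun y => gaussKernel t x y) (gaussKernel t x y * ((x - y) / (2 * t))) y := by
  have h1 : HasDerivAt (fun y => -(x - y) ^ 2 / (4 * t)) (2 * (x - y) / (4 * t)) y := by
    refine ((((hasDerivAt_id y).const_sub x).pow 2).neg.div_const (4 * t)).congr_deriv ?_
    simp
  refine (h1.exp.const_mul (1 / Real.sqrt (4 * Real.pi * t))).congr_deriv ?_
  rw [gaussKernel, show 2 * (x - y) / (4 * t) = (x - y) / (2 * t) by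
    rw [show 4 * t = 2 * (2 * t) by ring, mul_div_mul_left _ _ (two_ne_zero)]]
  ring

/-- The time derivative of `lineParametrix`. -/
noncomputable def lineParametrixT (W : ℝ → ℝ) (k : ℕ) (t x y : ℝ) : ℝ :=
  gaussKernel t x y * (((x - y) ^ 2 / (4 * t ^ 2) - 1 / (2 * t)) *
      ∑ l ∈ Finset.range (k + 1), transportCoeff W l x y * t ^ l +
    ∑ l ∈ Finset.range (k + 1), transportCoeff W l x y * (l * t ^ (l - 1)))

/-- The `y`-derivative of `lineParametrix`. -/
noncomputable def lineParametrixY (W : ℝ → ℝ) (k : ℕ) (t x y : ℝ) : ℝ :=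
  gaussKernel t x y * ((x - y) / (2 * t) *
      ∑ l ∈ Finset.range (k + 1), transportCoeff W l x y * t ^ l +
    ∑ l ∈ Finset.range (k + 1), deriv (transportCoeff W l x) y * t ^ l)

/-- The second `y`-derivative of `lineParametrix`. -/
noncomputable def lineParametrixYY (W : ℝ → ℝ) (k : ℕ) (t x y : ℝ) : ℝ :=
  gaussKernel t x y * (((x - y) ^ 2 / (4 * t ^ 2) - 1 / (2 * t)) *
      ∑ l ∈ Finset.range (k + 1), transportCoeff W l x y * t ^ l +
    (x - y) / t * ∑ l ∈ Finset.range (k + 1), deriv (transportCoeff W l x) y * t ^ l +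
    ∑ l ∈ Finset.range (k + 1), deriv (deriv (transportCoeff W l x)) y * t ^ l)

/-- The parametrix on the line, multiplied by a cut-off function `R` in the variable `y`. -/
noncomputable def cutParametrix (k : ℕ) (R W : ℝ → ℝ) (t x y : ℝ) : ℝ :=
  R y * lineParametrix W k t x y

/-- The time derivative of `cutParametrix`. -/
noncomputable def cutParametrixT (k : ℕ) (R W : ℝ → ℝ) (t x y : ℝ) : ℝ :=
  R y * lineParametrixT W k t x y

/-- The `y`-derivative of `cutParametrix`. -/
noncomputable def cutParametrixY (k : ℕ) (R W : ℝ → ℝ) (t x y : ℝ) : ℝ :=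
  deriv R y * lineParametrix W k t x y + R y * lineParametrixY W k t x y

/-- The second `y`-derivative of `cutParametrix`. -/
noncomputable def cutParametrixYY (k : ℕ) (R W : ℝ → ℝ) (t x y : ℝ) : ℝ :=
  deriv (deriv R) y * lineParametrix W k t x y + 2 * (deriv R y * lineParametrixY W k t x y) +
    R y * lineParametrixYY W k t x y

/-- The defect of `cutParametrix` in the heat equation. -/
noncomputable def cutDefect (k : ℕ) (R W : ℝ → ℝ) (t x y : ℝ) : ℝ :=
  cutParametrixT k R W t x y - cutParametrixYY k R W t x y - W y * cutParametrix k R W t x y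

section smooth

variable {R W : ℝ → ℝ} (hR : ContDiff ℝ ∞ R) (hW : ContDiff ℝ ∞ W) (k : ℕ)

theorem hasDerivAt_lineParametrix_time (W : ℝ → ℝ) (k : ℕ) {t : ℝ} (ht : 0 < t) (x y : ℝ) :
    HasDerivAt (fun t => lineParametrix W k t x y) (lineParametrixT W k t x y) t := by
  have h : HasDerivAt (fun t => ∑ l ∈ Finset.range (k + 1), transportCoeff W l x y * t ^ l)
      (∑ l ∈ Finset.range (k + 1), transportCoeff W l x y * (l * t ^ (l - 1))) t :=
    HasDerivAt.fun_sum fun l _ => (hasDerivAt_pow l t).const_mul _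
  refine ((hasDerivAt_gaussKernel_time ht x y).mul h).congr_deriv ?_
  rw [lineParametrixT]
  ring

theorem hasDerivAt_cutParametrix_time (R W : ℝ → ℝ) (k : ℕ) {t : ℝ} (ht : 0 < t) (x y : ℝ) :
    HasDerivAt (fun t => cutParametrix k R W t x y) (cutParametrixT k R W t x y) t :=
  (hasDerivAt_lineParametrix_time W k ht x y).const_mul (R y)

include hW in
theorem hasDerivAt_lineParametrix (t x y : ℝ) :
    HasDerivAt (lineParametrix W k t x) (lineParametrixY W k t x y) y := by
  have h : HasDerivAt (fun y => ∑ l ∈ Finset.range (k + 1), transportCoeff W l x y * t ^ l)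
      (∑ l ∈ Finset.range (k + 1), deriv (transportCoeff W l x) y * t ^ l) y :=
    HasDerivAt.fun_sum fun l _ =>
      ((fiberSmooth_transportCoeff hW l).hasDerivAt x y).mul_const _
  refine ((hasDerivAt_gaussKernel_space t x y).mul h).congr_deriv ?_
  rw [lineParametrixY]
  ring

include hW in
theorem hasDerivAt_lineParametrixY {t : ℝ} (ht : 0 < t) (x y : ℝ) :
    HasDerivAt (lineParametrixY W k t x) (lineParametrixYY W k t x y) y := by
  have h : HasDerivAt (fun y => ∑ l ∈ Finset.range (k + 1), transportCoeff W l x y * t ^ l)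
      (∑ l ∈ Finset.range (k + 1), deriv (transportCoeff W l x) y * t ^ l) y :=
    HasDerivAt.fun_sum fun l _ =>
      ((fiberSmooth_transportCoeff hW l).hasDerivAt x y).mul_const _
  have h' : HasDerivAt (fun y => ∑ l ∈ Finset.range (k + 1), deriv (transportCoeff W l x) y * t ^ l)
      (∑ l ∈ Finset.range (k + 1), deriv (deriv (transportCoeff W l x)) y * t ^ l) y :=
    HasDerivAt.fun_sum fun l _ =>
      ((fiberSmooth_transportCoeff hW l).deriv.hasDerivAt x y).mul_const _
  have h1 : HasDerivAt (fun y => (x - y) / (2 * t)) (-1 / (2 * t)) y :=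
    ((hasDerivAt_id y).const_sub x).div_const (2 * t)
  refine ((hasDerivAt_gaussKernel_space t x y).mul ((h1.mul h).add h')).congr_deriv ?_
  simp only [lineParametrixYY, Pi.mul_apply, Pi.add_apply]
  field_simp
  ring

include hR hW in
theorem hasDerivAt_cutParametrix (t x y : ℝ) :
    HasDerivAt (cutParametrix k R W t x) (cutParametrixY k R W t x y) y :=
  ((hR.differentiable (by simp)).differentiableAt.hasDerivAt).mul
    (hasDerivAt_lineParametrix hW k t x y)

include hR hW in
theorem hasDerivAt_cutParametrixY {t : ℝ} (ht : 0 < t) (x y : ℝ) :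
    HasDerivAt (cutParametrixY k R W t x) (cutParametrixYY k R W t x y) y := by
  have hR' := (contDiff_infty_iff_deriv.1 hR).2
  refine (((hR'.differentiable (by simp)).differentiableAt.hasDerivAt.mul
    (hasDerivAt_lineParametrix hW k t x y)).add
    ((hR.differentiable (by simp)).differentiableAt.hasDerivAt.mul
      (hasDerivAt_lineParametrixY hW k ht x y))).congr_deriv ?_
  rw [cutParametrixYY]
  ring

include hW in
/-- The transport equations make all powers of `t` below `t ^ k` cancel. -/
theorem lineParametrix_defect {t : ℝ} (ht : 0 < t) (x y : ℝ) :
    lineParametrixT W k t x y - lineParametrixYY W k t x y - W y * lineParametrix W k t x y =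
      -(t ^ k * (gaussKernel t x y * transportSource W k x y)) := by
  have hsum : ∑ l ∈ Finset.range (k + 1), transportCoeff W l x y * (l * t ^ (l - 1)) -
      (x - y) / t * ∑ l ∈ Finset.range (k + 1), deriv (transportCoeff W l x) y * t ^ l -
      ∑ l ∈ Finset.range (k + 1), transportSource W l x y * t ^ l =
      -(t ^ k * transportSource W k x y) := by
    have h0 : deriv (transportCoeff W 0 x) y = 0 :=
      deriv_const y (1 : ℝ)
    induction k with
    | zero => simp [h0]
    | succ k ih =>
      rw [Finset.sum_range_succ, Finset.sum_range_succ _ (k + 1), Finset.sum_range_succ _ (k + 1)]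
      have ht' := transport_equation hW k x y
      have : (x - y) / t * (deriv (transportCoeff W (k + 1) x) y * t ^ (k + 1)) =
          (x - y) * deriv (transportCoeff W (k + 1) x) y * t ^ k := by
        field_simp
        ring
      rw [mul_add, this]
      simp only [Nat.add_sub_cancel, Nat.cast_add, Nat.cast_one]
      linear_combination ih + t ^ k * ht'
  have hsrc : ∑ l ∈ Finset.range (k + 1), transportSource W l x y * t ^ l =
      ∑ l ∈ Finset.range (k + 1), deriv (deriv (transportCoeff W l x)) y * t ^ l +
      W y * ∑ l ∈ Finset.range (k + 1), transportCoeff W l x y * t ^ l := by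
    rw [Finset.mul_sum, ← Finset.sum_add_distrib]
    refine Finset.sum_congr rfl fun l _ => ?_
    rw [transportSource]
    ring
  rw [lineParametrixT, lineParametrixYY, lineParametrix]
  linear_combination gaussKernel t x y * hsum + gaussKernel t x y * hsrc

include hW in
theorem cutDefect_eq {t : ℝ} (ht : 0 < t) (x y : ℝ) :
    cutDefect k R W t x y = -(R y * (t ^ k * (gaussKernel t x y * transportSource W k x y)) +
      2 * (deriv R y * lineParametrixY W k t x y) +
      deriv (deriv R) y * lineParametrix W k t x y) := by
  have := lineParametrix_defect hW k ht x y
  rw [cutDefect, cutParametrixT, cutParametrixYY, cutParametrix]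
  linear_combination R y * this

theorem continuousOn_gaussKernel :
    ContinuousOn (fun p : ℝ × ℝ × ℝ => gaussKernel p.1 p.2.1 p.2.2) (Ioi 0 ×ˢ univ) := by
  intro p hp
  have hp0 : (0 : ℝ) < p.1 := hp.1
  have h1 : Real.sqrt (4 * Real.pi * p.1) ≠ 0 := (Real.sqrt_pos.2 (by positivity)).ne'
  have h2 : 4 * p.1 ≠ 0 := by positivity
  refine ContinuousAt.continuousWithinAt ?_
  unfold gaussKernel
  fun_prop (disch := assumption)

theorem continuousOn_sum_mul_pow {v : ℕ → ℝ → ℝ → ℝ} (hv : ∀ l, FiberSmooth (v l)) (k : ℕ)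
    {c : ℕ → ℝ → ℝ} (hc : ∀ l, Continuous (c l)) (s : Set (ℝ × ℝ × ℝ)) :
    ContinuousOn (fun p : ℝ × ℝ × ℝ => ∑ l ∈ Finset.range (k + 1),
      v l p.2.1 p.2.2 * c l p.1) s := by
  refine Continuous.continuousOn (continuous_finsetSum _ fun l _ => ?_)
  exact ((hv l).continuous.comp continuous_snd).mul ((hc l).comp continuous_fst)

include hW in
theorem continuousOn_lineParametrix :
    ContinuousOn (fun p : ℝ × ℝ × ℝ => lineParametrix W k p.1 p.2.1 p.2.2) (Ioi 0 ×ˢ univ) :=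
  continuousOn_gaussKernel.mul (continuousOn_sum_mul_pow (fiberSmooth_transportCoeff hW) k
    (c := fun l t => t ^ l) (fun l => continuous_pow l) _)

include hW in
theorem continuousOn_lineParametrixT :
    ContinuousOn (fun p : ℝ × ℝ × ℝ => lineParametrixT W k p.1 p.2.1 p.2.2) (Ioi 0 ×ˢ univ) := by
  refine continuousOn_gaussKernel.mul ((ContinuousOn.mul ?_
    (continuousOn_sum_mul_pow (fiberSmooth_transportCoeff hW) k
    (c := fun l t => t ^ l) (fun l => continuous_pow l) _)).add
    (continuousOn_sum_mul_pow (fiberSmooth_transportCoeff hW) k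
    (c := fun l t => l * t ^ (l - 1)) (fun l => by fun_prop) _))
  intro p hp
  have hp0 : (0 : ℝ) < p.1 := hp.1
  have h1 : 4 * p.1 ^ 2 ≠ 0 := by positivity
  have h2 : 2 * p.1 ≠ 0 := by positivity
  exact ContinuousAt.continuousWithinAt (by fun_prop (disch := assumption))

include hW in
theorem continuousOn_lineParametrixY :
    ContinuousOn (fun p : ℝ × ℝ × ℝ => lineParametrixY W k p.1 p.2.1 p.2.2) (Ioi 0 ×ˢ univ) := by
  refine continuousOn_gaussKernel.mul ((ContinuousOn.mul ?_
    (continuousOn_sum_mul_pow (fiberSmooth_transportCoeff hW) k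
    (c := fun l t => t ^ l) (fun l => continuous_pow l) _)).add
    (continuousOn_sum_mul_pow (fun l => (fiberSmooth_transportCoeff hW l).deriv) k
    (c := fun l t => t ^ l) (fun l => continuous_pow l) _))
  intro p hp
  have hp0 : (0 : ℝ) < p.1 := hp.1
  have h2 : 2 * p.1 ≠ 0 := by positivity
  exact ContinuousAt.continuousWithinAt (by fun_prop (disch := assumption))

include hW in
theorem continuousOn_lineParametrixYY :
    ContinuousOn (fun p : ℝ × ℝ × ℝ => lineParametrixYY W k p.1 p.2.1 p.2.2) (Ioi 0 ×ˢ univ) := by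
  refine continuousOn_gaussKernel.mul (((ContinuousOn.mul ?_
    (continuousOn_sum_mul_pow (fiberSmooth_transportCoeff hW) k
    (c := fun l t => t ^ l) (fun l => continuous_pow l) _)).add (ContinuousOn.mul ?_
    (continuousOn_sum_mul_pow (fun l => (fiberSmooth_transportCoeff hW l).deriv) k
    (c := fun l t => t ^ l) (fun l => continuous_pow l) _))).add
    (continuousOn_sum_mul_pow (fun l => (fiberSmooth_transportCoeff hW l).deriv.deriv) k
    (c := fun l t => t ^ l) (fun l => continuous_pow l) _))
  all_goals
    intro p hp
    have hp0 : (0 : ℝ) < p.1 := hp.1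
    have h1 : 4 * p.1 ^ 2 ≠ 0 := by positivity
    have h2 : 2 * p.1 ≠ 0 := by positivity
    have h3 : p.1 ≠ 0 := hp0.ne'
    exact ContinuousAt.continuousWithinAt (by fun_prop (disch := assumption))

include hR in
theorem continuous_cutoff_snd : Continuous (fun p : ℝ × ℝ × ℝ => R p.2.2) ∧
    Continuous (fun p : ℝ × ℝ × ℝ => deriv R p.2.2) ∧
    Continuous (fun p : ℝ × ℝ × ℝ => deriv (deriv R) p.2.2) := by
  have h1 := (contDiff_infty_iff_deriv.1 hR).2
  have h2 := (contDiff_infty_iff_deriv.1 h1).2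
  have c0 := hR.continuous
  have c1 := h1.continuous
  have c2 := h2.continuous
  exact ⟨by fun_prop, by fun_prop, by fun_prop⟩

include hR hW in
theorem continuousOn_cutParametrix :
    ContinuousOn (fun p : ℝ × ℝ × ℝ => cutParametrix k R W p.1 p.2.1 p.2.2) (Ioi 0 ×ˢ univ) :=
  (continuous_cutoff_snd hR).1.continuousOn.mul (continuousOn_lineParametrix hW k)

include hR hW in
theorem continuousOn_cutParametrixT :
    ContinuousOn (fun p : ℝ × ℝ × ℝ => cutParametrixT k R W p.1 p.2.1 p.2.2) (Ioi 0 ×ˢ univ) :=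
  (continuous_cutoff_snd hR).1.continuousOn.mul (continuousOn_lineParametrixT hW k)

include hR hW in
theorem continuousOn_cutParametrixYY :
    ContinuousOn (fun p : ℝ × ℝ × ℝ => cutParametrixYY k R W p.1 p.2.1 p.2.2) (Ioi 0 ×ˢ univ) := by
  obtain ⟨h0, h1, h2⟩ := continuous_cutoff_snd hR
  exact ((h2.continuousOn.mul (continuousOn_lineParametrix hW k)).add
    (continuousOn_const.mul (h1.continuousOn.mul (continuousOn_lineParametrixY hW k)))).add
    (h0.continuousOn.mul (continuousOn_lineParametrixYY hW k))

theorem abs_sum_mul_pow_le {v : ℕ → ℝ} {C : ℝ} (hv : ∀ l ≤ k, |v l| ≤ C) {t : ℝ}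
    (ht : t ∈ Ioc (0 : ℝ) 1) : |∑ l ∈ Finset.range (k + 1), v l * t ^ l| ≤ (k + 1) * C := by
  refine (Finset.abs_sum_le_sum_abs _ _).trans ?_
  calc ∑ l ∈ Finset.range (k + 1), |v l * t ^ l| ≤ ∑ _l ∈ Finset.range (k + 1), C := by
        refine Finset.sum_le_sum fun l hl => ?_
        rw [abs_mul, abs_of_nonneg (pow_nonneg ht.1.le l)]
        have := hv l (by simpa [Nat.lt_succ_iff] using hl)
        exact (mul_le_mul this (pow_le_one₀ ht.1.le ht.2) (pow_nonneg ht.1.le _)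
          ((abs_nonneg _).trans this)).trans (mul_one _).le
    _ = (k + 1) * C := by simp

include hW in
theorem exists_lineParametrix_le (L : ℝ) :
    ∃ C, 0 ≤ C ∧ ∀ t ∈ Ioc (0 : ℝ) 1, ∀ x ∈ Icc (-L) L, ∀ y ∈ Icc (-L) L,
      |lineParametrix W k t x y| ≤ C * gaussKernel t x y := by
  obtain ⟨C, hC0, hC⟩ := exists_bound_iteratedDeriv_transportCoeff hW k 0 L
  refine ⟨(k + 1) * C, by positivity, fun t ht x hx y hy => ?_⟩
  rw [lineParametrix, abs_mul, abs_of_nonneg (gaussKernel_nonneg _ _ _), mul_comm]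
  refine mul_le_mul_of_nonneg_right (abs_sum_mul_pow_le k (fun l hl => ?_) ht)
    (gaussKernel_nonneg _ _ _)
  simpa using hC l hl 0 le_rfl x hx y hy

include hW in
theorem exists_lineParametrixY_le (L : ℝ) :
    ∃ C, 0 ≤ C ∧ ∀ t ∈ Ioc (0 : ℝ) 1, ∀ x ∈ Icc (-L) L, ∀ y ∈ Icc (-L) L,
      |lineParametrixY W k t x y| ≤ C * (gaussKernel t x y * t⁻¹) := by
  obtain ⟨C, hC0, hC⟩ := exists_bound_iteratedDeriv_transportCoeff hW k 1 L
  refine ⟨(|L| + 1) * ((k + 1) * C), by positivity, fun t ht x hx y hy => ?_⟩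
  have ht0 := ht.1
  have hG := gaussKernel_nonneg t x y
  have h0 := abs_sum_mul_pow_le k (v := fun l => transportCoeff W l x y)
    (fun l hl => by simpa using hC l hl 0 (by omega) x hx y hy) ht
  have h1 := abs_sum_mul_pow_le k (v := fun l => deriv (transportCoeff W l x) y)
    (fun l hl => by simpa using hC l hl 1 le_rfl x hx y hy) ht
  have h2 : |(x - y) / (2 * t)| ≤ |L| * t⁻¹ := by
    rw [abs_div, abs_of_pos (by positivity : 0 < 2 * t), div_le_iff₀ (by positivity),
      mul_assoc, show t⁻¹ * (2 * t) = 2 by field_simp, abs_le]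
    have := le_abs_self L
    constructor <;> linarith [hx.1, hx.2, hy.1, hy.2]
  have h3 : 1 ≤ t⁻¹ := (one_le_inv₀ ht0).2 ht.2
  rw [lineParametrixY, abs_mul, abs_of_nonneg hG]
  calc _ ≤ gaussKernel t x y * (|L| * t⁻¹ * ((k + 1) * C) + t⁻¹ * ((k + 1) * C)) := by
        refine mul_le_mul_of_nonneg_left ((abs_add_le _ _).trans (add_le_add ?_ ?_)) hG
        · rw [abs_mul]
          exact mul_le_mul h2 h0 (abs_nonneg _) (by positivity)
        · exact h1.trans (le_mul_of_one_le_left (by positivity) h3)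
    _ = _ := by ring

include hR hW in
/-- The defect is of order `t ^ (k - 1/2)` if the derivatives of the cut-off function vanish near
the diagonal. -/
theorem exists_cutDefect_le {L δ : ℝ} (hδ : 0 < δ) {X Y : Set ℝ} (hX : X ⊆ Icc (-L) L)
    (hY : Y ⊆ Icc (-L) L)
    (hXY : ∀ x ∈ X, ∀ y ∈ Y, |x - y| < δ → deriv R y = 0 ∧ deriv (deriv R) y = 0) :
    ∃ C, 0 ≤ C ∧ ∀ t ∈ Ioc (0 : ℝ) 1, ∀ x ∈ X, ∀ y ∈ Y,
      |cutDefect k R W t x y| ≤ C * t ^ ((k : ℝ) - 1 / 2) := by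
  obtain ⟨C₁, hC₁, h₁⟩ := exists_lineParametrix_le hW k L
  obtain ⟨C₂, hC₂, h₂⟩ := exists_lineParametrixY_le hW k L
  obtain ⟨C₃, hC₃, h₃⟩ := exists_gaussKernel_le_pow hδ (k + 1)
  obtain ⟨B, hB⟩ : ∃ B, ∀ y ∈ Icc (-L) L, |R y| ≤ B ∧ |deriv R y| ≤ B ∧
      |deriv (deriv R) y| ≤ B := by
    have c1 := (contDiff_infty_iff_deriv.1 hR).2
    have c2 := (contDiff_infty_iff_deriv.1 c1).2
    obtain ⟨B₀, h0⟩ := isCompact_Icc.exists_bound_of_continuousOn (s := Icc (-L) L)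
      hR.continuous.continuousOn
    obtain ⟨B₁, h1⟩ := isCompact_Icc.exists_bound_of_continuousOn (s := Icc (-L) L)
      c1.continuous.continuousOn
    obtain ⟨B₂, h2⟩ := isCompact_Icc.exists_bound_of_continuousOn (s := Icc (-L) L)
      c2.continuous.continuousOn
    exact ⟨max B₀ (max B₁ B₂), fun y hy => ⟨(h0 y hy).trans (le_max_left _ _),
      (h1 y hy).trans ((le_max_left _ _).trans (le_max_right _ _)),
      (h2 y hy).trans ((le_max_right _ _).trans (le_max_right _ _))⟩⟩
  obtain ⟨D, hD⟩ := (isCompact_Icc.prod isCompact_Icc).exists_bound_of_continuousOn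
    (s := Icc (-L) L ×ˢ Icc (-L) L) (fiberSmooth_transportSource hW k).continuous.continuousOn
  refine ⟨|B| * |D| + 2 * (|B| * (C₂ * C₃)) + |B| * (C₁ * C₃), by positivity,
    fun t ht x hx y hy => ?_⟩
  have ht0 := ht.1
  obtain ⟨b0, b1, b2⟩ := hB y (hY hy)
  have hG := gaussKernel_nonneg t x y
  have hpow : t ^ k * t ^ (-(1 / 2) : ℝ) = t ^ ((k : ℝ) - 1 / 2) := by
    rw [← Real.rpow_natCast, ← Real.rpow_add ht0, sub_eq_add_neg]
  have hle : t ^ k ≤ t ^ ((k : ℝ) - 1 / 2) := by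
    rw [← Real.rpow_natCast]
    exact Real.rpow_le_rpow_of_exponent_ge ht0 ht.2 (by linarith)
  have hp := Real.rpow_nonneg ht0.le ((k : ℝ) - 1 / 2)
  have e1 : |R y * (t ^ k * (gaussKernel t x y * transportSource W k x y))| ≤
      |B| * |D| * t ^ ((k : ℝ) - 1 / 2) := by
    rw [abs_mul, abs_mul, abs_mul, abs_of_nonneg hG, abs_of_nonneg (pow_nonneg ht0.le k), ← hpow]
    calc _ ≤ |B| * (t ^ k * (t ^ (-(1 / 2) : ℝ) * |D|)) := by
          have hs : |transportSource W k x y| ≤ |D| :=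
            (hD (x, y) ⟨hX hx, hY hy⟩).trans (le_abs_self _)
          exact mul_le_mul (b0.trans (le_abs_self _)) (mul_le_mul_of_nonneg_left
            (mul_le_mul (gaussKernel_le ht0 x y) hs (abs_nonneg _) (by positivity))
            (by positivity)) (by positivity) (abs_nonneg _)
      _ = _ := by ring
  have e2 : |deriv R y * lineParametrixY W k t x y| ≤
      |B| * (C₂ * C₃) * t ^ ((k : ℝ) - 1 / 2) := by
    by_cases hxy : |x - y| < δ
    · rw [(hXY x hx y hy hxy).1, zero_mul, abs_zero]
      positivity
    · have := h₃ t ht x y (not_lt.1 hxy)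
      rw [abs_mul]
      calc _ ≤ |B| * (C₂ * (C₃ * t ^ (k + 1) * t⁻¹)) := by
            refine mul_le_mul (b1.trans (le_abs_self _)) ((h₂ t ht x (hX hx) y (hY hy)).trans ?_)
              (abs_nonneg _) (abs_nonneg _)
            gcongr
        _ = |B| * (C₂ * C₃) * t ^ k := by
            field_simp
            ring
        _ ≤ _ := by gcongr
  have e3 : |deriv (deriv R) y * lineParametrix W k t x y| ≤
      |B| * (C₁ * C₃) * t ^ ((k : ℝ) - 1 / 2) := by
    by_cases hxy : |x - y| < δ
    · rw [(hXY x hx y hy hxy).2, zero_mul, abs_zero]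
      positivity
    · have := h₃ t ht x y (not_lt.1 hxy)
      rw [abs_mul]
      calc _ ≤ |B| * (C₁ * (C₃ * t ^ k)) := by
            refine mul_le_mul (b2.trans (le_abs_self _)) ((h₁ t ht x (hX hx) y (hY hy)).trans ?_)
              (abs_nonneg _) (abs_nonneg _)
            gcongr
            exact this.trans (mul_le_mul_of_nonneg_left
              (pow_le_pow_of_le_one ht0.le ht.2 (Nat.le_succ k)) hC₃)
        _ = |B| * (C₁ * C₃) * t ^ k := by ring
        _ ≤ _ := by gcongr
  rw [cutDefect_eq hW k ht0, abs_neg]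
  refine (abs_add_le _ _).trans ((add_le_add (abs_add_le _ _) le_rfl).trans ?_)
  rw [abs_mul 2, abs_two]
  linarith

include hW in
/-- The parametrix on the line is an approximate identity. -/
theorem tendsto_integral_lineParametrix {ℓ x : ℝ} (hx : x ∈ Ioo 0 ℓ) {φ : ℝ → ℂ}
    (hφ : ContinuousOn φ (Icc 0 ℓ)) :
    Tendsto (fun t => ∫ z in (0 : ℝ)..ℓ, (lineParametrix W k t x z : ℂ) * φ z) (𝓝[>] 0)
      (𝓝 (φ x)) := by
  have hℓ : (0 : ℝ) ≤ ℓ := (hx.1.trans hx.2).le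
  obtain ⟨C, hC0, hC⟩ := exists_bound_iteratedDeriv_transportCoeff hW k 0 ℓ
  obtain ⟨B, hB⟩ := isCompact_Icc.exists_bound_of_continuousOn hφ
  have hsub : Icc 0 ℓ ⊆ Icc (-ℓ) ℓ := Icc_subset_Icc_left (by linarith)
  have hxm := hsub (Ioo_subset_Icc_self hx)
  have hGc (t : ℝ) (ht : 0 < t) : Continuous fun z => gaussKernel t x z := by
    unfold gaussKernel
    fun_prop
  have hSc (t : ℝ) : Continuous fun z =>
      ∑ l ∈ Finset.range (k + 1), transportCoeff W l x z * t ^ l :=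
    continuous_finsetSum _ fun l _ =>
      ((fiberSmooth_transportCoeff hW l).1 x).continuous.mul continuous_const
  -- the coefficients of positive order contribute `O(t)`
  have hdiff : Tendsto (fun t => ∫ z in (0 : ℝ)..ℓ,
      ((lineParametrix W k t x z : ℂ) * φ z - (gaussKernel t x z : ℂ) * φ z)) (𝓝[>] 0) (𝓝 0) := by
    refine squeeze_zero_norm' (a := fun t => (k : ℝ) * C * |B| * t) ?_ ?_
    · filter_upwards [Ioc_mem_nhdsGT (zero_lt_one (α := ℝ))] with t ht
      have ht0 := ht.1
      have hb : ∀ z ∈ Icc 0 ℓ, ‖(lineParametrix W k t x z : ℂ) * φ z -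
          (gaussKernel t x z : ℂ) * φ z‖ ≤ k * C * |B| * t * gaussKernel t x z := by
        intro z hz
        have hS : |∑ l ∈ Finset.range (k + 1), transportCoeff W l x z * t ^ l - 1| ≤ k * C * t := by
          rw [Finset.sum_range_succ', transportCoeff_zero, pow_zero, mul_one, add_sub_cancel_right]
          refine (Finset.abs_sum_le_sum_abs _ _).trans ?_
          calc _ ≤ ∑ _l ∈ Finset.range k, C * t := by
                refine Finset.sum_le_sum fun l hl => ?_
                rw [abs_mul, abs_of_nonneg (pow_nonneg ht0.le _)]
                refine mul_le_mul ?_ ?_ (by positivity) hC0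
                · simpa using hC (l + 1) (by simpa using hl) 0 le_rfl x hxm z (hsub hz)
                · exact pow_le_of_le_one ht0.le ht.2 (Nat.succ_ne_zero l)
            _ = _ := by simp [mul_assoc]
        rw [← sub_mul, norm_mul, lineParametrix, ← Complex.ofReal_sub, Complex.norm_real,
          Real.norm_eq_abs, show ∀ a b : ℝ, a * b - a = a * (b - 1) from fun a b => by ring,
          abs_mul, abs_of_nonneg (gaussKernel_nonneg _ _ _)]
        calc _ ≤ gaussKernel t x z * (k * C * t) * |B| := by
              have := gaussKernel_nonneg t x z
              gcongr
              exact (hB z hz).trans (le_abs_self _)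
          _ = _ := by ring
      refine (intervalIntegral.norm_integral_le_of_norm_le hℓ
        ((ae_of_all _ fun z hz => hb z (Ioc_subset_Icc_self hz)))
        (((hGc t ht0).const_mul _).intervalIntegrable _ _)).trans ?_
      rw [intervalIntegral.integral_const_mul]
      simp only [gaussKernel_symm t x]
      exact mul_le_of_le_one_right (by positivity) (intervalIntegral_gaussKernel_le ht0 hℓ x)
    · have : Tendsto (fun t : ℝ => (k : ℝ) * C * |B| * t) (𝓝 0) (𝓝 ((k : ℝ) * C * |B| * 0)) :=
        tendsto_id.const_mul _
      rw [mul_zero] at this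
      exact this.mono_left nhdsWithin_le_nhds
  have := (tendsto_integral_gaussKernel hx hφ).add hdiff
  rw [add_zero] at this
  refine this.congr' ?_
  filter_upwards [self_mem_nhdsWithin] with t ht
  have ht0 : (0 : ℝ) < t := ht
  have hi1 : IntervalIntegrable (fun z => (gaussKernel t x z : ℂ) * φ z) volume 0 ℓ :=
    ContinuousOn.intervalIntegrable_of_Icc hℓ
      ((Complex.continuous_ofReal.comp (hGc t ht0)).continuousOn.mul hφ)
  have hi2 : IntervalIntegrable (fun z => (lineParametrix W k t x z : ℂ) * φ z) volume 0 ℓ :=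
    ContinuousOn.intervalIntegrable_of_Icc hℓ
      ((Complex.continuous_ofReal.comp ((hGc t ht0).mul (hSc t))).continuousOn.mul hφ)
  rw [← intervalIntegral.integral_add hi1 (hi2.sub hi1)]
  simp

end smooth

/-! ### Smooth extension of glued potentials -/

/-- Two functions on `[0, a]` and `[0, b]` with matching jets at `0` glue to a smooth function. -/
theorem contDiffOn_glue {a b : ℝ} (ha : 0 < a) (hb : 0 < b) {f g : ℝ → ℝ}
    (hf : ContDiffOn ℝ ∞ f (Icc 0 a)) (hg : ContDiffOn ℝ ∞ g (Icc 0 b))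
    (hfg : ∀ j : ℕ, iteratedDerivWithin j f (Icc 0 a) 0 =
      (-1) ^ j * iteratedDerivWithin j g (Icc 0 b) 0) :
    ContDiffOn ℝ ∞ (fun z => if 0 ≤ z then f z else g (-z)) (Ioo (-b) a) := by
  refine contDiffOn_infty.2 fun n => ?_
  have hua := uniqueDiffOn_Icc ha
  have hub := uniqueDiffOn_Icc hb
  induction n generalizing f g with
  | zero =>
    refine contDiffOn_zero.2 ?_
    have h0 : f 0 = g 0 := by simpa using hfg 0
    refine (ContinuousOn.if (p := fun z => 0 ≤ z) ?_ ?_ ?_)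
    · intro z hz
      have : z = 0 := by
        have := hz.2
        rw [show {z : ℝ | 0 ≤ z} = Ici 0 from rfl, frontier_Ici] at this
        simpa using this
      simp [this, h0]
    · refine hf.continuousOn.mono fun z hz => ?_
      have := hz.2
      rw [show {z : ℝ | 0 ≤ z} = Ici 0 from rfl, closure_Ici] at this
      exact ⟨this, hz.1.2.le⟩
    · refine hg.continuousOn.comp (by fun_prop) fun z hz => ?_
      have := hz.2
      rw [show {z : ℝ | ¬ 0 ≤ z} = Iio 0 by ext; simp, closure_Iio] at this
      exact ⟨neg_nonneg.2 this, by linarith [hz.1.1]⟩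
  | succ n ih =>
    have hd (z : ℝ) (hz : z ∈ Ioo (-b) a) :
        HasDerivAt (fun z => if 0 ≤ z then f z else g (-z))
          (if 0 ≤ z then derivWithin f (Icc 0 a) z else -derivWithin g (Icc 0 b) (-z)) z := by
      have hf' (z : ℝ) (hz : z ∈ Icc 0 a) := (hf.differentiableOn (by simp) z hz).hasDerivWithinAt
      have hg' (z : ℝ) (hz : z ∈ Icc 0 b) := (hg.differentiableOn (by simp) z hz).hasDerivWithinAt
      rcases lt_trichotomy z 0 with h | h | h
      · have h1 := (hg' (-z) ⟨by linarith, by linarith [hz.1]⟩).hasDerivAt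
          (Icc_mem_nhds (by linarith) (by linarith [hz.1]))
        rw [if_neg (not_le.2 h)]
        have h2 := HasDerivAt.comp z h1 (hasDerivAt_neg z)
        rw [mul_neg_one] at h2
        refine h2.congr_of_eventuallyEq ?_
        filter_upwards [Iio_mem_nhds h] with y hy
        exact if_neg (not_le.2 hy)
      · subst h
        rw [if_pos le_rfl, ← hasDerivWithinAt_univ, ← Iic_union_Ici (a := (0 : ℝ))]
        refine HasDerivWithinAt.union ?_ ?_
        · have h1 : HasDerivWithinAt g (derivWithin g (Icc 0 b) 0) (Ici 0) (-0) := by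
            rw [neg_zero]
            exact (hg' 0 ⟨le_rfl, hb.le⟩).mono_of_mem_nhdsWithin (Icc_mem_nhdsGE hb)
          have h2 : HasDerivWithinAt (fun z : ℝ => -z) (-1) (Iic 0) 0 :=
            (hasDerivAt_neg 0).hasDerivWithinAt
          have h3 : HasDerivWithinAt (fun z => g (-z)) (derivWithin g (Icc 0 b) 0 * -1) (Iic 0) 0 :=
            HasDerivWithinAt.comp (0 : ℝ) h1 h2 (fun z (hz : z ≤ 0) => (neg_nonneg.2 hz : 0 ≤ -z))
          have h4 : derivWithin f (Icc 0 a) 0 = (-1) ^ 1 * derivWithin g (Icc 0 b) 0 := by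
            simpa only [iteratedDerivWithin_one] using hfg 1
          refine (h3.congr_deriv (by rw [h4]; ring)).congr_of_mem (fun z hz => ?_) self_mem_Iic
          rcases eq_or_lt_of_le (show z ≤ 0 from hz) with h | h
          · simpa [h] using hfg 0
          · simp [not_le.2 h]
        · have h1 : HasDerivWithinAt f (derivWithin f (Icc 0 a) 0) (Ici 0) 0 :=
            (hf' 0 ⟨le_rfl, ha.le⟩).mono_of_mem_nhdsWithin (Icc_mem_nhdsGE ha)
          exact h1.congr_of_mem (fun z hz => if_pos hz) self_mem_Ici
      · have h1 := (hf' z ⟨h.le, hz.2.le⟩).hasDerivAt (Icc_mem_nhds h hz.2)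
        rw [if_pos h.le]
        refine h1.congr_of_eventuallyEq ?_
        filter_upwards [Ioi_mem_nhds h] with y hy
        rw [if_pos (le_of_lt hy)]
    have hf1 := ((contDiffOn_infty_iff_derivWithin hua).1 hf).2
    have hg1 := ((contDiffOn_infty_iff_derivWithin hub).1 hg).2
    rw [Nat.cast_succ, contDiffOn_succ_iff_deriv_of_isOpen isOpen_Ioo]
    refine ⟨fun z hz => (hd z hz).differentiableAt.differentiableWithinAt, by simp, ?_⟩
    refine (ih hf1 hg1.neg fun j => ?_).congr fun z hz => (hd z hz).deriv
    have hn : iteratedDerivWithin j (-derivWithin g (Icc 0 b)) (Icc 0 b) 0 =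
        -iteratedDerivWithin j (derivWithin g (Icc 0 b)) (Icc 0 b) 0 := iteratedDerivWithin_neg ..
    rw [show (fun x => -derivWithin g (Icc 0 b) x) = -derivWithin g (Icc 0 b) from rfl, hn,
      ← iteratedDerivWithin_succ', ← iteratedDerivWithin_succ', hfg (j + 1)]
    ring

namespace MetricGraph

variable {V : Type u} {E : Type v} [DecidableEq V] {Γ : MetricGraph V E}

theorem coord_coord (w : V) (α : E) (x : ℝ) : Γ.coord w α (Γ.coord w α x) = x := by
  unfold coord
  split_ifs <;> ring

theorem coord_mem_Icc {w : V} {α : E} {x : ℝ} (hx : x ∈ Icc 0 (Γ.len α)) :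
    Γ.coord w α x ∈ Icc 0 (Γ.len α) := by
  unfold coord
  split_ifs
  · exact hx
  · exact ⟨by linarith [hx.2], by linarith [hx.1]⟩

theorem coord_mem_Ioo {w : V} {α : E} {x : ℝ} (hx : x ∈ Ioo 0 (Γ.len α)) :
    Γ.coord w α x ∈ Ioo 0 (Γ.len α) := by
  unfold coord
  split_ifs
  · exact hx
  · exact ⟨by linarith [hx.2], by linarith [hx.1]⟩

theorem coord_of_ne {w w' : V} {α : E} (hw : Γ.Incident α w) (hw' : Γ.Incident α w') (h : w ≠ w')
    (x : ℝ) : Γ.coord w' α x = Γ.len α - Γ.coord w α x := by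
  unfold coord
  rcases hw with hw | hw <;> rcases hw' with hw' | hw'
  · exact absurd (hw.symm.trans hw') h
  · rw [if_pos hw, if_neg (hw ▸ h)]
  · rw [if_pos hw', if_neg (hw' ▸ h.symm)]
    ring
  · exact absurd (hw.symm.trans hw') h

omit [DecidableEq V] in
theorem exists_other_vertex {w : V} {α : E} (hw : Γ.Incident α w) :
    ∃ w', Γ.Incident α w' ∧ w ≠ w' := by
  rcases hw with hw | hw
  · exact ⟨Γ.tgt α, Or.inr rfl, hw ▸ Γ.no_loops α⟩
  · exact ⟨Γ.src α, Or.inl rfl, hw ▸ (Γ.no_loops α).symm⟩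

theorem contDiffOn_coord (w : V) (α : E) (s : Set ℝ) : ContDiffOn ℝ ∞ (Γ.coord w α) s := by
  unfold coord
  split_ifs
  · exact contDiffOn_id
  · exact contDiffOn_const.sub contDiffOn_id

variable {U : E → ℝ → ℝ} (hU : Γ.IsSmoothPotential U)

include hU

theorem IsSmoothPotential.contDiffOn_glue {w : V} {α β : E} (hα : Γ.Incident α w)
    (hβ : Γ.Incident β w) :
    ContDiffOn ℝ ∞ (Γ.glue U w α β) (Ioo (-Γ.len β) (Γ.len α)) := by
  have h (α : E) : ContDiffOn ℝ ∞ (Γ.atVertex U w α) (Icc 0 (Γ.len α)) :=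
    (hU.smooth α).comp (contDiffOn_coord w α _) fun x hx => coord_mem_Icc hx
  refine _root_.contDiffOn_glue (Γ.len_pos α) (Γ.len_pos β) (h α) (h β) fun j => ?_
  rcases Nat.even_or_odd' j with ⟨m, rfl | rfl⟩
  · simpa [vertexDeriv] using hU.even w α β hα hβ m
  · have h1 := hU.odd w α hα m
    have h2 := hU.odd w β hβ m
    rw [vertexDeriv] at h1 h2
    rw [h1, h2, mul_zero]

/-- The potentials glued at a vertex extend smoothly beyond the far ends of both edges: at a far
end the vanishing odd derivatives make the even reflection smooth. -/
theorem IsSmoothPotential.exists_extension {w : V} {α β : E} (hα : Γ.Incident α w)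
    (hβ : Γ.Incident β w) :
    ∃ W : ℝ → ℝ, ContDiff ℝ ∞ W ∧ EqOn (Γ.glue U w α β) W (Icc (-Γ.len β) (Γ.len α)) := by
  have la := Γ.len_pos α
  have lb := Γ.len_pos β
  obtain ⟨a', ha', hna⟩ := exists_other_vertex hα
  obtain ⟨b', hb', hnb⟩ := exists_other_vertex hβ
  set T : ℝ → Set ℝ :=
    fun z => {r | z ∈ Icc (-Γ.len β) (Γ.len α) → r = Γ.glue U w α β z}
  have hconv (z : ℝ) : Convex ℝ (T z) := by
    intro r hr s hs c d _ _ hcd hz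
    rw [hr hz, hs hz, ← add_smul, hcd, one_smul]
  suffices hloc : ∀ z : ℝ, ∃ s ∈ 𝓝 z, ∃ g : ℝ → ℝ, ContMDiffOn (modelWithCornersSelf ℝ ℝ)
      (modelWithCornersSelf ℝ ℝ) ∞ g s ∧ ∀ y ∈ s, g y ∈ T y by
    obtain ⟨g, hg⟩ := exists_contMDiffMap_forall_mem_convex_of_local (modelWithCornersSelf ℝ ℝ)
      hconv hloc
    exact ⟨g, g.contMDiff.contDiff, fun z hz => (hg z hz).symm⟩
  · intro z
    by_cases hz : z ∈ Icc (-Γ.len β) (Γ.len α)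
    · rcases eq_or_lt_of_le hz.2 with h | h
      · refine ⟨Ioo 0 (2 * Γ.len α), Ioo_mem_nhds (by linarith) (by linarith),
          fun y => Γ.glue U a' α α (Γ.len α - y), ?_, fun y hy hy' => ?_⟩
        · refine ((hU.contDiffOn_glue ha' ha').comp (contDiff_const.sub contDiff_id).contDiffOn
            fun y hy => ?_).contMDiffOn
          constructor <;> simp only [id] <;> linarith [hy.1, hy.2]
        · have : 0 ≤ Γ.len α - y := by linarith [hy'.2]
          simp only [glue, if_pos this, if_pos hy.1.le, atVertex]
          rw [coord_of_ne ha' hα hna.symm]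
          congr 1
          unfold coord
          split_ifs <;> ring
      · rcases eq_or_lt_of_le hz.1 with h' | h'
        · refine ⟨Ioo (-(2 * Γ.len β)) 0, Ioo_mem_nhds (by linarith) (by linarith),
            fun y => Γ.glue U b' β β (Γ.len β + y), ?_, fun y hy hy' => ?_⟩
          · refine ((hU.contDiffOn_glue hb' hb').comp (contDiff_const.add contDiff_id).contDiffOn
              fun y hy => ?_).contMDiffOn
            constructor <;> simp only [id] <;> linarith [hy.1, hy.2]
          · have : 0 ≤ Γ.len β + y := by linarith [hy'.1]
            simp only [glue, if_pos this, if_neg (not_le.2 hy.2), atVertex]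
            rw [coord_of_ne hb' hβ hnb.symm]
            congr 1
            unfold coord
            split_ifs <;> ring
        · exact ⟨Ioo (-Γ.len β) (Γ.len α), Ioo_mem_nhds h' h, Γ.glue U w α β,
            (hU.contDiffOn_glue hα hβ).contMDiffOn, fun y _ _ => rfl⟩
    · exact ⟨(Icc (-Γ.len β) (Γ.len α))ᶜ, isClosed_Icc.isOpen_compl.mem_nhds hz, fun _ => 0,
        contMDiffOn_const, fun y hy hy' => absurd hy' hy⟩

end MetricGraph

/-! ### Boundary conditions and Green's formula -/

theorem Matrix.isUnit_of_rank_eq_card {n : Type*} [Fintype n] [DecidableEq n] {M : Matrix n n ℂ}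
    (h : M.rank = Fintype.card n) : IsUnit M := by
  rw [← Matrix.mulVec_surjective_iff_isUnit]
  have : LinearMap.range M.mulVecLin = ⊤ := by
    refine Submodule.eq_top_of_finrank_eq ?_
    rw [Module.finrank_fintype_fun_eq_card, ← h]
    rfl
  exact LinearMap.range_eq_top.1 this

namespace MetricGraph

variable {V : Type u} {E : Type v} [DecidableEq V] {Γ : MetricGraph V E} [Fintype E]

namespace BoundaryConditions

variable [DecidableEq E] (bc : Γ.BoundaryConditions) (w : V)

theorem mul_conjTranspose_eq (z : ℂ) (hz : z = Complex.I ∨ z = -Complex.I) :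
    (bc.A w + z • bc.B w) * (bc.A w + z • bc.B w)ᴴ =
      bc.A w * (bc.A w)ᴴ + bc.B w * (bc.B w)ᴴ := by
  have h : bc.B w * (bc.A w)ᴴ = bc.A w * (bc.B w)ᴴ := by
    have := (bc.selfAdjoint w).eq
    rwa [Matrix.conjTranspose_mul, Matrix.conjTranspose_conjTranspose] at this
  have hz1 : star z = -z := by rcases hz with rfl | rfl <;> simp
  have hz2 : z * z = -1 := by rcases hz with rfl | rfl <;> simp
  rw [Matrix.conjTranspose_add, Matrix.conjTranspose_smul, hz1]
  simp only [add_mul, mul_add, Matrix.smul_mul, Matrix.mul_smul, smul_smul, h, neg_smul,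
    mul_neg, hz2]
  simp only [one_smul]
  abel

open scoped ComplexOrder in
theorem isUnit_add_smul (z : ℂ) (hz : z = Complex.I ∨ z = -Complex.I) :
    IsUnit (bc.A w + z • bc.B w) := by
  have h1 : IsUnit (bc.A w * (bc.A w)ᴴ + bc.B w * (bc.B w)ᴴ) := by
    refine Matrix.isUnit_of_rank_eq_card ?_
    rw [← bc.fullRank w, ← Matrix.rank_self_mul_conjTranspose (Matrix.fromCols (bc.A w) (bc.B w)),
      Matrix.conjTranspose_fromCols_eq_fromRows_conjTranspose, Matrix.fromCols_mul_fromRows]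
  rw [← bc.mul_conjTranspose_eq w z hz, Matrix.isUnit_iff_isUnit_det, Matrix.det_mul] at h1
  rw [Matrix.isUnit_iff_isUnit_det]
  exact isUnit_of_mul_isUnit_left h1

theorem add_mul_sigma :
    (bc.A w + Complex.I • bc.B w) * bc.sigma w = -(bc.A w - Complex.I • bc.B w) := by
  have h := (Matrix.isUnit_iff_isUnit_det _).1 (bc.isUnit_add_smul w Complex.I (Or.inl rfl))
  rw [sigma, mul_neg, Matrix.mul_nonsing_inv_cancel_left _ _ h]

theorem sub_mul_sigma :
    (bc.A w - Complex.I • bc.B w) * bc.sigma w = -(bc.A w + Complex.I • bc.B w) := by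
  have h := (Matrix.isUnit_iff_isUnit_det _).1 (bc.isUnit_add_smul w (-Complex.I) (Or.inr rfl))
  have hk := bc.nonRobin w 1 (-1) (by norm_num) (by norm_num)
  simp only [Complex.ofReal_one, mul_one, Complex.ofReal_neg, mul_neg, neg_smul,
    ← sub_eq_add_neg, sub_neg_eq_add] at hk
  rw [neg_smul, ← sub_eq_add_neg] at h
  rw [sigma, hk, mul_neg, Matrix.mul_nonsing_inv_cancel_left _ _ h]

theorem sigma_mul_sigma : bc.sigma w * bc.sigma w = 1 := by
  have h := bc.isUnit_add_smul w Complex.I (Or.inl rfl)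
  refine h.mul_left_cancel ?_
  rw [← mul_assoc, add_mul_sigma, neg_mul, sub_mul_sigma, neg_neg, mul_one]

theorem A_mul_sigma : bc.A w * bc.sigma w = -bc.A w := by
  have h1 := bc.add_mul_sigma w
  have h2 := bc.sub_mul_sigma w
  rw [add_mul] at h1
  rw [sub_mul] at h2
  have h3 : (2 : ℂ) • (bc.A w * bc.sigma w) = (2 : ℂ) • (-bc.A w) := by
    rw [two_smul, two_smul]
    linear_combination (norm := module) h1 + h2
  exact smul_right_injective _ (two_ne_zero) h3

theorem B_mul_sigma : bc.B w * bc.sigma w = bc.B w := by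
  have h1 := bc.add_mul_sigma w
  rw [add_mul, A_mul_sigma, Matrix.smul_mul] at h1
  have h3 : Complex.I • (bc.B w * bc.sigma w) = Complex.I • bc.B w := by
    linear_combination (norm := module) h1
  exact smul_right_injective _ Complex.I_ne_zero h3

theorem sigma_conjTranspose : (bc.sigma w)ᴴ = bc.sigma w := by
  have h := bc.isUnit_add_smul w Complex.I (Or.inl rfl)
  -- `σ` is unitary, and it is its own inverse
  have hu : bc.sigma w * (bc.sigma w)ᴴ = 1 := by
    have h1 := bc.mul_conjTranspose_eq w Complex.I (Or.inl rfl)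
    have h2 := bc.mul_conjTranspose_eq w (-Complex.I) (Or.inr rfl)
    rw [← h1, neg_smul, ← sub_eq_add_neg, show bc.A w - Complex.I • bc.B w =
      -((bc.A w + Complex.I • bc.B w) * bc.sigma w) by rw [add_mul_sigma, neg_neg],
      Matrix.conjTranspose_neg, neg_mul_neg, Matrix.conjTranspose_mul] at h2
    have h' : IsUnit (bc.A w + Complex.I • bc.B w)ᴴ := h.star
    refine h.mul_left_cancel (h'.mul_right_cancel ?_)
    rw [mul_one, ← h2]
    simp only [mul_assoc]
  calc (bc.sigma w)ᴴ = bc.sigma w * bc.sigma w * (bc.sigma w)ᴴ := by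
        rw [sigma_mul_sigma, one_mul]
    _ = bc.sigma w := by rw [mul_assoc, hu, mul_one]

/-- The boundary conditions are `σ F = F` for the values and `σ F' = -F'` for the outward
derivatives. -/
theorem sigma_mulVec_of_boundary {F F' : Γ.EdgesAt w → ℂ}
    (h : bc.A w *ᵥ F + bc.B w *ᵥ F' = 0) :
    bc.sigma w *ᵥ F = F ∧ bc.sigma w *ᵥ F' = -F' := by
  have hu := bc.isUnit_add_smul w Complex.I (Or.inl rfl)
  set P := F - bc.sigma w *ᵥ F with hP
  set Q := F' + bc.sigma w *ᵥ F' with hQ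
  have hAP : bc.A w *ᵥ P = (2 : ℂ) • bc.A w *ᵥ F := by
    rw [hP, Matrix.mulVec_sub, Matrix.mulVec_mulVec, A_mul_sigma, Matrix.neg_mulVec, two_smul,
      sub_neg_eq_add]
  have hBP : bc.B w *ᵥ P = 0 := by
    rw [hP, Matrix.mulVec_sub, Matrix.mulVec_mulVec, B_mul_sigma, sub_self]
  have hAQ : bc.A w *ᵥ Q = 0 := by
    rw [hQ, Matrix.mulVec_add, Matrix.mulVec_mulVec, A_mul_sigma, Matrix.neg_mulVec,
      add_neg_cancel]
  have hBQ : bc.B w *ᵥ Q = (2 : ℂ) • bc.B w *ᵥ F' := by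
    rw [hQ, Matrix.mulVec_add, Matrix.mulVec_mulVec, B_mul_sigma, two_smul]
  have hσP : bc.sigma w *ᵥ P = -P := by
    rw [hP, Matrix.mulVec_sub, Matrix.mulVec_mulVec, sigma_mul_sigma, Matrix.one_mulVec, neg_sub]
  have hσQ : bc.sigma w *ᵥ Q = Q := by
    rw [hQ, Matrix.mulVec_add, Matrix.mulVec_mulVec, sigma_mul_sigma, Matrix.one_mulVec, add_comm]
  clear_value P Q
  have key : P - Complex.I • Q = 0 := by
    refine Matrix.mulVec_injective_iff_isUnit.2 hu ?_
    rw [Matrix.mulVec_zero, Matrix.add_mulVec, Matrix.smul_mulVec, Matrix.mulVec_sub,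
      Matrix.mulVec_sub, Matrix.mulVec_smul, Matrix.mulVec_smul, hAP, hBP, hAQ, hBQ, smul_zero,
      sub_zero, zero_sub, smul_neg, smul_smul, Complex.I_mul_I, neg_one_smul, neg_neg,
      ← smul_add, h, smul_zero]
  -- `P` and `Q` are in different eigenspaces of `σ`
  have key' : -P - Complex.I • Q = 0 := by
    have := congrArg (bc.sigma w *ᵥ ·) key
    simpa only [Matrix.mulVec_sub, Matrix.mulVec_smul, hσP, hσQ, Matrix.mulVec_zero] using this
  have hP0 : P = 0 := by
    have h2 : (2 : ℂ) • P = 0 := by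
      rw [two_smul]
      linear_combination (norm := module) key - key'
    exact (smul_eq_zero.1 h2).resolve_left two_ne_zero
  have hQ0 : Q = 0 := by
    rw [hP0, zero_sub, neg_eq_zero] at key
    exact (smul_eq_zero.1 key).resolve_left Complex.I_ne_zero
  exact ⟨(sub_eq_zero.1 (hP ▸ hP0)).symm, eq_neg_of_add_eq_zero_right (hQ ▸ hQ0)⟩

/-- Values and outward derivatives that satisfy the boundary conditions are orthogonal. -/
theorem sum_mul_conj_eq_zero {F G' : Γ.EdgesAt w → ℂ} (hF : bc.sigma w *ᵥ F = F)
    (hG : bc.sigma w *ᵥ G' = -G') : ∑ α, F α * starRingEnd ℂ (G' α) = 0 := by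
  have h : F ⬝ᵥ star G' = -(F ⬝ᵥ star G') := by
    conv_lhs => rw [← hF]
    rw [dotProduct_comm, Matrix.dotProduct_mulVec, ← sigma_conjTranspose,
      ← Matrix.star_mulVec, hG, star_neg, neg_dotProduct, dotProduct_comm]
  exact self_eq_neg.1 h

end BoundaryConditions

/-- The sign of the outward derivative at `w` along `α` in the fixed coordinate of `α`. -/
noncomputable def orient (Γ : MetricGraph V E) (w : V) (α : E) : ℝ :=
  if Γ.src α = w then 1 else -1

omit [Fintype E] in
theorem coord_eq (w : V) (α : E) (x : ℝ) :
    Γ.coord w α x = Γ.coord w α 0 + Γ.orient w α * x := by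
  unfold coord orient
  split_ifs <;> ring

omit [Fintype E] in
theorem orient_mul_orient (w : V) (α : E) : Γ.orient w α * Γ.orient w α = 1 := by
  unfold orient
  split_ifs <;> norm_num

omit [Fintype E] in
theorem hasDerivAt_coord (w : V) (α : E) (x : ℝ) :
    HasDerivAt (Γ.coord w α) (Γ.orient w α) x := by
  rw [show Γ.coord w α = fun x => Γ.coord w α 0 + Γ.orient w α * x from funext (coord_eq w α)]
  simpa using ((hasDerivAt_id x).const_mul (Γ.orient w α)).const_add (Γ.coord w α 0)

omit [Fintype E] in
theorem continuous_coord (w : V) (α : E) : Continuous (Γ.coord w α) :=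
  continuous_iff_continuousAt.2 fun x => (hasDerivAt_coord w α x).continuousAt

/-- A sum over all edges at all vertices is a sum over the two endpoints of all edges. -/
theorem sum_edgesAt [Fintype V] {R : Type*} [AddCommMonoid R] (g : V → E → R) :
    ∑ w : V, ∑ α : Γ.EdgesAt w, g w α = ∑ β : E, (g (Γ.src β) β + g (Γ.tgt β) β) := by
  have h (w : V) : ∑ α : Γ.EdgesAt w, g w α = ∑ β : E, if Γ.Incident β w then g w β else 0 := by
    rw [← Finset.sum_filter]
    exact (Finset.sum_subtype _ (by simp) _).symm
  simp only [h]
  rw [Finset.sum_comm]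
  refine Finset.sum_congr rfl fun β _ => ?_
  have hs (w : V) : (if Γ.Incident β w then g w β else 0) =
      (if Γ.src β = w then g w β else 0) + if Γ.tgt β = w then g w β else 0 := by
    have := Γ.no_loops β
    unfold Incident
    by_cases h1 : Γ.src β = w <;> by_cases h2 : Γ.tgt β = w
    · exact absurd (h1.trans h2.symm) this
    all_goals simp [h1, h2]
  simp only [hs, Finset.sum_add_distrib, Finset.sum_ite_eq, Finset.mem_univ, if_true]

theorem sum_endpoints [Fintype V] (Φ : E → ℝ → ℂ) :
    ∑ β : E, (Φ β (Γ.len β) - Φ β 0) =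
      -∑ w : V, ∑ α : Γ.EdgesAt w, (Γ.orient w α : ℂ) * Φ α (Γ.coord w α 0) := by
  rw [sum_edgesAt (Γ := Γ) fun w α => (Γ.orient w α : ℂ) * Φ α (Γ.coord w α 0),
    ← Finset.sum_neg_distrib]
  refine Finset.sum_congr rfl fun β _ => ?_
  simp only [orient, coord, Γ.no_loops β]
  simp
  ring

/-- `f` is a function of time and space on the graph with time derivative `ft` and space
derivatives `fy`, `fyy` that satisfies the (conjugate) boundary conditions. Nothing is assumed as
`t → 0`, and no equation is imposed. -/
structure HeatFlow [DecidableEq E] (bc : Γ.BoundaryConditions) (f ft fy fyy : ℝ → E → ℝ → ℂ) :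
    Prop where
  cont : ∀ β, ContinuousOn (fun p : ℝ × ℝ => f p.1 β p.2) (Ioi 0 ×ˢ Icc 0 (Γ.len β))
  cont_time : ∀ β, ContinuousOn (fun p : ℝ × ℝ => ft p.1 β p.2) (Ioi 0 ×ˢ Icc 0 (Γ.len β))
  cont_space : ∀ β, ContinuousOn (fun p : ℝ × ℝ => fyy p.1 β p.2) (Ioi 0 ×ˢ Icc 0 (Γ.len β))
  time : ∀ t > 0, ∀ β, ∀ y ∈ Icc 0 (Γ.len β), HasDerivAt (fun s => f s β y) (ft t β y) t
  space : ∀ t > 0, ∀ β, ∀ y ∈ Icc 0 (Γ.len β),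
    HasDerivWithinAt (f t β) (fy t β y) (Icc 0 (Γ.len β)) y
  space₂ : ∀ t > 0, ∀ β, ∀ y ∈ Icc 0 (Γ.len β),
    HasDerivWithinAt (fy t β) (fyy t β y) (Icc 0 (Γ.len β)) y
  value : ∀ t > 0, ∀ w, bc.sigma w *ᵥ
    (fun α : Γ.EdgesAt w => starRingEnd ℂ (f t α (Γ.coord w α 0))) =
      fun α : Γ.EdgesAt w => starRingEnd ℂ (f t α (Γ.coord w α 0))
  flux : ∀ t > 0, ∀ w, bc.sigma w *ᵥ
    (fun α : Γ.EdgesAt w => (Γ.orient w α : ℂ) * starRingEnd ℂ (fy t α (Γ.coord w α 0))) =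
      -fun α : Γ.EdgesAt w => (Γ.orient w α : ℂ) * starRingEnd ℂ (fy t α (Γ.coord w α 0))

namespace HeatFlow

variable [DecidableEq E] {bc : Γ.BoundaryConditions} {f ft fy fyy g gt gy gyy : ℝ → E → ℝ → ℂ}

omit [DecidableEq V] [Fintype E] [DecidableEq E] in
theorem continuousOn_slice {h : ℝ → E → ℝ → ℂ} {β : E} {t : ℝ} (ht : 0 < t)
    (hc : ContinuousOn (fun p : ℝ × ℝ => h p.1 β p.2) (Ioi 0 ×ˢ Icc 0 (Γ.len β))) :
    ContinuousOn (h t β) (Icc 0 (Γ.len β)) :=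
  hc.comp (f := fun y => (t, y)) (by fun_prop) fun _ hy => ⟨ht, hy⟩

/-- Green's formula. -/
theorem integral_green [Fintype V] (hf : HeatFlow bc f ft fy fyy) (hg : HeatFlow bc g gt gy gyy)
    {s t : ℝ} (hs : 0 < s) (ht : 0 < t) :
    (Γ.integral fun β y => fyy s β y * starRingEnd ℂ (g t β y) -
      f s β y * starRingEnd ℂ (gyy t β y)) = 0 := by
  have hβ (β : E) : ∫ y in (0 : ℝ)..Γ.len β, (fyy s β y * starRingEnd ℂ (g t β y) -
      f s β y * starRingEnd ℂ (gyy t β y)) =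
      (fun y => fy s β y * starRingEnd ℂ (g t β y) - f s β y * starRingEnd ℂ (gy t β y))
        (Γ.len β) -
      (fun y => fy s β y * starRingEnd ℂ (g t β y) - f s β y * starRingEnd ℂ (gy t β y)) 0 := by
    have hd (y : ℝ) (hy : y ∈ Icc 0 (Γ.len β)) : HasDerivWithinAt
        (fun y => fy s β y * starRingEnd ℂ (g t β y) - f s β y * starRingEnd ℂ (gy t β y))
        (fyy s β y * starRingEnd ℂ (g t β y) - f s β y * starRingEnd ℂ (gyy t β y))
        (Icc 0 (Γ.len β)) y := by
      refine (((hf.space₂ s hs β y hy).mul (hg.space t ht β y hy).star).sub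
        ((hf.space s hs β y hy).mul (hg.space₂ t ht β y hy).star)).congr_deriv ?_
      simp only [starRingEnd_apply]
      ring
    refine intervalIntegral.integral_eq_sub_of_hasDerivAt_of_le (Γ.len_pos β).le
      (fun y hy => (hd y hy).continuousWithinAt) (fun y hy =>
        (hd y (Ioo_subset_Icc_self hy)).hasDerivAt (Icc_mem_nhds hy.1 hy.2)) ?_
    refine ContinuousOn.intervalIntegrable_of_Icc (Γ.len_pos β).le ?_
    exact ((continuousOn_slice hs (hf.cont_space β)).mul
      (continuousOn_slice ht (hg.cont β)).star).sub
      ((continuousOn_slice hs (hf.cont β)).mul (continuousOn_slice ht (hg.cont_space β)).star)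
  rw [MetricGraph.integral, Finset.sum_congr rfl fun β _ => hβ β,
    sum_endpoints (Γ := Γ) fun β y => fy s β y * starRingEnd ℂ (g t β y) -
      f s β y * starRingEnd ℂ (gy t β y), neg_eq_zero]
  refine Finset.sum_eq_zero fun w _ => ?_
  have h1 := bc.sum_mul_conj_eq_zero w (hg.value t ht w) (hf.flux s hs w)
  have h2 := bc.sum_mul_conj_eq_zero w (hf.value s hs w) (hg.flux t ht w)
  have h2' := congrArg (starRingEnd ℂ) h2
  rw [map_zero, map_sum] at h2'
  rw [← sub_zero (0 : ℂ)]
  nth_rw 1 [← h1]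
  rw [← h2', ← Finset.sum_sub_distrib]
  refine Finset.sum_congr rfl fun α _ => ?_
  simp only [map_mul, Complex.conj_conj, Complex.conj_ofReal]
  ring

end HeatFlow

end MetricGraph

namespace MetricGraph

/-! ### Duhamel's principle -/

variable {V : Type u} {E : Type v} {Γ : MetricGraph V E} [Fintype E]

theorem norm_integral_le {f : E → ℝ → ℂ} {g : E → ℝ → ℝ}
    (h : ∀ β, ∀ y ∈ Icc 0 (Γ.len β), ‖f β y‖ ≤ g β y)
    (hg : ∀ β, IntervalIntegrable (g β) volume 0 (Γ.len β)) :
    ‖Γ.integral f‖ ≤ Γ.integral g :=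
  (norm_sum_le _ _).trans <| Finset.sum_le_sum fun β _ =>
    intervalIntegral.norm_integral_le_of_norm_le (Γ.len_pos β).le
      (ae_of_all _ fun y hy => h β y (Ioc_subset_Icc_self hy)) (hg β)

theorem integral_mono {f g : E → ℝ → ℝ} (h : ∀ β, ∀ y ∈ Ioo 0 (Γ.len β), f β y ≤ g β y)
    (hf : ∀ β, IntervalIntegrable (f β) volume 0 (Γ.len β))
    (hg : ∀ β, IntervalIntegrable (g β) volume 0 (Γ.len β)) :
    Γ.integral f ≤ Γ.integral g :=
  Finset.sum_le_sum fun β _ =>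
    intervalIntegral.integral_mono_on_of_le_Ioo (Γ.len_pos β).le (hf β) (hg β) (h β)

theorem integral_const_mul (c : ℝ) (f : E → ℝ → ℝ) :
    (Γ.integral fun β y => c * f β y) = c * Γ.integral f := by
  simp only [MetricGraph.integral, intervalIntegral.integral_const_mul, Finset.mul_sum]

theorem integral_add {R : Type*} [NormedAddCommGroup R] [NormedSpace ℝ R] {f g : E → ℝ → R}
    (hf : ∀ β, IntervalIntegrable (f β) volume 0 (Γ.len β))
    (hg : ∀ β, IntervalIntegrable (g β) volume 0 (Γ.len β)) :
    (Γ.integral fun β y => f β y + g β y) = Γ.integral f + Γ.integral g := by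
  simp only [MetricGraph.integral, ← Finset.sum_add_distrib]
  exact Finset.sum_congr rfl fun β _ => intervalIntegral.integral_add (hf β) (hg β)

theorem integral_sub {R : Type*} [NormedAddCommGroup R] [NormedSpace ℝ R] {f g : E → ℝ → R}
    (hf : ∀ β, IntervalIntegrable (f β) volume 0 (Γ.len β))
    (hg : ∀ β, IntervalIntegrable (g β) volume 0 (Γ.len β)) :
    (Γ.integral fun β y => f β y - g β y) = Γ.integral f - Γ.integral g := by
  simp only [MetricGraph.integral, ← Finset.sum_sub_distrib]
  exact Finset.sum_congr rfl fun β _ => intervalIntegral.integral_sub (hf β) (hg β)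

theorem integral_congr {R : Type*} [NormedAddCommGroup R] [NormedSpace ℝ R] {f g : E → ℝ → R}
    (h : ∀ β, ∀ y ∈ Icc 0 (Γ.len β), f β y = g β y) : Γ.integral f = Γ.integral g :=
  Finset.sum_congr rfl fun β _ => intervalIntegral.integral_congr fun y hy =>
    h β y (by rwa [uIcc_of_le (Γ.len_pos β).le] at hy)

/-- The functions `f t` tend weakly to the Dirac measure at the point `x` of the edge `α`. -/
def TendsToDirac (Γ : MetricGraph V E) (f : ℝ → E → ℝ → ℂ) (α : E) (x : ℝ) : Prop :=
  ∀ ψ : E → ℝ → ℂ, (∀ β, ContinuousOn (ψ β) (Icc 0 (Γ.len β))) →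
    Tendsto (fun t => Γ.integral fun β y => f t β y * ψ β y) (𝓝[>] 0) (𝓝 (ψ α x))

/-- By the Banach–Steinhaus theorem, weak convergence as `t → 0` forces a bound in `L¹`. -/
theorem TendsToDirac.exists_bound {f : ℝ → E → ℝ → ℂ} {α : E} {x : ℝ}
    (hd : TendsToDirac Γ f α x)
    (hc : ∀ β, ContinuousOn (fun p : ℝ × ℝ => f p.1 β p.2) (Ioi 0 ×ˢ Icc 0 (Γ.len β))) (T : ℝ) :
    ∃ M, ∀ s ∈ Ioc 0 T, (Γ.integral fun β y => ‖f s β y‖) ≤ M := by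
  have hslice (s : ℝ) (hs : 0 < s) (β : E) : ContinuousOn (f s β) (Icc 0 (Γ.len β)) :=
    (hc β).comp (f := fun y => (s, y)) (by fun_prop) fun y hy => ⟨hs, hy⟩
  let X := ∀ β : E, C(Icc 0 (Γ.len β), ℂ)
  let ext (ψ : X) (β : E) : ℝ → ℂ := IccExtend (Γ.len_pos β).le (ψ β)
  have hext (ψ : X) (β : E) : Continuous (ext ψ β) := (ψ β).continuous.Icc_extend'
  have hnorm (ψ : X) (β : E) (y : ℝ) : ‖ext ψ β y‖ ≤ ‖ψ‖ :=
    ((ψ β).norm_coe_le_norm _).trans (norm_le_pi_norm ψ β)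
  have hint (s : ℝ) (hs : 0 < s) (ψ : X) (β : E) :
      IntervalIntegrable (fun y => f s β y * ext ψ β y) volume 0 (Γ.len β) :=
    ContinuousOn.intervalIntegrable_of_Icc (Γ.len_pos β).le
      ((hslice s hs β).mul (hext ψ β).continuousOn)
  have hintn (s : ℝ) (hs : 0 < s) (β : E) :
      IntervalIntegrable (fun y => ‖f s β y‖) volume 0 (Γ.len β) :=
    ContinuousOn.intervalIntegrable_of_Icc (Γ.len_pos β).le (hslice s hs β).norm
  let L (s : Ioc 0 T) : X →L[ℂ] ℂ := LinearMap.mkContinuous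
    { toFun := fun ψ => Γ.integral fun β y => f s β y * ext ψ β y
      map_add' := fun ψ φ => by
        rw [← integral_add (hint s s.2.1 ψ) (hint s s.2.1 φ)]
        congr 1
        ext β y
        exact mul_add _ _ _
      map_smul' := fun c ψ => by
        simp only [MetricGraph.integral, RingHom.id_apply, smul_eq_mul, Finset.mul_sum,
          ← intervalIntegral.integral_const_mul]
        refine Finset.sum_congr rfl fun β _ => ?_
        congr 1
        ext y
        exact mul_left_comm _ _ _ }
    (Γ.integral fun β y => ‖f s β y‖) (fun ψ => by
      rw [mul_comm, ← integral_const_mul]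
      refine norm_integral_le (fun β y _ => ?_) fun β => (hintn s s.2.1 β).const_mul _
      rw [norm_mul, mul_comm]
      exact mul_le_mul_of_nonneg_right (hnorm ψ β y) (norm_nonneg _))
  have hL (s : Ioc 0 T) (ψ : X) : L s ψ = Γ.integral fun β y => f s β y * ext ψ β y := rfl
  obtain ⟨C, hC⟩ : ∃ C, ∀ s, ‖L s‖ ≤ C := by
    refine banach_steinhaus fun ψ => ?_
    -- near `t = 0` the values converge, away from it `f` is bounded
    have hlim := (hd (ext ψ) fun β => (hext ψ β).continuousOn).norm
    have hev := hlim.eventually (gt_mem_nhds (lt_add_one _))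
    obtain ⟨δ, hδ, hδs⟩ := mem_nhdsGT_iff_exists_Ioo_subset.1 hev
    have hb (β : E) : ∃ C, ∀ p ∈ Icc δ T ×ˢ Icc 0 (Γ.len β), ‖f p.1 β p.2‖ ≤ C :=
      (isCompact_Icc.prod isCompact_Icc).exists_bound_of_continuousOn
        ((hc β).mono (prod_mono (fun s hs => lt_of_lt_of_le hδ hs.1) le_rfl))
    choose K hK using hb
    refine ⟨max (‖ext ψ α x‖ + 1) (Γ.integral fun β _ => K β * ‖ψ‖), fun s => ?_⟩
    rw [hL]
    rcases lt_or_ge (s : ℝ) δ with h | h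
    · exact le_max_of_le_left (le_of_lt (hδs ⟨s.2.1, h⟩))
    · refine le_max_of_le_right (norm_integral_le (fun β y hy => ?_) fun β => by simp)
      rw [norm_mul]
      exact mul_le_mul (hK β (s, y) ⟨⟨h, s.2.2⟩, hy⟩) (hnorm ψ β y) (norm_nonneg _)
        ((norm_nonneg _).trans (hK β (s, y) ⟨⟨h, s.2.2⟩, hy⟩))
  refine ⟨C + Γ.integral fun _ _ => (1 : ℝ), fun s hs => ?_⟩
  -- a test function of norm at most `1` that is almost the conjugate phase of `f`
  let ψ : X := fun β => ⟨fun z => starRingEnd ℂ (f s β z) / ((‖f s β z‖ + 1 : ℝ) : ℂ), by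
    have h : Continuous fun z : Icc 0 (Γ.len β) => f s β z :=
      continuousOn_iff_continuous_domRestrict.1 (hslice s hs.1 β)
    refine (Complex.continuous_conj.comp h).div
      (Complex.continuous_ofReal.comp (h.norm.add continuous_const)) fun z => ?_
    exact Complex.ofReal_ne_zero.2 (by positivity)⟩
  have hψ : ‖ψ‖ ≤ 1 := by
    refine (pi_norm_le_iff_of_nonneg zero_le_one).2 fun β =>
      (ContinuousMap.norm_le _ zero_le_one).2 fun z => ?_
    change ‖starRingEnd ℂ (f s β z) / ((‖f s β z‖ + 1 : ℝ) : ℂ)‖ ≤ 1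
    rw [norm_div, RCLike.norm_conj, Complex.norm_real, Real.norm_of_nonneg (by positivity)]
    exact div_le_one_of_le₀ (by linarith) (by positivity)
  have h1 : L ⟨s, hs⟩ ψ =
      ((Γ.integral fun β y => ‖f s β y‖ * ‖f s β y‖ / (‖f s β y‖ + 1) : ℝ) : ℂ) := by
    rw [hL]
    simp only [MetricGraph.integral, Complex.ofReal_sum, ← intervalIntegral.integral_ofReal]
    refine Finset.sum_congr rfl fun β _ => intervalIntegral.integral_congr fun y hy => ?_
    rw [uIcc_of_le (Γ.len_pos β).le] at hy
    have : ext ψ β y = starRingEnd ℂ (f s β y) / ((‖f s β y‖ + 1 : ℝ) : ℂ) :=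
      IccExtend_of_mem _ _ hy
    simp only [this, mul_div_assoc', Complex.mul_conj, Complex.normSq_eq_norm_sq,
      Complex.ofReal_div, sq]
  have h2 : (Γ.integral fun β y => ‖f s β y‖ * ‖f s β y‖ / (‖f s β y‖ + 1)) ≤ C := by
    have := ((L ⟨s, hs⟩).le_opNorm ψ).trans (mul_le_mul (hC _) hψ (norm_nonneg _)
      (le_trans (norm_nonneg (L ⟨s, hs⟩)) (hC ⟨s, hs⟩)))
    rw [h1, Complex.norm_real, mul_one] at this
    exact (le_abs_self _).trans this
  have hi2 (β : E) : IntervalIntegrable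
      (fun y => ‖f s β y‖ * ‖f s β y‖ / (‖f s β y‖ + 1)) volume 0 (Γ.len β) :=
    ContinuousOn.intervalIntegrable_of_Icc (Γ.len_pos β).le
      (((hslice s hs.1 β).norm.mul (hslice s hs.1 β).norm).div
        ((hslice s hs.1 β).norm.add continuousOn_const) fun y _ => by positivity)
  calc (Γ.integral fun β y => ‖f s β y‖) ≤
        Γ.integral fun β y => ‖f s β y‖ * ‖f s β y‖ / (‖f s β y‖ + 1) + 1 := by
        refine integral_mono (fun β y _ => ?_) (hintn s hs.1) fun β => (hi2 β).add (by simp)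
        rw [← sub_le_iff_le_add, le_div_iff₀ (by positivity)]
        nlinarith
    _ ≤ _ := by
        rw [integral_add hi2 (fun β => by simp)]
        exact add_le_add h2 le_rfl

/-- Weak convergence to a Dirac measure may be tested with time dependent functions. -/
theorem TendsToDirac.tendsto_pairing {f ψ : ℝ → E → ℝ → ℂ} {α : E} {x : ℝ}
    (hd : TendsToDirac Γ f α x)
    (hc : ∀ β, ContinuousOn (fun p : ℝ × ℝ => f p.1 β p.2) (Ioi 0 ×ˢ Icc 0 (Γ.len β)))
    {T : ℝ} (hT : 0 < T)
    (hψ : ∀ β, ContinuousOn (fun p : ℝ × ℝ => ψ p.1 β p.2) (Icc 0 T ×ˢ Icc 0 (Γ.len β))) :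
    Tendsto (fun t => Γ.integral fun β y => f t β y * ψ t β y) (𝓝[>] 0) (𝓝 (ψ 0 α x)) := by
  obtain ⟨M, hM⟩ := hd.exists_bound hc T
  have hslice (s : ℝ) (hs : 0 < s) (β : E) : ContinuousOn (f s β) (Icc 0 (Γ.len β)) :=
    (hc β).comp (f := fun y => (s, y)) (by fun_prop) fun y hy => ⟨hs, hy⟩
  have hψs (s : ℝ) (hs : s ∈ Icc 0 T) (β : E) : ContinuousOn (ψ s β) (Icc 0 (Γ.len β)) :=
    (hψ β).comp (f := fun y => (s, y)) (by fun_prop) fun y hy => ⟨hs, hy⟩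
  have h0 : (0 : ℝ) ∈ Icc 0 T := ⟨le_rfl, hT.le⟩
  have hunif (ε : ℝ) (hε : 0 < ε) : ∀ᶠ t in 𝓝[>] (0 : ℝ), ∀ β, ∀ y ∈ Icc 0 (Γ.len β),
      ‖ψ t β y - ψ 0 β y‖ ≤ ε := by
    refine eventually_all.2 fun β => ?_
    obtain ⟨δ, hδ, h⟩ := Metric.uniformContinuousOn_iff.1
      ((isCompact_Icc.prod isCompact_Icc).uniformContinuousOn_of_continuous (hψ β)) ε hε
    filter_upwards [Ioo_mem_nhdsGT (lt_min hδ hT)] with t ht y hy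
    rw [← dist_eq_norm]
    have htT : t ∈ Icc 0 T := ⟨ht.1.le, ht.2.le.trans (min_le_right _ _)⟩
    refine (h (t, y) ⟨htT, hy⟩ (0, y) ⟨h0, hy⟩ ?_).le
    rw [Prod.dist_eq, dist_self, Real.dist_eq, sub_zero, abs_of_pos ht.1]
    exact max_lt (ht.2.trans_le (min_le_left _ _)) hδ
  have hdiff : Tendsto (fun t => Γ.integral fun β y => f t β y * (ψ t β y - ψ 0 β y)) (𝓝[>] 0)
      (𝓝 0) := by
    rw [Metric.tendsto_nhds]
    intro ε hε
    have hM1 : 0 < |M| + 1 := by positivity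
    filter_upwards [hunif (ε / (|M| + 1) / 2) (by positivity), Ioc_mem_nhdsGT hT] with t ht htT
    rw [dist_zero_right]
    calc _ ≤ Γ.integral fun β y => ε / (|M| + 1) / 2 * ‖f t β y‖ := by
          refine norm_integral_le (fun β y hy => ?_) fun β =>
            ContinuousOn.intervalIntegrable_of_Icc (Γ.len_pos β).le
              (continuousOn_const.mul (hslice t htT.1 β).norm)
          rw [norm_mul, mul_comm]
          exact mul_le_mul_of_nonneg_right (ht β y hy) (norm_nonneg _)
      _ ≤ ε / (|M| + 1) / 2 * (|M| + 1) := by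
          rw [integral_const_mul]
          refine mul_le_mul_of_nonneg_left ?_ (by positivity)
          exact (hM t htT).trans ((le_abs_self M).trans (by linarith))
      _ < ε := by
          rw [div_mul_eq_mul_div, div_mul_cancel₀ _ hM1.ne']
          linarith
  have := (hd (ψ 0) fun β => hψs 0 h0 β).add hdiff
  rw [add_zero] at this
  refine this.congr' ?_
  filter_upwards [Ioc_mem_nhdsGT hT] with t ht
  have htT : t ∈ Icc 0 T := ⟨ht.1.le, ht.2⟩
  rw [← integral_add]
  · congr 1
    ext β y
    ring
  · exact fun β => ContinuousOn.intervalIntegrable_of_Icc (Γ.len_pos β).le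
      ((hslice t ht.1 β).mul (hψs 0 h0 β))
  · exact fun β => ContinuousOn.intervalIntegrable_of_Icc (Γ.len_pos β).le
      ((hslice t ht.1 β).mul ((hψs t htT β).sub (hψs 0 h0 β)))

variable [DecidableEq V] [DecidableEq E] {bc : Γ.BoundaryConditions}
  {f ft fy fyy g gt gy gyy : ℝ → E → ℝ → ℂ}

theorem HeatFlow.hasDerivAt_pairing (hf : HeatFlow bc f ft fy fyy) (hg : HeatFlow bc g gt gy gyy)
    {s t : ℝ} (hs : s ∈ Ioo 0 t) :
    HasDerivAt (fun s => Γ.integral fun β z => f s β z * starRingEnd ℂ (g (t - s) β z))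
      (Γ.integral fun β z => ft s β z * starRingEnd ℂ (g (t - s) β z) -
        f s β z * starRingEnd ℂ (gt (t - s) β z)) s := by
  obtain ⟨r, hr, hrs⟩ : ∃ r > 0, Icc (s - r) (s + r) ⊆ Ioo 0 t := by
    refine ⟨min s (t - s) / 2, by have := lt_min hs.1 (sub_pos.2 hs.2); positivity, fun z hz => ?_⟩
    have h1 := min_le_left s (t - s)
    have h2 := min_le_right s (t - s)
    have h3 := lt_min hs.1 (sub_pos.2 hs.2)
    constructor <;> linarith [hz.1, hz.2]
  have hnhd : Icc (s - r) (s + r) ∈ 𝓝 s := Icc_mem_nhds (by linarith) (by linarith)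
  refine HasDerivAt.fun_sum fun β _ => ?_
  have hsub : Icc (s - r) (s + r) ×ˢ Icc 0 (Γ.len β) ⊆ Ioi 0 ×ˢ Icc 0 (Γ.len β) :=
    prod_mono (fun z hz => (hrs hz).1) le_rfl
  have hmaps : MapsTo (fun p : ℝ × ℝ => (t - p.1, p.2)) (Icc (s - r) (s + r) ×ˢ Icc 0 (Γ.len β))
      (Ioi 0 ×ˢ Icc 0 (Γ.len β)) := fun p hp => ⟨sub_pos.2 (hrs hp.1).2, hp.2⟩
  have hrefl : ContinuousOn (fun p : ℝ × ℝ => (t - p.1, p.2))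
      (Icc (s - r) (s + r) ×ˢ Icc 0 (Γ.len β)) := by fun_prop
  have hF : ContinuousOn (fun p : ℝ × ℝ => f p.1 β p.2 * starRingEnd ℂ (g (t - p.1) β p.2))
      (Icc (s - r) (s + r) ×ˢ Icc 0 (Γ.len β)) :=
    ((hf.cont β).mono hsub).mul ((hg.cont β).comp hrefl hmaps).star
  have hF' : ContinuousOn (fun p : ℝ × ℝ => ft p.1 β p.2 * starRingEnd ℂ (g (t - p.1) β p.2) -
      f p.1 β p.2 * starRingEnd ℂ (gt (t - p.1) β p.2))
      (Icc (s - r) (s + r) ×ˢ Icc 0 (Γ.len β)) :=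
    (((hf.cont_time β).mono hsub).mul ((hg.cont β).comp hrefl hmaps).star).sub
      (((hf.cont β).mono hsub).mul ((hg.cont_time β).comp hrefl hmaps).star)
  obtain ⟨C, hC⟩ := (isCompact_Icc.prod isCompact_Icc).exists_bound_of_continuousOn hF'
  have hslice {h : ℝ × ℝ → ℂ} (hh : ContinuousOn h (Icc (s - r) (s + r) ×ˢ Icc 0 (Γ.len β)))
      {z : ℝ} (hz : z ∈ Icc (s - r) (s + r)) : ContinuousOn (fun y => h (z, y))
        (Icc 0 (Γ.len β)) :=
    hh.comp (f := fun y => (z, y)) (by fun_prop) fun y hy => ⟨hz, hy⟩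
  have hsm : s ∈ Icc (s - r) (s + r) := ⟨by linarith, by linarith⟩
  have hle := (Γ.len_pos β).le
  have hmeas {h : ℝ → ℂ} (hh : ContinuousOn h (Icc 0 (Γ.len β))) :
      AEStronglyMeasurable h (volume.restrict (uIoc 0 (Γ.len β))) := by
    rw [uIoc_of_le hle]
    exact (hh.mono Ioc_subset_Icc_self).aestronglyMeasurable measurableSet_Ioc
  refine (intervalIntegral.hasDerivAt_integral_of_dominated_loc_of_deriv_le
    (F := fun z y => f z β y * starRingEnd ℂ (g (t - z) β y))
    (F' := fun z y => ft z β y * starRingEnd ℂ (g (t - z) β y) -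
      f z β y * starRingEnd ℂ (gt (t - z) β y))
    (bound := fun _ => C) hnhd ?_ ?_ ?_ ?_ ?_ ?_).2
  · filter_upwards [hnhd] with z hz using hmeas (hslice hF hz)
  · exact ContinuousOn.intervalIntegrable_of_Icc hle (hslice hF hsm)
  · exact hmeas (hslice hF' hsm)
  · refine ae_of_all _ fun y hy z hz => hC (z, y) ⟨hz, ?_⟩
    rw [uIoc_of_le hle] at hy
    exact Ioc_subset_Icc_self hy
  · exact intervalIntegrable_const
  · refine ae_of_all _ fun y hy z hz => ?_
    rw [uIoc_of_le hle] at hy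
    have hz' := hrs hz
    have h1 := hf.time z hz'.1 β y (Ioc_subset_Icc_self hy)
    have h2 := hg.time (t - z) (sub_pos.2 hz'.2) β y (Ioc_subset_Icc_self hy)
    have h3 : HasDerivAt (fun z => t - z) (-1) z := (hasDerivAt_id z).const_sub t
    have h4 : HasDerivAt (fun z => g (t - z) β y) ((-1 : ℝ) • gt (t - z) β y) z :=
      HasDerivAt.scomp z h2 h3
    refine (h1.mul h4.star).congr_deriv ?_
    simp only [neg_smul, one_smul, star_neg, starRingEnd_apply]
    ring

/-- Duhamel's principle, as a bound: `f` solves the heat equation up to an error `ε`, and `g`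
solves it exactly. -/
theorem HeatFlow.duhamel [Fintype V] {U : E → ℝ → ℝ} (hf : HeatFlow bc f ft fy fyy)
    (hg : HeatFlow bc g gt gy gyy)
    (hgU : ∀ t > 0, ∀ β, ∀ y ∈ Icc 0 (Γ.len β), gt t β y = gyy t β y + (U β y : ℂ) * g t β y)
    {α β : E} {x y : ℝ}
    (hfd : TendsToDirac Γ f α x) (hgd : TendsToDirac Γ g β y) {t ε M : ℝ} (ht : 0 < t)
    (hε : ∀ s ∈ Ioo 0 t, ∀ β, ∀ z ∈ Icc 0 (Γ.len β),
      ‖ft s β z - fyy s β z - (U β z : ℂ) * f s β z‖ ≤ ε)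
    (hε0 : 0 ≤ ε) (hM : ∀ s ∈ Ioo 0 t, (Γ.integral fun β z => ‖g s β z‖) ≤ M) :
    ‖f t β y - starRingEnd ℂ (g t α x)‖ ≤ ε * M * t := by
  set F : ℝ → ℂ := fun s => Γ.integral fun β z => f s β z * starRingEnd ℂ (g (t - s) β z) with hFdef
  set F' : ℝ → ℂ := fun s => Γ.integral fun β z => ft s β z * starRingEnd ℂ (g (t - s) β z) -
        f s β z * starRingEnd ℂ (gt (t - s) β z)
  have hF' (s : ℝ) (hs : s ∈ Ioo 0 t) : ‖F' s‖ ≤ ε * M := by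
    have hts : 0 < t - s := sub_pos.2 hs.2
    have e1 : F' s = (Γ.integral fun β z => (ft s β z - fyy s β z - (U β z : ℂ) * f s β z) *
        starRingEnd ℂ (g (t - s) β z)) := by
      have hgreen := HeatFlow.integral_green hf hg hs.1 hts
      have c1 (β : E) := HeatFlow.continuousOn_slice hs.1 (hf.cont β)
      have c2 (β : E) := HeatFlow.continuousOn_slice hs.1 (hf.cont_time β)
      have c3 (β : E) := HeatFlow.continuousOn_slice hs.1 (hf.cont_space β)
      have c4 (β : E) := HeatFlow.continuousOn_slice hts (hg.cont β)
      have c5 (β : E) := HeatFlow.continuousOn_slice hts (hg.cont_space β)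
      have c6 (β : E) := HeatFlow.continuousOn_slice hts (hg.cont_time β)
      rw [← sub_zero (F' s), ← hgreen, ← integral_sub]
      · refine integral_congr fun β z hz => ?_
        rw [hgU _ hts β z hz]
        simp only [map_add, map_mul, Complex.conj_ofReal]
        ring
      · exact fun β => ContinuousOn.intervalIntegrable_of_Icc (Γ.len_pos β).le
          (((c2 β).mul (c4 β).star).sub ((c1 β).mul (c6 β).star))
      · exact fun β => ContinuousOn.intervalIntegrable_of_Icc (Γ.len_pos β).le
          (((c3 β).mul (c4 β).star).sub ((c1 β).mul (c5 β).star))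
    rw [e1]
    calc _ ≤ Γ.integral fun β z => ε * ‖g (t - s) β z‖ := by
          refine norm_integral_le (fun β z hz => ?_) fun β =>
            ContinuousOn.intervalIntegrable_of_Icc (Γ.len_pos β).le
              (continuousOn_const.mul (HeatFlow.continuousOn_slice hts (hg.cont β)).norm)
          rw [norm_mul, RCLike.norm_conj]
          exact mul_le_mul_of_nonneg_right (hε s hs β z hz) (norm_nonneg _)
      _ ≤ ε * M := by
          rw [integral_const_mul]
          exact mul_le_mul_of_nonneg_left (hM _ ⟨hts, by linarith [hs.1]⟩) hε0
  have hεM : 0 ≤ ε * M := (norm_nonneg _).trans (hF' (t / 2) ⟨by linarith, by linarith⟩)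
  have hmvt (a b : ℝ) (ha : a ∈ Ioo 0 t) (hb : b ∈ Ioo 0 t) : ‖F b - F a‖ ≤ ε * M * t := by
    have h := (convex_Ioo 0 t).norm_image_sub_le_of_norm_hasDerivWithin_le
      (fun s hs => (HeatFlow.hasDerivAt_pairing hf hg hs).hasDerivWithinAt) hF' ha hb
    refine h.trans (mul_le_mul_of_nonneg_left ?_ hεM)
    rw [Real.norm_eq_abs, abs_le]
    constructor <;> linarith [ha.1, ha.2, hb.1, hb.2]
  have hlim0 : Tendsto F (𝓝[>] 0) (𝓝 (starRingEnd ℂ (g t α x))) := by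
    have h := hfd.tendsto_pairing (ψ := fun s β z => starRingEnd ℂ (g (t - s) β z)) hf.cont
      (T := t / 2) (by linarith) fun β => ?_
    · simpa using h
    · refine ((hg.cont β).comp (f := fun p : ℝ × ℝ => (t - p.1, p.2)) (by fun_prop) ?_).star
      exact fun p hp => ⟨sub_pos.2 (lt_of_le_of_lt hp.1.2 (by linarith)), hp.2⟩
  have hlim1 : Tendsto (fun s => F (t - s)) (𝓝[>] 0) (𝓝 (f t β y)) := by
    have h := hgd.tendsto_pairing (ψ := fun s β z => starRingEnd ℂ (f (t - s) β z)) hg.cont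
      (T := t / 2) (by linarith) fun β => ?_
    · have h' := (Complex.continuous_conj.tendsto _).comp h
      simp only [sub_zero, Complex.conj_conj] at h'
      refine h'.congr fun s => ?_
      simp only [Function.comp_def, hFdef, sub_sub_cancel, MetricGraph.integral, map_sum]
      refine Finset.sum_congr rfl fun β _ => ?_
      rw [intervalIntegral.integral_of_le (Γ.len_pos β).le,
        intervalIntegral.integral_of_le (Γ.len_pos β).le, ← integral_conj]
      congr 1
      ext z
      rw [map_mul, Complex.conj_conj, mul_comm]
    · refine ((hf.cont β).comp (f := fun p : ℝ × ℝ => (t - p.1, p.2)) (by fun_prop) ?_).star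
      exact fun p hp => ⟨sub_pos.2 (lt_of_le_of_lt hp.1.2 (by linarith)), hp.2⟩
  have hev : ∀ᶠ s in 𝓝[>] (0 : ℝ), s ∈ Ioo 0 t := Ioo_mem_nhdsGT ht
  have hstep (b : ℝ) (hb : b ∈ Ioo 0 t) : ‖F b - starRingEnd ℂ (g t α x)‖ ≤ ε * M * t :=
    le_of_tendsto (tendsto_const_nhds.sub hlim0).norm
      (hev.mono fun a ha => hmvt a b ha hb)
  exact le_of_tendsto (hlim1.sub tendsto_const_nhds).norm
    (hev.mono fun s hs => hstep (t - s) ⟨by linarith [hs.2], by linarith [hs.1]⟩)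

end MetricGraph

namespace MetricGraph

/-! ### Comparison of the heat kernel with a parametrix -/

variable {V : Type u} {E : Type v} {Γ : MetricGraph V E} [Fintype E] [DecidableEq V]
  [DecidableEq E] {bc : Γ.BoundaryConditions} {U : E → ℝ → ℝ}

theorem BoundaryConditions.IsHeatKernel.heatFlow {e : ℝ → E → ℝ → E → ℝ → ℂ}
    (hU : ∀ β, ContinuousOn (U β) (Icc 0 (Γ.len β))) (he : bc.IsHeatKernel U e) {α : E} {x : ℝ}
    (hx : x ∈ Icc 0 (Γ.len α)) :
    HeatFlow bc (fun t => e t α x) (fun t β y => deriv (fun s => e s α x β y) t)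
      (fun t β => derivWithin (e t α x β) (Icc 0 (Γ.len β)))
      (fun t β => iteratedDerivWithin 2 (e t α x β) (Icc 0 (Γ.len β))) := by
  have hcont (β : E) : ContinuousOn (fun p : ℝ × ℝ => e p.1 α x β p.2)
      (Ioi 0 ×ˢ Icc 0 (Γ.len β)) :=
    (he.continuous α β).comp (f := fun p : ℝ × ℝ => (p.1, x, p.2)) (by fun_prop)
      fun p hp => ⟨hp.1, hx, hp.2⟩
  have hcont_t (β : E) := he.continuous_deriv_time α β x hx
  have hspace (t : ℝ) (ht : 0 < t) (β : E) (y : ℝ) (hy : y ∈ Icc 0 (Γ.len β)) :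
      HasDerivWithinAt (e t α x β) (derivWithin (e t α x β) (Icc 0 (Γ.len β)) y)
        (Icc 0 (Γ.len β)) y :=
    ((he.contDiff_space t ht α β x hx).differentiableOn (by norm_num) y hy).hasDerivWithinAt
  have hbd (t : ℝ) (ht : 0 < t) (w : V) : bc.sigma w *ᵥ
      (fun α' : Γ.EdgesAt w => starRingEnd ℂ (e t α x α' (Γ.coord w α' 0))) =
        (fun α' : Γ.EdgesAt w => starRingEnd ℂ (e t α x α' (Γ.coord w α' 0))) ∧
      bc.sigma w *ᵥ (fun β : Γ.EdgesAt w => (Γ.orient w β : ℂ) *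
        starRingEnd ℂ (derivWithin (e t α x β) (Icc 0 (Γ.len β)) (Γ.coord w β 0))) =
      -fun β : Γ.EdgesAt w => (Γ.orient w β : ℂ) *
        starRingEnd ℂ (derivWithin (e t α x β) (Icc 0 (Γ.len β)) (Γ.coord w β 0)) := by
    refine bc.sigma_mulVec_of_boundary w ?_
    rw [← he.boundary t ht α x hx w]
    congr 2
    ext β
    have h0 : (0 : ℝ) ∈ Icc 0 (Γ.len β) := ⟨le_rfl, (Γ.len_pos β).le⟩
    have h1 := hspace t ht β _ (coord_mem_Icc (w := w) h0)
    have h2 := HasDerivWithinAt.scomp (0 : ℝ) h1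
      ((hasDerivAt_coord w (β : E) 0).hasDerivWithinAt (s := Icc 0 (Γ.len β)))
      fun y hy => coord_mem_Icc hy
    rw [vertexDeriv, iteratedDerivWithin_one]
    have h3 := (h2.star.derivWithin (uniqueDiffOn_Icc (Γ.len_pos β) 0 h0)).symm
    rw [star_smul, star_trivial, Complex.real_smul] at h3
    exact h3
  refine ⟨hcont, hcont_t, fun β => ?_, fun t ht β y hy => ?_, hspace, fun t ht β y hy => ?_,
    fun t ht w => (hbd t ht w).1, fun t ht w => (hbd t ht w).2⟩
  · have h : ContinuousOn (fun p : ℝ × ℝ => (U β p.2 : ℂ)) (Ioi (0 : ℝ) ×ˢ Icc 0 (Γ.len β)) :=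
      Complex.continuous_ofReal.comp_continuousOn
        ((hU β).comp continuousOn_snd fun p hp => hp.2)
    refine ((hcont_t β).sub (h.mul (hcont β))).congr fun p hp => ?_
    have := he.heat_equation p.1 hp.1 α β x hx p.2 hp.2
    simp only [Pi.sub_apply, Pi.mul_apply]
    linear_combination -this
  · exact ((he.differentiable_time α β x hx y hy t ht).differentiableAt
      (Ioi_mem_nhds ht)).hasDerivAt
  · have hu := uniqueDiffOn_Icc (Γ.len_pos β)
    have h1 : ContDiffOn ℝ 1 (derivWithin (e t α x β) (Icc 0 (Γ.len β))) (Icc 0 (Γ.len β)) :=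
      (he.contDiff_space t ht α β x hx).derivWithin hu (by norm_num)
    have h2 := (h1.differentiableOn (by norm_num) y hy).hasDerivWithinAt
    rw [← iteratedDerivWithin_one, ← iteratedDerivWithin_succ] at h2
    rwa [iteratedDerivWithin_one] at h2

theorem BoundaryConditions.IsHeatKernel.time_eq {e : ℝ → E → ℝ → E → ℝ → ℂ}
    (he : bc.IsHeatKernel U e) {α : E} {x : ℝ} (hx : x ∈ Icc 0 (Γ.len α)) :
    ∀ t > 0, ∀ β, ∀ y ∈ Icc 0 (Γ.len β), deriv (fun s => e s α x β y) t =
      iteratedDerivWithin 2 (e t α x β) (Icc 0 (Γ.len β)) y + (U β y : ℂ) * e t α x β y :=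
  fun t ht β y hy => sub_eq_zero.1 (he.heat_equation t ht α β x hx y hy)

/-- The heat kernel is Hermitian. -/
theorem BoundaryConditions.IsHeatKernel.hermitian [Fintype V] {e : ℝ → E → ℝ → E → ℝ → ℂ}
    (hU : ∀ β, ContinuousOn (U β) (Icc 0 (Γ.len β))) (he : bc.IsHeatKernel U e) {α β : E} {x y : ℝ}
    (hx : x ∈ Ioo 0 (Γ.len α)) (hy : y ∈ Ioo 0 (Γ.len β)) {t : ℝ} (ht : 0 < t) :
    e t α x β y = starRingEnd ℂ (e t β y α x) := by
  have hx' := Ioo_subset_Icc_self hx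
  have hy' := Ioo_subset_Icc_self hy
  have hfx := he.heatFlow hU hx'
  have hfy := he.heatFlow hU hy'
  obtain ⟨M, hM⟩ := TendsToDirac.exists_bound (he.initial β y hy) hfy.cont t
  have := HeatFlow.duhamel hfx hfy (he.time_eq hy') (he.initial α x hx) (he.initial β y hy) ht
    (ε := 0) (fun s hs β' z hz => ?_) le_rfl fun s hs => hM s ⟨hs.1, hs.2.le⟩
  · rw [zero_mul, zero_mul] at this
    exact sub_eq_zero.1 (norm_le_zero_iff.1 this)
  · rw [he.time_eq hx' s hs.1 β' z hz, add_sub_cancel_left, sub_self, norm_zero]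

/-- The properties of an approximate heat kernel `p` of order `k` that are used in the comparison
with the exact one; `pt`, `py`, `pyy` are its derivatives. -/
structure IsParametrix (bc : Γ.BoundaryConditions) (U : E → ℝ → ℝ) (k : ℕ)
    (p pt py pyy : ℝ → E → ℝ → E → ℝ → ℂ) : Prop where
  flow : ∀ α, ∀ x ∈ Ioo 0 (Γ.len α), HeatFlow bc (fun t => p t α x) (fun t => pt t α x)
    (fun t => py t α x) (fun t => pyy t α x)
  dirac : ∀ α, ∀ x ∈ Ioo 0 (Γ.len α), TendsToDirac Γ (fun t => p t α x) α x
  cont : ∀ t > 0, ∀ α β, ContinuousOn (fun q : ℝ × ℝ => p t α q.1 β q.2)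
    (Icc 0 (Γ.len α) ×ˢ Icc 0 (Γ.len β))
  defect : ∃ C, ∀ t ∈ Ioc (0 : ℝ) 1, ∀ α, ∀ x ∈ Icc 0 (Γ.len α), ∀ β, ∀ y ∈ Icc 0 (Γ.len β),
    ‖pt t α x β y - pyy t α x β y - (U β y : ℂ) * p t α x β y‖ ≤ C * t ^ ((k : ℝ) - 1 / 2)
  bound : ∃ C, ∀ t ∈ Ioc (0 : ℝ) 1, ∀ β, ∀ y ∈ Icc 0 (Γ.len β),
    (Γ.integral fun α x => ‖p t α x β y‖) ≤ C

/-- The heat kernel agrees with a parametrix of order `k` up to `O(t ^ (k + 1/2))`. -/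
theorem IsParametrix.exists_norm_sub_le [Fintype V] {e : ℝ → E → ℝ → E → ℝ → ℂ}
    (hU : ∀ β, ContinuousOn (U β) (Icc 0 (Γ.len β))) (he : bc.IsHeatKernel U e) {k : ℕ}
    (hk : 1 ≤ k) {p pt py pyy : ℝ → E → ℝ → E → ℝ → ℂ} (hp : IsParametrix bc U k p pt py pyy) :
    ∃ C T : ℝ, 0 < T ∧ T ≤ 1 ∧ ∀ t ∈ Ioc 0 T, ∀ α, ∀ x ∈ Icc 0 (Γ.len α), ∀ β,
      ∀ y ∈ Icc 0 (Γ.len β), ‖e t α x β y - p t α x β y‖ ≤ C * t ^ ((k : ℝ) + 1 / 2) := by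
  obtain ⟨C, hC⟩ := hp.defect
  obtain ⟨K, hK⟩ := hp.bound
  set G : ℝ := Γ.integral fun _ _ => (1 : ℝ) with hG
  have hG0 : 0 ≤ G := by
    simp only [hG, MetricGraph.integral, intervalIntegral.integral_const, sub_zero, smul_eq_mul,
      mul_one]
    exact Finset.sum_nonneg fun β _ => (Γ.len_pos β).le
  have hk' : (1 : ℝ) ≤ k := by exact_mod_cast hk
  -- Duhamel's principle, given a bound in `L¹`
  have hduh {t : ℝ} (ht : t ∈ Ioc (0 : ℝ) 1) {α β : E} {x y : ℝ} (hx : x ∈ Ioo 0 (Γ.len α))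
      (hy : y ∈ Ioo 0 (Γ.len β)) {M : ℝ}
      (hM : ∀ s ∈ Ioc 0 t, (Γ.integral fun β' z => ‖e s β y β' z‖) ≤ M) :
      ‖p t α x β y - starRingEnd ℂ (e t β y α x)‖ ≤ |C| * M * t ^ ((k : ℝ) + 1 / 2) := by
    have hy' := Ioo_subset_Icc_self hy
    have h := HeatFlow.duhamel (hp.flow α x hx) (he.heatFlow hU hy') (he.time_eq hy')
      (hp.dirac α x hx) (he.initial β y hy) ht.1 (ε := |C| * t ^ ((k : ℝ) - 1 / 2))
      (fun s hs β' z hz => ?_) (by have := ht.1; positivity) fun s hs => hM s ⟨hs.1, hs.2.le⟩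
    · refine h.trans (le_of_eq ?_)
      rw [show (k : ℝ) + 1 / 2 = (k : ℝ) - 1 / 2 + 1 by ring, Real.rpow_add_one ht.1.ne']
      ring
    · refine (hC s ⟨hs.1, hs.2.le.trans ht.2⟩ α x (Ioo_subset_Icc_self hx) β' z hz).trans ?_
      have hs0 := hs.1
      exact mul_le_mul (le_abs_self C) (Real.rpow_le_rpow hs.1.le hs.2.le (by linarith))
        (by positivity) (abs_nonneg _)
  obtain ⟨T, hT0, hT1, hT⟩ : ∃ T : ℝ, 0 < T ∧ T ≤ 1 ∧ G * |C| * T ≤ 1 / 2 := by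
    refine ⟨min 1 (1 / (2 * (G * |C| + 1))), by positivity, min_le_left _ _, ?_⟩
    calc G * |C| * min 1 (1 / (2 * (G * |C| + 1))) ≤
          (G * |C| + 1) * (1 / (2 * (G * |C| + 1))) := by
          refine mul_le_mul (by linarith) (min_le_right _ _) (by positivity) (by positivity)
      _ = 1 / 2 := by field_simp
  -- a bound in `L¹` that is uniform in the base point
  have hL {β : E} {y : ℝ} (hy : y ∈ Ioo 0 (Γ.len β)) :
      ∀ s ∈ Ioc 0 T, (Γ.integral fun β' z => ‖e s β y β' z‖) ≤ 2 * K := by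
    have hy' := Ioo_subset_Icc_self hy
    have hflow := he.heatFlow hU hy'
    set m : ℝ → ℝ := fun s => Γ.integral fun β' z => ‖e s β y β' z‖
    obtain ⟨M, hM⟩ := TendsToDirac.exists_bound (he.initial β y hy) hflow.cont T
    have hbdd : BddAbove (m '' Ioc 0 T) := ⟨M, by rintro _ ⟨s, hs, rfl⟩; exact hM s hs⟩
    set S := sSup (m '' Ioc 0 T)
    have hmS (s : ℝ) (hs : s ∈ Ioc 0 T) : m s ≤ S := le_csSup hbdd ⟨s, hs, rfl⟩
    have hm0 (s : ℝ) : 0 ≤ m s := Finset.sum_nonneg fun β' _ =>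
      intervalIntegral.integral_nonneg (Γ.len_pos β').le fun z _ => norm_nonneg _
    have hS0 : 0 ≤ S := (hm0 T).trans (hmS T ⟨hT0, le_rfl⟩)
    have hstep (t : ℝ) (ht : t ∈ Ioc 0 T) : m t ≤ K + 1 / 2 * S := by
      have ht1 : t ∈ Ioc (0 : ℝ) 1 := ⟨ht.1, ht.2.trans hT1⟩
      have hi1 (β' : E) : IntervalIntegrable (fun z => ‖p t β' z β y‖) volume 0 (Γ.len β') :=
        ContinuousOn.intervalIntegrable_of_Icc (Γ.len_pos β').le
          ((hp.cont t ht.1 β' β).comp (f := fun z => (z, y)) (by fun_prop)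
            fun z hz => ⟨hz, hy'⟩).norm
      have hpow : t ^ ((k : ℝ) + 1 / 2) ≤ T :=
        (Real.rpow_le_rpow_of_exponent_ge ht.1 ht1.2 (by linarith)).trans
          ((Real.rpow_one t).le.trans ht.2)
      calc m t ≤ Γ.integral fun β' z => ‖p t β' z β y‖ + |C| * S * T * 1 := by
            refine integral_mono (fun β' z hz => ?_) (fun β' =>
              ContinuousOn.intervalIntegrable_of_Icc (Γ.len_pos β').le
                (HeatFlow.continuousOn_slice (h := fun t => e t β y) ht.1 (hflow.cont β')).norm)
              fun β' => (hi1 β').add intervalIntegrable_const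
            have h1 := hduh ht1 hz hy (M := S) fun s hs => hmS s ⟨hs.1, hs.2.trans ht.2⟩
            have h2 : |C| * S * t ^ ((k : ℝ) + 1 / 2) ≤ |C| * S * T :=
              mul_le_mul_of_nonneg_left hpow (by positivity)
            have h3 := norm_sub_norm_le (starRingEnd ℂ (e t β y β' z)) (p t β' z β y)
            rw [RCLike.norm_conj, norm_sub_rev] at h3
            linarith
        _ = (Γ.integral fun β' z => ‖p t β' z β y‖) + |C| * S * T * G := by
            rw [integral_add hi1 (fun β' => intervalIntegrable_const), integral_const_mul]
        _ ≤ _ := by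
            have h1 := hK t ht1 β y hy'
            have h2 := mul_le_mul_of_nonneg_right hT hS0
            linarith
    have hS : S ≤ K + 1 / 2 * S :=
      csSup_le ⟨_, ⟨T, ⟨hT0, le_rfl⟩, rfl⟩⟩ (by rintro _ ⟨s, hs, rfl⟩; exact hstep s hs)
    exact fun s hs => (hmS s hs).trans (by linarith)
  refine ⟨|C| * (2 * K), T, hT0, hT1, fun t ht α x hx β y hy => ?_⟩
  have hcl : closure (Ioo 0 (Γ.len α) ×ˢ Ioo 0 (Γ.len β)) =
      Icc 0 (Γ.len α) ×ˢ Icc 0 (Γ.len β) := by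
    rw [closure_prod_eq, closure_Ioo (Γ.len_pos α).ne, closure_Ioo (Γ.len_pos β).ne]
  have hcont : ContinuousOn (fun q : ℝ × ℝ => ‖e t α q.1 β q.2 - p t α q.1 β q.2‖)
      (Icc 0 (Γ.len α) ×ˢ Icc 0 (Γ.len β)) :=
    (((he.continuous α β).comp (f := fun q : ℝ × ℝ => (t, q.1, q.2)) (by fun_prop)
      fun q hq => ⟨ht.1, hq⟩).sub (hp.cont t ht.1 α β)).norm
  refine le_on_closure (s := Ioo 0 (Γ.len α) ×ˢ Ioo 0 (Γ.len β))
    (f := fun q : ℝ × ℝ => ‖e t α q.1 β q.2 - p t α q.1 β q.2‖)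
    (g := fun _ => |C| * (2 * K) * t ^ ((k : ℝ) + 1 / 2)) (fun q hq => ?_) (hcl ▸ hcont)
    continuousOn_const (x := (x, y)) (hcl ▸ ⟨hx, hy⟩)
  rw [he.hermitian hU hq.1 hq.2 ht.1, norm_sub_rev]
  exact hduh ⟨ht.1, ht.2.trans hT1⟩ hq.1 hq.2 fun s hs => hL hq.2 s ⟨hs.1, hs.2.trans ht.2⟩

end MetricGraph

/-! ### A parametrix that satisfies the boundary conditions exactly -/

/-- A smooth function on the line that is `1` for `y ≤ 7 ℓ / 10` and `0` for `y ≥ 9 ℓ / 10`. -/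
noncomputable def farCutoff (ℓ y : ℝ) : ℝ := Real.smoothTransition (9 / 2 - 5 * (y / ℓ))

theorem contDiff_farCutoff (ℓ : ℝ) : ContDiff ℝ ∞ (farCutoff ℓ) :=
  Real.smoothTransition.contDiff.comp
    (contDiff_const.sub (contDiff_const.mul (contDiff_id.div_const ℓ)))

theorem contDiff_farCutoff_neg (ℓ : ℝ) : ContDiff ℝ ∞ fun y => farCutoff ℓ (-y) :=
  (contDiff_farCutoff ℓ).comp contDiff_neg

theorem farCutoff_eq_one {ℓ y : ℝ} (hℓ : 0 < ℓ) (hy : y ≤ 7 / 10 * ℓ) : farCutoff ℓ y = 1 := by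
  refine Real.smoothTransition.one_of_one_le ?_
  have : y / ℓ ≤ 7 / 10 := (div_le_iff₀ hℓ).2 hy
  linarith

theorem farCutoff_eq_zero {ℓ y : ℝ} (hℓ : 0 < ℓ) (hy : 9 / 10 * ℓ ≤ y) : farCutoff ℓ y = 0 := by
  refine Real.smoothTransition.zero_of_nonpos ?_
  have : 9 / 10 ≤ y / ℓ := (le_div_iff₀ hℓ).2 hy
  linarith

theorem farCutoff_mem_Icc (ℓ y : ℝ) : farCutoff ℓ y ∈ Icc (0 : ℝ) 1 :=
  ⟨Real.smoothTransition.nonneg _, Real.smoothTransition.le_one _⟩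

theorem deriv_eq_zero_of_eventually_const {f : ℝ → ℝ} {c y : ℝ} (h : ∀ᶠ z in 𝓝 y, f z = c) :
    deriv f y = 0 ∧ deriv (deriv f) y = 0 := by
  have h' : f =ᶠ[𝓝 y] fun _ => c := h
  refine ⟨by rw [h'.deriv_eq, deriv_const], ?_⟩
  rw [h'.deriv.deriv_eq]
  simp

theorem deriv_farCutoff_eq_zero {ℓ y : ℝ} (hℓ : 0 < ℓ) (hy : y < 7 / 10 * ℓ ∨ 9 / 10 * ℓ < y) :
    (deriv (farCutoff ℓ) y = 0 ∧ deriv (deriv (farCutoff ℓ)) y = 0) ∧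
    deriv (fun z => farCutoff ℓ (-z)) (-y) = 0 ∧
      deriv (deriv fun z => farCutoff ℓ (-z)) (-y) = 0 := by
  have hc : ∃ c, ∀ᶠ z in 𝓝 y, farCutoff ℓ z = c := by
    rcases hy with hy | hy
    · exact ⟨1, by filter_upwards [Iio_mem_nhds hy] with z hz using farCutoff_eq_one hℓ hz.le⟩
    · exact ⟨0, by
        filter_upwards [Ioi_mem_nhds hy] with z hz using farCutoff_eq_zero hℓ (le_of_lt hz)⟩
  obtain ⟨c, hc⟩ := hc
  refine ⟨deriv_eq_zero_of_eventually_const hc, deriv_eq_zero_of_eventually_const (c := c) ?_⟩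
  have : Tendsto (fun z : ℝ => -z) (𝓝 (-y)) (𝓝 y) := by
    simpa using (continuous_neg.tendsto (-y))
  exact this.eventually hc

namespace MetricGraph

variable {V : Type u} {E : Type v} {Γ : MetricGraph V E} [DecidableEq V]

/-- Smooth functions on the whole line that extend the potentials glued at the vertices. -/
def IsExtension (Γ : MetricGraph V E) (U : E → ℝ → ℝ)
    (W : ∀ w : V, Γ.EdgesAt w → Γ.EdgesAt w → ℝ → ℝ) : Prop :=
  ∀ w (α β : Γ.EdgesAt w), ContDiff ℝ ∞ (W w α β) ∧
    EqOn (Γ.glue U w α β) (W w α β) (Icc (-Γ.len β) (Γ.len α))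

theorem IsSmoothPotential.exists_isExtension {U : E → ℝ → ℝ} (hU : Γ.IsSmoothPotential U) :
    ∃ W, IsExtension Γ U W := by
  choose W hW using fun (w : V) (α β : Γ.EdgesAt w) => hU.exists_extension α.2 β.2
  exact ⟨W, hW⟩

section extension

variable {U : E → ℝ → ℝ} {W : ∀ w : V, Γ.EdgesAt w → Γ.EdgesAt w → ℝ → ℝ}

theorem IsExtension.eq_of_nonneg (hW : IsExtension Γ U W) {w : V} (α β : Γ.EdgesAt w) {z : ℝ}
    (hz : z ∈ Icc 0 (Γ.len α)) : W w α β z = Γ.atVertex U w α z := by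
  rw [← (hW w α β).2 ⟨by linarith [hz.1, Γ.len_pos β], hz.2⟩, glue, if_pos hz.1]

theorem IsExtension.eq_of_nonpos (hW : IsExtension Γ U W) (hU : Γ.IsSmoothPotential U) {w : V}
    (α β : Γ.EdgesAt w) {z : ℝ} (hz : z ∈ Icc 0 (Γ.len β)) :
    W w α β (-z) = Γ.atVertex U w β z := by
  rcases eq_or_lt_of_le hz.1 with h | h
  · subst h
    rw [neg_zero, hW.eq_of_nonneg α β ⟨le_rfl, (Γ.len_pos α).le⟩]
    simpa [vertexDeriv] using hU.even w α β α.2 β.2 0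
  · rw [← (hW w α β).2 ⟨neg_le_neg hz.2, by linarith [Γ.len_pos α]⟩, glue,
      if_neg (by linarith), neg_neg]

theorem IsExtension.eqOn (hW : IsExtension Γ U W) {w : V} (α β γ : Γ.EdgesAt w) :
    EqOn (W w α β) (W w α γ) (Icc 0 (Γ.len α)) := fun z hz => by
  rw [hW.eq_of_nonneg α β hz, hW.eq_of_nonneg α γ hz]

/-- The parametrix on the line and its `y`-derivative at the vertex only depend on the potential
on the edge that carries the first point. -/
theorem IsExtension.lineParametrix_zero (hW : IsExtension Γ U W) {w : V} (α β : Γ.EdgesAt w) (k : ℕ)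
    {t x : ℝ} (hx : x ∈ Ioo 0 (Γ.len α)) :
    lineParametrix (W w α β) k t x 0 = lineParametrix (W w α α) k t x 0 ∧
      lineParametrixY (W w α β) k t x 0 = lineParametrixY (W w α α) k t x 0 := by
  have h0 : (0 : ℝ) ∈ Icc 0 (Γ.len α) := ⟨le_rfl, (Γ.len_pos α).le⟩
  have h1 (l : ℕ) : transportCoeff (W w α β) l x 0 = transportCoeff (W w α α) l x 0 :=
    transportCoeff_congr (hW.eqOn α β α) l hx h0
  have h2 (l : ℕ) : deriv (transportCoeff (W w α β) l x) 0 =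
      deriv (transportCoeff (W w α α) l x) 0 :=
    deriv_transportCoeff_congr (hW w α β).1 (hW w α α).1 (hW.eqOn α β α) l hx h0
  simp only [lineParametrix, lineParametrixY, h1, h2, and_self]

end extension

variable [Fintype E] [DecidableEq E] (bc : Γ.BoundaryConditions)
  (W : ∀ w : V, Γ.EdgesAt w → Γ.EdgesAt w → ℝ → ℝ)

/-- The direct and the reflected contribution of the vertex `w`, in the coordinates that start at
`w`, for a function `Φ R W t x y` on the line, to be used with `Φ = cutParametrix k` and its
derivatives. The number of `y`-derivatives that led to `Φ` is `j`; it determines the sign of the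
reflected part. -/
noncomputable def vertexTerm (Φ : (ℝ → ℝ) → (ℝ → ℝ) → ℝ → ℝ → ℝ → ℝ) (j : ℕ) (w : V)
    (α β : Γ.EdgesAt w) (t x y : ℝ) : ℂ :=
  (if α = β then (Φ (farCutoff (Γ.len β)) (W w α α) t x y : ℂ) else 0) +
    bc.sigma w α β *
      ((-1) ^ j * (Φ (fun y => farCutoff (Γ.len β) (-y)) (W w α β) t x (-y) : ℂ))

/-- The sum of the contributions of all vertices, as a function on the graph; `j` is the number of
`y`-derivatives. -/
noncomputable def assemble [Fintype V] (η : ℝ → ℝ) (Φ : (ℝ → ℝ) → (ℝ → ℝ) → ℝ → ℝ → ℝ → ℝ) (j : ℕ)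
    (t : ℝ) (α : E) (x : ℝ) (β : E) (y : ℝ) : ℂ :=
  ∑ w : V, if h : Γ.Incident α w ∧ Γ.Incident β w then
    (Γ.chi η w α x : ℂ) * ((Γ.orient w β : ℂ) ^ j *
      vertexTerm bc W Φ j w ⟨α, h.1⟩ ⟨β, h.2⟩ t (Γ.coord w α x) (Γ.coord w β y))
  else 0

section derivatives

variable {bc W} {U : E → ℝ → ℝ} (hW : IsExtension Γ U W)
  {Φ Φ' : (ℝ → ℝ) → (ℝ → ℝ) → ℝ → ℝ → ℝ → ℝ}

include hW in
theorem hasDerivAt_vertexTerm {t x : ℝ}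
    (h : ∀ R W : ℝ → ℝ, ContDiff ℝ ∞ R → ContDiff ℝ ∞ W → ∀ y,
      HasDerivAt (Φ R W t x) (Φ' R W t x y) y) (j : ℕ) (w : V) (α β : Γ.EdgesAt w) (y : ℝ) :
    HasDerivAt (vertexTerm bc W Φ j w α β t x) (vertexTerm bc W Φ' (j + 1) w α β t x y) y := by
  refine HasDerivAt.add ?_ ?_
  · split_ifs
    · exact (h _ _ (contDiff_farCutoff _) (hW w α α).1 y).ofReal_comp
    · exact hasDerivAt_const _ _
  · have h1 := h _ _ (contDiff_farCutoff_neg (Γ.len β)) (hW w α β).1 (-y)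
    have h2 := (HasDerivAt.comp y h1 (hasDerivAt_neg y)).ofReal_comp
    refine ((h2.const_mul ((-1) ^ j)).const_mul (bc.sigma w α β)).congr_deriv ?_
    push_cast
    ring

include hW in
theorem hasDerivAt_assemble [Fintype V] (η : ℝ → ℝ) {t : ℝ}
    (h : ∀ R W : ℝ → ℝ, ContDiff ℝ ∞ R → ContDiff ℝ ∞ W → ∀ x y,
      HasDerivAt (Φ R W t x) (Φ' R W t x y) y) (j : ℕ) (α : E) (x : ℝ) (β : E) (y : ℝ) :
    HasDerivAt (assemble bc W η Φ j t α x β) (assemble bc W η Φ' (j + 1) t α x β y) y := by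
  refine HasDerivAt.fun_sum fun w _ => ?_
  split_ifs with hw
  · have h1 := hasDerivAt_vertexTerm (bc := bc) hW
      (fun R W hR hW y => h R W hR hW (Γ.coord w α x) y)
      j w ⟨α, hw.1⟩ ⟨β, hw.2⟩ (Γ.coord w β y)
    have h2 := HasDerivAt.scomp y h1 (hasDerivAt_coord w β y)
    refine ((h2.const_mul _).const_mul _).congr_deriv ?_
    rw [Complex.real_smul, pow_succ]
    ring
  · exact hasDerivAt_const _ _

theorem hasDerivAt_assemble_time [Fintype V] (η : ℝ → ℝ) {t : ℝ}
    (h : ∀ R W : ℝ → ℝ, ∀ x y, HasDerivAt (fun t => Φ R W t x y) (Φ' R W t x y) t)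
    (α : E) (x : ℝ) (β : E) (y : ℝ) :
    HasDerivAt (fun t => assemble bc W η Φ 0 t α x β y) (assemble bc W η Φ' 0 t α x β y) t := by
  refine HasDerivAt.fun_sum fun w _ => ?_
  split_ifs with hw
  · refine HasDerivAt.const_mul _ (HasDerivAt.const_mul _ (HasDerivAt.add ?_ ?_))
    · split_ifs
      · exact (h _ _ _ _).ofReal_comp
      · exact hasDerivAt_const _ _
    · exact ((h _ _ _ _).ofReal_comp.const_mul _).const_mul _
  · exact hasDerivAt_const _ _

include hW in
theorem continuousOn_assemble [Fintype V] {η : ℝ → ℝ} (hη : Continuous η)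
    (h : ∀ R W : ℝ → ℝ, ContDiff ℝ ∞ R → ContDiff ℝ ∞ W →
      ContinuousOn (fun p : ℝ × ℝ × ℝ => Φ R W p.1 p.2.1 p.2.2) (Ioi 0 ×ˢ univ)) (j : ℕ)
    (α β : E) :
    ContinuousOn (fun p : ℝ × ℝ × ℝ => assemble bc W η Φ j p.1 α p.2.1 β p.2.2)
      (Ioi 0 ×ˢ univ) := by
  refine continuousOn_finsetSum _ fun w _ => ?_
  by_cases hw : Γ.Incident α w ∧ Γ.Incident β w
  · simp only [dif_pos hw]
    have hcα := continuous_coord (Γ := Γ) w α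
    have hcβ := continuous_coord (Γ := Γ) w β
    have hχ : Continuous fun p : ℝ × ℝ × ℝ => (Γ.chi η w α p.2.1 : ℂ) := by
      unfold chi
      fun_prop
    refine hχ.continuousOn.mul (continuousOn_const.mul (ContinuousOn.add ?_ ?_))
    · split_ifs
      · exact Complex.continuous_ofReal.comp_continuousOn
          ((h _ _ (contDiff_farCutoff _) (hW w _ _).1).comp
            (f := fun p : ℝ × ℝ × ℝ => (p.1, Γ.coord w α p.2.1, Γ.coord w β p.2.2))
            (by fun_prop) fun p hp => ⟨hp.1, mem_univ _⟩)
      · exact continuousOn_const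
    · exact continuousOn_const.mul (continuousOn_const.mul
        (Complex.continuous_ofReal.comp_continuousOn
          ((h _ _ (contDiff_farCutoff_neg _) (hW w _ _).1).comp
            (f := fun p : ℝ × ℝ × ℝ => (p.1, Γ.coord w α p.2.1, -Γ.coord w β p.2.2))
            (by fun_prop) fun p hp => ⟨hp.1, mem_univ _⟩)))
  · simp only [dif_neg hw]
    exact continuousOn_const

end derivatives

section boundary

variable {bc W} {U : E → ℝ → ℝ} (hW : IsExtension Γ U W)

/-- At a vertex `w`, only the contribution of `w` itself is left. -/
theorem assemble_vertex [Fintype V] (η : ℝ → ℝ) {Φ : (ℝ → ℝ) → (ℝ → ℝ) → ℝ → ℝ → ℝ → ℝ}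
    (hΦ : ∀ R W : ℝ → ℝ, ∀ t x y, R y = 0 → deriv R y = 0 → Φ R W t x y = 0) (j : ℕ) (t : ℝ)
    {w : V} (α : E) (x : ℝ) (β : Γ.EdgesAt w) :
    assemble bc W η Φ j t α x β (Γ.coord w β 0) = if h : Γ.Incident α w then
      (Γ.chi η w α x : ℂ) * ((Γ.orient w β : ℂ) ^ j *
        vertexTerm bc W Φ j w ⟨α, h⟩ β t (Γ.coord w α x) 0) else 0 := by
  rw [assemble, Finset.sum_eq_single w]
  · by_cases h : Γ.Incident α w
    · rw [dif_pos h, dif_pos ⟨h, β.2⟩, coord_coord]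
    · rw [dif_neg h, dif_neg fun h' => h h'.1]
  · intro w' _ hw'
    split_ifs with h
    · have hl := Γ.len_pos β
      have h1 := deriv_farCutoff_eq_zero (y := Γ.len β) hl (Or.inr (by linarith))
      have h2 : farCutoff (Γ.len β) (Γ.len β) = 0 := farCutoff_eq_zero hl (by linarith)
      have h3 : Γ.coord w' β (Γ.coord w β 0) = Γ.len β := by
        rw [coord_of_ne β.2 h.2 hw'.symm, coord_coord, sub_zero]
      have h4 : vertexTerm bc W Φ j w' ⟨α, h.1⟩ ⟨β, h.2⟩ t (Γ.coord w' α x) (Γ.len β) = 0 := by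
        rw [vertexTerm, hΦ _ _ _ _ _ h2 h1.1.1, hΦ _ _ _ _ _ (by rwa [neg_neg]) h1.2.1]
        simp
      rw [h3, h4, mul_zero, mul_zero]
    · rfl
  · exact fun h => absurd (Finset.mem_univ w) h

theorem sigma_mulVec_one_add_sigma (w : V) (c : ℂ) (α : Γ.EdgesAt w) {s : ℂ} (hs : s * s = 1) :
    (bc.sigma w *ᵥ fun β => starRingEnd ℂ (c * ((if α = β then 1 else 0) + s * bc.sigma w α β))) =
      starRingEnd ℂ s • fun β => starRingEnd ℂ (c * ((if α = β then 1 else 0) +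
        s * bc.sigma w α β)) := by
  have hσ (β : Γ.EdgesAt w) : starRingEnd ℂ (bc.sigma w α β) = bc.sigma w β α := by
    conv_rhs => rw [← bc.sigma_conjTranspose w]
    rfl
  have hF : (fun β => starRingEnd ℂ (c * ((if α = β then 1 else 0) + s * bc.sigma w α β))) =
      starRingEnd ℂ c • (((1 : Matrix _ _ ℂ) + starRingEnd ℂ s • bc.sigma w) *ᵥ
        Pi.single α 1) := by
    ext β
    have h1 : starRingEnd ℂ (if α = β then (1 : ℂ) else 0) = (1 : Matrix _ _ ℂ) β α := by
      rw [Matrix.one_apply]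
      by_cases h : α = β <;> simp [h, eq_comm]
    rw [map_mul, map_add, map_mul, hσ, h1]
    simp [Matrix.mulVec_single]
  have hs' : starRingEnd ℂ s * starRingEnd ℂ s = 1 := by rw [← map_mul, hs, map_one]
  rw [hF, Matrix.mulVec_smul, Matrix.mulVec_mulVec, mul_add, Matrix.mul_smul,
    bc.sigma_mul_sigma, mul_one, smul_comm, ← Matrix.smul_mulVec (starRingEnd ℂ s), smul_add,
    smul_smul, hs', one_smul, add_comm]

include hW in
theorem assemble_boundary [Fintype V] (η : ℝ → ℝ) (k : ℕ) (t : ℝ) {α : E} {x : ℝ}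
    (hx : x ∈ Ioo 0 (Γ.len α)) (w : V) :
    (bc.sigma w *ᵥ (fun β : Γ.EdgesAt w => starRingEnd ℂ
      (assemble bc W η (cutParametrix k) 0 t α x β (Γ.coord w β 0))) =
      fun β : Γ.EdgesAt w => starRingEnd ℂ
        (assemble bc W η (cutParametrix k) 0 t α x β (Γ.coord w β 0))) ∧
    bc.sigma w *ᵥ (fun β : Γ.EdgesAt w => (Γ.orient w β : ℂ) * starRingEnd ℂ
      (assemble bc W η (cutParametrixY k) 1 t α x β (Γ.coord w β 0))) =
      -fun β : Γ.EdgesAt w => (Γ.orient w β : ℂ) * starRingEnd ℂ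
        (assemble bc W η (cutParametrixY k) 1 t α x β (Γ.coord w β 0)) := by
  have hR (β : E) : farCutoff (Γ.len β) 0 = 1 :=
    farCutoff_eq_one (Γ.len_pos β) (by linarith [Γ.len_pos β])
  have hR' (β : E) := deriv_farCutoff_eq_zero (y := 0) (Γ.len_pos β)
    (Or.inl (by linarith [Γ.len_pos β]))
  rw [neg_zero] at hR'
  simp only [assemble_vertex η (Φ := cutParametrix k) fun R W t x y h _ => by
    rw [cutParametrix, h, zero_mul]]
  simp only [assemble_vertex η (Φ := cutParametrixY k) fun R W t x y h h' => by
    rw [cutParametrixY, h, h', zero_mul, zero_mul, add_zero]]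
  by_cases h : Γ.Incident α w
  · simp only [dif_pos h]
    have hx' := coord_mem_Ioo (w := w) hx
    set α' : Γ.EdgesAt w := ⟨α, h⟩
    constructor
    · have h1 (β : Γ.EdgesAt w) : (Γ.chi η w α x : ℂ) * ((Γ.orient w β : ℂ) ^ 0 *
          vertexTerm bc W (cutParametrix k) 0 w α' β t (Γ.coord w α x) 0) =
          ((Γ.chi η w α x : ℂ) * (lineParametrix (W w α' α') k t (Γ.coord w α x) 0 : ℂ)) *
            ((if α' = β then 1 else 0) + 1 * bc.sigma w α' β) := by
        rw [vertexTerm]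
        simp only [cutParametrix, neg_zero, hR, (hW.lineParametrix_zero α' β k hx').1]
        split_ifs <;> simp <;> ring
      simp only [h1]
      rw [sigma_mulVec_one_add_sigma w _ α' (one_mul 1), map_one, one_smul]
    · have h1 (β : Γ.EdgesAt w) : (Γ.orient w β : ℂ) * starRingEnd ℂ ((Γ.chi η w α x : ℂ) *
          ((Γ.orient w β : ℂ) ^ 1 *
          vertexTerm bc W (cutParametrixY k) 1 w α' β t (Γ.coord w α x) 0)) =
          starRingEnd ℂ
          (((Γ.chi η w α x : ℂ) * (lineParametrixY (W w α' α') k t (Γ.coord w α x) 0 : ℂ)) *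
            ((if α' = β then 1 else 0) + (-1) * bc.sigma w α' β)) := by
        have ho : (Γ.orient w β : ℂ) * (Γ.orient w β : ℂ) = 1 := by
          exact_mod_cast orient_mul_orient w (β : E)
        rw [show (Γ.orient w β : ℂ) = starRingEnd ℂ (Γ.orient w β : ℂ) by
          rw [Complex.conj_ofReal], ← map_mul, Complex.conj_ofReal]
        congr 1
        rw [vertexTerm]
        simp only [cutParametrixY, neg_zero, hR, (hR' β).1.1, (hR' β).2.1,
          (hW.lineParametrix_zero α' β k hx').2, pow_one]
        rw [show ∀ a b c : ℂ, a * (b * (a * c)) = (a * a) * (b * c) from fun a b c => by ring, ho]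
        split_ifs <;> simp <;> ring
      simp only [h1]
      rw [sigma_mulVec_one_add_sigma w _ α' (by norm_num), map_neg, map_one, neg_one_smul]
  · simp only [dif_neg h, map_zero, mul_zero]
    constructor
    · exact Matrix.mulVec_zero _
    · rw [show (fun _ : Γ.EdgesAt w => (0 : ℂ)) = 0 from rfl, Matrix.mulVec_zero, neg_zero]

include hW in
theorem heatFlow_assemble [Fintype V] {η : ℝ → ℝ} (hη : Continuous η) (k : ℕ) {α : E} {x : ℝ}
    (hx : x ∈ Ioo 0 (Γ.len α)) :
    HeatFlow bc (fun t => assemble bc W η (cutParametrix k) 0 t α x)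
      (fun t => assemble bc W η (cutParametrixT k) 0 t α x)
      (fun t => assemble bc W η (cutParametrixY k) 1 t α x)
      (fun t => assemble bc W η (cutParametrixYY k) 2 t α x) := by
  have hslice {g : ℝ × ℝ × ℝ → ℂ} (hg : ContinuousOn g (Ioi 0 ×ˢ univ)) (β : E) :
      ContinuousOn (fun p : ℝ × ℝ => g (p.1, x, p.2)) (Ioi 0 ×ˢ Icc 0 (Γ.len β)) :=
    hg.comp (f := fun p : ℝ × ℝ => (p.1, x, p.2)) (by fun_prop) fun p hp => ⟨hp.1, mem_univ _⟩
  exact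
  { cont := fun β => hslice (continuousOn_assemble hW hη
      (fun R W hR hW => continuousOn_cutParametrix hR hW k) 0 α β) β
    cont_time := fun β => hslice (continuousOn_assemble hW hη
      (fun R W hR hW => continuousOn_cutParametrixT hR hW k) 0 α β) β
    cont_space := fun β => hslice (continuousOn_assemble hW hη
      (fun R W hR hW => continuousOn_cutParametrixYY hR hW k) 2 α β) β
    time := fun t ht β y _ => hasDerivAt_assemble_time η
      (fun R W x y => hasDerivAt_cutParametrix_time R W k ht x y) α x β y
    space := fun t _ β y _ => (hasDerivAt_assemble hW η
      (fun R W hR hW x y => hasDerivAt_cutParametrix hR hW k t x y) 0 α x β y).hasDerivWithinAt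
    space₂ := fun t ht β y _ => (hasDerivAt_assemble hW η
      (fun R W hR hW x y => hasDerivAt_cutParametrixY hR hW k ht x y) 1 α x β y).hasDerivWithinAt
    value := fun t _ w => (assemble_boundary hW η k t hx w).1
    flux := fun t _ w => (assemble_boundary hW η k t hx w).2 }

end boundary

end MetricGraph

namespace MetricGraph

variable {V : Type u} {E : Type v} {Γ : MetricGraph V E} [DecidableEq V]

/-! ### Estimates for the parametrix on the graph -/

theorem integral_comp_coord {R : Type*} [NormedAddCommGroup R] [NormedSpace ℝ R] (f : ℝ → R)
    (w : V) (α : E) :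
    ∫ x in (0 : ℝ)..Γ.len α, f (Γ.coord w α x) = ∫ x in (0 : ℝ)..Γ.len α, f x := by
  unfold coord
  split_ifs
  · rfl
  · rw [intervalIntegral.integral_comp_sub_left]
    simp

theorem continuous_chi {η : ℝ → ℝ} (hη : Continuous η) (w : V) (α : E) :
    Continuous (Γ.chi η w α) := by
  have := continuous_coord (Γ := Γ) w α
  unfold chi
  fun_prop

theorem chi_eq_zero {η : ℝ → ℝ} (hη : IsCutoff η) {w : V} {α : E} {x : ℝ}
    (hx : 2 / 3 * Γ.len α ≤ Γ.coord w α x) : Γ.chi η w α x = 0 := by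
  refine hη.eq_zero _ ?_
  rw [inv_mul_eq_div, le_div_iff₀ (Γ.len_pos α)]
  exact hx

theorem abs_chi_le_one {η : ℝ → ℝ} (hη : IsCutoff η) (w : V) (α : E) (x : ℝ) :
    |Γ.chi η w α x| ≤ 1 := by
  have := hη.mem_Icc ((Γ.len α)⁻¹ * Γ.coord w α x)
  rw [chi, abs_of_nonneg this.1]
  exact this.2

theorem chi_src_add_chi_tgt {η : ℝ → ℝ} (hη : IsCutoff η) (α : E) (x : ℝ) :
    Γ.chi η (Γ.src α) α x + Γ.chi η (Γ.tgt α) α x = 1 := by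
  have hl := (Γ.len_pos α).ne'
  have : (Γ.len α)⁻¹ * (Γ.len α - x) = 1 - (Γ.len α)⁻¹ * x := by field_simp
  simp only [chi, coord, if_true, Γ.no_loops α, if_false]
  rw [this, hη.symmetric]
  ring

variable [Fintype E] [DecidableEq E] {bc : Γ.BoundaryConditions}
  {W : ∀ w : V, Γ.EdgesAt w → Γ.EdgesAt w → ℝ → ℝ} {U : E → ℝ → ℝ}

theorem exists_uniform_bound {ι : Type*} [Finite ι] {P : ι → ℝ → Prop}
    (hP : ∀ i C C', C ≤ C' → P i C → P i C') (h : ∀ i, ∃ C, P i C) :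
    ∃ C, 0 ≤ C ∧ ∀ i, P i C := by
  choose C hC using h
  obtain ⟨M, hM⟩ := Finite.bddAbove_range C
  exact ⟨|M|, abs_nonneg M, fun i =>
    hP i _ _ ((hM (mem_range_self i)).trans (le_abs_self M)) (hC i)⟩

omit [Fintype E] [DecidableEq E] in
/-- A sum over the vertices adjacent to two edges is bounded if its terms are, uniformly in the
support of `χ`. -/
theorem norm_sum_chi_le [Fintype V] {η : ℝ → ℝ} (hη : IsCutoff η) {α β : E} {x B : ℝ}
    (hx : x ∈ Icc 0 (Γ.len α)) (hB : 0 ≤ B)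
    {T : ∀ w : V, Γ.Incident α w ∧ Γ.Incident β w → ℂ}
    (hT : ∀ w h, Γ.coord w α x ∈ Ico 0 (2 / 3 * Γ.len α) → ‖T w h‖ ≤ B) :
    ‖∑ w : V, if h : Γ.Incident α w ∧ Γ.Incident β w then (Γ.chi η w α x : ℂ) * T w h else 0‖ ≤
      Fintype.card V * B := by
  refine (norm_sum_le _ _).trans ?_
  rw [← nsmul_eq_mul, ← Finset.card_univ, ← Finset.sum_const]
  refine Finset.sum_le_sum fun w _ => ?_
  split_ifs with h
  · rw [norm_mul, Complex.norm_real, Real.norm_eq_abs]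
    rcases lt_or_ge (Γ.coord w α x) (2 / 3 * Γ.len α) with hlt | hge
    · exact (mul_le_mul (abs_chi_le_one hη w α x) (hT w h ⟨(coord_mem_Icc hx).1, hlt⟩)
        (norm_nonneg _) zero_le_one).trans (one_mul B).le
    · rw [chi_eq_zero hη hge, abs_zero, zero_mul]
      exact hB
  · simpa using hB

theorem norm_vertexTerm_le {Φ : (ℝ → ℝ) → (ℝ → ℝ) → ℝ → ℝ → ℝ → ℝ} {w : V} {α β : Γ.EdgesAt w}
    {t x y B B' : ℝ} (hB : 0 ≤ B)
    (h : α = β → |Φ (farCutoff (Γ.len β)) (W w α α) t x y| ≤ B)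
    (h' : |Φ (fun y => farCutoff (Γ.len β) (-y)) (W w α β) t x (-y)| ≤ B') :
    ‖vertexTerm bc W Φ 0 w α β t x y‖ ≤ B + ‖bc.sigma w α β‖ * B' := by
  refine (norm_add_le _ _).trans (add_le_add ?_ ?_)
  · split_ifs with hab
    · rw [Complex.norm_real]
      exact h hab
    · simpa using hB
  · rw [pow_zero, one_mul, norm_mul, Complex.norm_real]
    exact mul_le_mul_of_nonneg_left h' (norm_nonneg _)

theorem exists_vertexTerm_cutDefect_le (hW : IsExtension Γ U W) (k : ℕ) (w : V)
    (α β : Γ.EdgesAt w) : ∃ C, ∀ t ∈ Ioc (0 : ℝ) 1, ∀ x ∈ Ico 0 (2 / 3 * Γ.len α),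
      ∀ y ∈ Icc 0 (Γ.len β),
      ‖vertexTerm bc W (cutDefect k) 0 w α β t x y‖ ≤ C * t ^ ((k : ℝ) - 1 / 2) := by
  have la := Γ.len_pos α
  have lb := Γ.len_pos β
  have hX : Ico 0 (2 / 3 * Γ.len α) ⊆
      Icc (-(Γ.len α + Γ.len β)) (Γ.len α + Γ.len β) :=
    fun x hx => ⟨by linarith [hx.1], by linarith [hx.2]⟩
  obtain ⟨C₁, hC₁, h₁⟩ := exists_cutDefect_le (contDiff_farCutoff_neg (Γ.len β)) (hW w α β).1 k
    (δ := 7 / 10 * Γ.len β) (by positivity) (X := Ico 0 (2 / 3 * Γ.len α))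
    (Y := Icc (-Γ.len β) 0) hX
    (fun y hy => ⟨by linarith [hy.1], by linarith [hy.2]⟩) fun x hx y hy hxy => by
      have := (deriv_farCutoff_eq_zero (y := -y) lb
        (Or.inl (by linarith [(abs_lt.1 hxy).2, hx.1]))).2
      rwa [neg_neg] at this
  obtain ⟨C₂, hC₂, h₂⟩ : ∃ C, 0 ≤ C ∧ (α = β → ∀ t ∈ Ioc (0 : ℝ) 1,
      ∀ x ∈ Ico 0 (2 / 3 * Γ.len α), ∀ y ∈ Icc 0 (Γ.len β),
      |cutDefect k (farCutoff (Γ.len β)) (W w α α) t x y| ≤ C * t ^ ((k : ℝ) - 1 / 2)) := by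
    by_cases hab : α = β
    · subst hab
      obtain ⟨C, hC, h⟩ := exists_cutDefect_le (contDiff_farCutoff (Γ.len α)) (hW w α α).1 k
        (δ := 1 / 30 * Γ.len α) (by positivity) (X := Ico 0 (2 / 3 * Γ.len α))
        (Y := Icc 0 (Γ.len α)) hX
        (fun y hy => ⟨by linarith [hy.1], by linarith [hy.2]⟩) fun x hx y hy hxy =>
          (deriv_farCutoff_eq_zero lb (Or.inl (by linarith [(abs_lt.1 hxy).1, hx.2]))).1
      exact ⟨C, hC, fun _ => h⟩
    · exact ⟨0, le_rfl, fun h => absurd h hab⟩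
  refine ⟨C₂ + ‖bc.sigma w α β‖ * C₁, fun t ht x hx y hy => ?_⟩
  have hp := Real.rpow_nonneg ht.1.le ((k : ℝ) - 1 / 2)
  refine (norm_vertexTerm_le (B := C₂ * t ^ ((k : ℝ) - 1 / 2)) (by positivity)
    (fun hab => h₂ hab t ht x hx y hy)
    (h₁ t ht x hx (-y) ⟨neg_le_neg hy.2, neg_nonpos.2 hy.1⟩)).trans (le_of_eq ?_)
  ring

theorem exists_vertexTerm_le (hW : IsExtension Γ U W) (k : ℕ) (w : V) (α β : Γ.EdgesAt w) :
    ∃ C, ∀ t ∈ Ioc (0 : ℝ) 1, ∀ x ∈ Icc 0 (Γ.len α), ∀ y ∈ Icc 0 (Γ.len β),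
      ‖vertexTerm bc W (cutParametrix k) 0 w α β t x y‖ ≤
        C * (gaussKernel t x y + gaussKernel t x (-y)) := by
  have la := Γ.len_pos α
  have lb := Γ.len_pos β
  obtain ⟨C₁, hC₁, h₁⟩ := exists_lineParametrix_le (hW w α α).1 k (Γ.len α + Γ.len β)
  obtain ⟨C₂, hC₂, h₂⟩ := exists_lineParametrix_le (hW w α β).1 k (Γ.len α + Γ.len β)
  refine ⟨C₁ + ‖bc.sigma w α β‖ * C₂, fun t ht x hx y hy => ?_⟩
  have hx' : x ∈ Icc (-(Γ.len α + Γ.len β)) (Γ.len α + Γ.len β) :=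
    ⟨by linarith [hx.1], by linarith [hx.2]⟩
  have hy' : y ∈ Icc (-(Γ.len α + Γ.len β)) (Γ.len α + Γ.len β) :=
    ⟨by linarith [hy.1], by linarith [hy.2]⟩
  have hy'' : -y ∈ Icc (-(Γ.len α + Γ.len β)) (Γ.len α + Γ.len β) :=
    ⟨by linarith [hy.2], by linarith [hy.1]⟩
  have hcut (R W' : ℝ → ℝ) (z : ℝ) (hR : R z ∈ Icc (0 : ℝ) 1) :
      |cutParametrix k R W' t x z| ≤ |lineParametrix W' k t x z| := by
    rw [cutParametrix, abs_mul, abs_of_nonneg hR.1]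
    exact mul_le_of_le_one_left (abs_nonneg _) hR.2
  have g1 := gaussKernel_nonneg t x y
  have g2 := gaussKernel_nonneg t x (-y)
  refine (norm_vertexTerm_le (B := C₁ * gaussKernel t x y) (by positivity)
    (B' := C₂ * gaussKernel t x (-y))
    (fun _ => (hcut (farCutoff (Γ.len β)) _ y (farCutoff_mem_Icc _ _)).trans (h₁ t ht x hx' y hy'))
    ((hcut (fun y => farCutoff (Γ.len β) (-y)) _ (-y) (farCutoff_mem_Icc _ _)).trans
      (h₂ t ht x hx' (-y) hy''))).trans ?_
  have h3 := mul_nonneg (mul_nonneg (norm_nonneg (bc.sigma w α β)) hC₂) g1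
  have h4 := mul_nonneg hC₁ g2
  linarith

theorem tendsto_integral_vertexTerm (hW : IsExtension Γ U W) (k : ℕ) (w : V) (α β : Γ.EdgesAt w)
    {x : ℝ} (hx : x ∈ Ioo 0 (Γ.len α)) {φ : ℝ → ℂ} (hφ : ContinuousOn φ (Icc 0 (Γ.len β))) :
    Tendsto (fun t => ∫ y in (0 : ℝ)..Γ.len β,
      vertexTerm bc W (cutParametrix k) 0 w α β t x y * φ y) (𝓝[>] 0)
      (𝓝 (if α = β then (farCutoff (Γ.len β) x : ℂ) * φ x else 0)) := by
  have lb := Γ.len_pos β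
  have hc1 (t : ℝ) : Continuous (lineParametrix (W w α α) k t x) :=
    continuous_iff_continuousAt.2 fun y =>
      (hasDerivAt_lineParametrix (hW w α α).1 k t x y).continuousAt
  have hc2 (t : ℝ) :
      Continuous (cutParametrix k (fun y => farCutoff (Γ.len β) (-y)) (W w α β) t x) :=
    continuous_iff_continuousAt.2 fun y =>
      (hasDerivAt_cutParametrix (contDiff_farCutoff_neg _) (hW w α β).1 k t x y).continuousAt
  have hR := (contDiff_farCutoff (Γ.len β)).continuous
  -- the direct part
  have h1 : Tendsto (fun t => ∫ y in (0 : ℝ)..Γ.len β,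
      (if α = β then (cutParametrix k (farCutoff (Γ.len β)) (W w α α) t x y : ℂ) else 0) * φ y)
      (𝓝[>] 0) (𝓝 (if α = β then (farCutoff (Γ.len β) x : ℂ) * φ x else 0)) := by
    by_cases hab : α = β
    · subst hab
      simp only [if_true]
      have := tendsto_integral_lineParametrix (hW w α α).1 k hx
        (φ := fun y => (farCutoff (Γ.len α) y : ℂ) * φ y)
        ((Complex.continuous_ofReal.comp hR).continuousOn.mul hφ)
      refine this.congr fun t => ?_
      congr 1
      ext y
      simp only [cutParametrix]
      push_cast
      ring
    · simp [hab]
  -- the reflected part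
  have h2 : Tendsto (fun t => ∫ y in (0 : ℝ)..Γ.len β, bc.sigma w α β *
      (cutParametrix k (fun y => farCutoff (Γ.len β) (-y)) (W w α β) t x (-y) : ℂ) * φ y)
      (𝓝[>] 0) (𝓝 0) := by
    obtain ⟨C₂, hC₂, h₂⟩ := exists_lineParametrix_le (hW w α β).1 k (Γ.len α + Γ.len β)
    obtain ⟨C₃, hC₃, h₃⟩ := exists_gaussKernel_le_pow hx.1 1
    obtain ⟨B, hB⟩ := isCompact_Icc.exists_bound_of_continuousOn hφ
    refine squeeze_zero_norm' (a := fun t => ‖bc.sigma w α β‖ * (C₂ * (C₃ * t ^ 1)) * |B| *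
      |Γ.len β - 0|) ?_ ?_
    · filter_upwards [Ioc_mem_nhdsGT (zero_lt_one (α := ℝ))] with t ht
      refine intervalIntegral.norm_integral_le_of_norm_le_const fun y hy => ?_
      rw [uIoc_of_le lb.le] at hy
      have hy' := Ioc_subset_Icc_self hy
      rw [norm_mul, norm_mul, Complex.norm_real, Real.norm_eq_abs]
      refine mul_le_mul (mul_le_mul_of_nonneg_left ?_ (norm_nonneg _))
        ((hB y hy').trans (le_abs_self B)) (norm_nonneg _)
        (by have := ht.1; positivity)
      rw [cutParametrix, neg_neg, abs_mul, abs_of_nonneg (farCutoff_mem_Icc _ _).1]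
      refine (mul_le_of_le_one_left (abs_nonneg _) (farCutoff_mem_Icc _ _).2).trans
        ((h₂ t ht x ⟨?_, ?_⟩ (-y) ⟨?_, ?_⟩).trans (mul_le_mul_of_nonneg_left
          (h₃ t ht x (-y) ?_) hC₂))
      · linarith [hx.1, Γ.len_pos α]
      · linarith [hx.2]
      · linarith [hy.2, Γ.len_pos α]
      · linarith [hy.1, Γ.len_pos α]
      · rw [sub_neg_eq_add, abs_of_nonneg (by linarith [hx.1, hy.1])]
        linarith [hy.1]
    · have : Tendsto (fun t : ℝ => ‖bc.sigma w α β‖ * (C₂ * (C₃ * t ^ 1)) * |B| *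
          |Γ.len β - 0|) (𝓝 0) (𝓝 (‖bc.sigma w α β‖ * (C₂ * (C₃ * 0 ^ 1)) * |B| *
          |Γ.len β - 0|)) := Continuous.tendsto (by fun_prop) 0
      simp only [pow_one, mul_zero, zero_mul] at this
      simpa only [pow_one] using this.mono_left nhdsWithin_le_nhds
  have := h1.add h2
  rw [add_zero] at this
  refine this.congr fun t => ?_
  have hi1 : IntervalIntegrable (fun y => (if α = β then
      (cutParametrix k (farCutoff (Γ.len β)) (W w α α) t x y : ℂ) else 0) * φ y) volume 0
      (Γ.len β) := by
    refine ContinuousOn.intervalIntegrable_of_Icc lb.le (ContinuousOn.mul ?_ hφ)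
    split_ifs
    · exact (Complex.continuous_ofReal.comp (hR.mul (hc1 t))).continuousOn
    · exact continuousOn_const
  have hi2 : IntervalIntegrable (fun y => bc.sigma w α β *
      (cutParametrix k (fun y => farCutoff (Γ.len β) (-y)) (W w α β) t x (-y) : ℂ) * φ y) volume 0
      (Γ.len β) :=
    ContinuousOn.intervalIntegrable_of_Icc lb.le (((continuous_const.mul
      (Complex.continuous_ofReal.comp ((hc2 t).comp continuous_neg))).continuousOn).mul hφ)
  rw [← intervalIntegral.integral_add hi1 hi2]
  congr 1
  ext y
  rw [vertexTerm, pow_zero, one_mul, add_mul]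

theorem tendsToDirac_assemble [Fintype V] (hW : IsExtension Γ U W) {η : ℝ → ℝ} (hη : IsCutoff η)
    (k : ℕ) {α : E} {x : ℝ} (hx : x ∈ Ioo 0 (Γ.len α)) :
    TendsToDirac Γ (fun t => assemble bc W η (cutParametrix k) 0 t α x) α x := by
  intro ψ hψ
  set φ : V → E → ℝ → ℂ := fun w β y => ψ β (Γ.coord w β y)
  have hφ (w : V) (β : E) : ContinuousOn (φ w β) (Icc 0 (Γ.len β)) :=
    (hψ β).comp (continuous_coord w β).continuousOn fun y hy => coord_mem_Icc hy
  have hVc (t : ℝ) (w : V) (α' β : Γ.EdgesAt w) (x : ℝ) :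
      Continuous (vertexTerm bc W (cutParametrix k) 0 w α' β t x) :=
    continuous_iff_continuousAt.2 fun y => (hasDerivAt_vertexTerm (bc := bc) hW
      (fun R W hR hW y => hasDerivAt_cutParametrix hR hW k t x y) 0 w α' β y).continuousAt
  have hlim (w : V) (β : E) : Tendsto (fun t => ∫ y in (0 : ℝ)..Γ.len β,
      (if h : Γ.Incident α w ∧ Γ.Incident β w then
        (Γ.chi η w α x : ℂ) * ((Γ.orient w β : ℂ) ^ 0 *
          vertexTerm bc W (cutParametrix k) 0 w ⟨α, h.1⟩ ⟨β, h.2⟩ t (Γ.coord w α x)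
            (Γ.coord w β y)) else 0) * ψ β y) (𝓝[>] 0)
      (𝓝 (if Γ.Incident α w ∧ α = β then (Γ.chi η w α x : ℂ) * ψ α x else 0)) := by
    by_cases h : Γ.Incident α w ∧ Γ.Incident β w
    · have h1 := (tendsto_integral_vertexTerm (bc := bc) hW k w ⟨α, h.1⟩ ⟨β, h.2⟩
        (coord_mem_Ioo (w := w) hx) (hφ w β)).const_mul (Γ.chi η w α x : ℂ)
      have h2 : (Γ.chi η w α x : ℂ) * (if (⟨α, h.1⟩ : Γ.EdgesAt w) = ⟨β, h.2⟩ then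
          (farCutoff (Γ.len β) (Γ.coord w α x) : ℂ) * φ w β (Γ.coord w α x) else 0) =
          if Γ.Incident α w ∧ α = β then (Γ.chi η w α x : ℂ) * ψ α x else 0 := by
        by_cases hab : α = β
        · subst hab
          simp only [if_true, h.1, true_and, φ, coord_coord]
          rcases lt_or_ge (Γ.coord w α x) (2 / 3 * Γ.len α) with hlt | hge
          · rw [farCutoff_eq_one (Γ.len_pos α) (by linarith [Γ.len_pos α]), Complex.ofReal_one,
              one_mul]
          · rw [chi_eq_zero hη hge]
            simp
        · simp [hab]
      rw [h2] at h1
      refine h1.congr fun t => ?_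
      rw [← intervalIntegral.integral_const_mul, ← integral_comp_coord _ w β]
      refine intervalIntegral.integral_congr fun y _ => ?_
      simp only [dif_pos h, φ, coord_coord, pow_zero, one_mul, mul_assoc]
    · have h' : ¬ (Γ.Incident α w ∧ α = β) := fun h' => h ⟨h'.1, h'.2 ▸ h'.1⟩
      simp [dif_neg h, if_neg h']
  have hsum := tendsto_finsetSum Finset.univ fun β _ =>
    tendsto_finsetSum Finset.univ fun w _ => hlim w β
  have hval : ∑ β : E, ∑ w : V,
      (if Γ.Incident α w ∧ α = β then (Γ.chi η w α x : ℂ) * ψ α x else 0) = ψ α x := by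
    have h1 := sum_edgesAt (Γ := Γ) fun w β => if α = β then (Γ.chi η w α x : ℂ) * ψ α x else 0
    have h2 (w : V) : ∑ β : E, (if Γ.Incident α w ∧ α = β then (Γ.chi η w α x : ℂ) * ψ α x
        else 0) = ∑ β : Γ.EdgesAt w, if α = β then (Γ.chi η w α x : ℂ) * ψ α x else 0 := by
      have h3 : ∑ β : Γ.EdgesAt w, (if α = β then (Γ.chi η w α x : ℂ) * ψ α x else 0) =
          ∑ β : E, if Γ.Incident β w then
            (if α = β then (Γ.chi η w α x : ℂ) * ψ α x else 0) else 0 := by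
        refine (Finset.sum_subtype (Finset.univ.filter fun β : E => Γ.Incident β w) (by simp)
          fun β => if α = β then (Γ.chi η w α x : ℂ) * ψ α x else 0).symm.trans ?_
        exact Finset.sum_filter _ _
      rw [h3]
      refine Finset.sum_congr rfl fun β _ => ?_
      by_cases hab : α = β
      · subst hab
        simp
      · simp [hab]
    refine Finset.sum_comm.trans ((Finset.sum_congr rfl fun w _ => h2 w).trans (h1.trans ?_))
    rw [Finset.sum_eq_single α (fun β _ hb => by simp [hb.symm]) (fun h => by simp at h)]
    simp only [if_true]
    rw [← add_mul, ← Complex.ofReal_add, chi_src_add_chi_tgt hη, Complex.ofReal_one, one_mul]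
  rw [hval] at hsum
  refine hsum.congr fun t => Finset.sum_congr rfl fun β _ => ?_
  rw [← intervalIntegral.integral_finsetSum]
  · refine intervalIntegral.integral_congr fun y _ => ?_
    simp only [assemble, Finset.sum_mul]
  · intro w _
    refine ContinuousOn.intervalIntegrable_of_Icc (Γ.len_pos β).le (ContinuousOn.mul ?_ (hψ β))
    by_cases h : Γ.Incident α w ∧ Γ.Incident β w
    · simp only [dif_pos h]
      exact (continuous_const.mul (continuous_const.mul
        ((hVc t w _ _ _).comp (continuous_coord w β)))).continuousOn
    · simp only [dif_neg h]
      exact continuousOn_const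

theorem assemble_defect [Fintype V] (hU : Γ.IsSmoothPotential U) (hW : IsExtension Γ U W)
    (η : ℝ → ℝ) (k : ℕ) (t : ℝ) (α : E) (x : ℝ) (β : E) {y : ℝ} (hy : y ∈ Icc 0 (Γ.len β)) :
    assemble bc W η (cutParametrixT k) 0 t α x β y -
      assemble bc W η (cutParametrixYY k) 2 t α x β y -
      (U β y : ℂ) * assemble bc W η (cutParametrix k) 0 t α x β y =
    assemble bc W η (cutDefect k) 0 t α x β y := by
  simp only [assemble, Finset.mul_sum, ← Finset.sum_sub_distrib]
  refine Finset.sum_congr rfl fun w _ => ?_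
  split_ifs with h
  · have ho : (Γ.orient w β : ℂ) ^ 2 = 1 := by
      rw [sq]
      exact_mod_cast orient_mul_orient w β
    have hy' := coord_mem_Icc (w := w) hy
    have h1 : W w ⟨α, h.1⟩ ⟨β, h.2⟩ (-Γ.coord w β y) = U β y := by
      rw [hW.eq_of_nonpos hU ⟨α, h.1⟩ ⟨β, h.2⟩ hy', atVertex, coord_coord]
    have h2 : vertexTerm bc W (cutDefect k) 0 w ⟨α, h.1⟩ ⟨β, h.2⟩ t (Γ.coord w α x)
        (Γ.coord w β y) =
        vertexTerm bc W (cutParametrixT k) 0 w ⟨α, h.1⟩ ⟨β, h.2⟩ t (Γ.coord w α x)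
          (Γ.coord w β y) -
        vertexTerm bc W (cutParametrixYY k) 2 w ⟨α, h.1⟩ ⟨β, h.2⟩ t (Γ.coord w α x)
          (Γ.coord w β y) -
        (U β y : ℂ) * vertexTerm bc W (cutParametrix k) 0 w ⟨α, h.1⟩ ⟨β, h.2⟩ t (Γ.coord w α x)
          (Γ.coord w β y) := by
      simp only [vertexTerm, cutDefect, h1]
      by_cases hab : α = β
      · subst hab
        have h3 : W w ⟨α, h.1⟩ ⟨α, h.1⟩ (Γ.coord w α y) = U α y := by
          rw [hW.eq_of_nonneg ⟨α, h.1⟩ ⟨α, h.1⟩ hy', atVertex, coord_coord]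
        simp only [h3, if_true]
        push_cast
        ring
      · have hab' : ¬ (⟨α, h.1⟩ : Γ.EdgesAt w) = ⟨β, h.2⟩ := fun h' => hab (congrArg Subtype.val h')
        simp only [hab', if_false]
        push_cast
        ring
    rw [h2, ho]
    ring
  · ring

theorem isParametrix_assemble [Fintype V] (hU : Γ.IsSmoothPotential U) (hW : IsExtension Γ U W)
    {η : ℝ → ℝ} (hη : IsCutoff η) (k : ℕ) :
    IsParametrix bc U k (assemble bc W η (cutParametrix k) 0) (assemble bc W η (cutParametrixT k) 0)
      (assemble bc W η (cutParametrixY k) 1) (assemble bc W η (cutParametrixYY k) 2) where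
  flow := fun α x hx => heatFlow_assemble hW hη.smooth.continuous k hx
  dirac := fun α x hx => tendsToDirac_assemble hW hη k hx
  cont := fun t ht α β => (continuousOn_assemble hW hη.smooth.continuous
      (fun R W hR hW => continuousOn_cutParametrix hR hW k) 0 α β).comp
      (f := fun q : ℝ × ℝ => (t, q.1, q.2)) (by fun_prop) fun q _ => ⟨ht, mem_univ _⟩
  defect := by
    obtain ⟨C, hC0, hC⟩ := exists_uniform_bound
      (ι := Σ w : V, Γ.EdgesAt w × Γ.EdgesAt w)
      (P := fun i C => ∀ t ∈ Ioc (0 : ℝ) 1, ∀ x ∈ Ico 0 (2 / 3 * Γ.len i.2.1),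
        ∀ y ∈ Icc 0 (Γ.len i.2.2), ‖vertexTerm bc W (cutDefect k) 0 i.1 i.2.1 i.2.2 t x y‖ ≤
          C * t ^ ((k : ℝ) - 1 / 2))
      (fun i C C' hCC h t ht x hx y hy => (h t ht x hx y hy).trans
        (mul_le_mul_of_nonneg_right hCC (Real.rpow_nonneg ht.1.le _)))
      (fun i => exists_vertexTerm_cutDefect_le hW k i.1 i.2.1 i.2.2)
    refine ⟨Fintype.card V * C, fun t ht α x hx β y hy => ?_⟩
    rw [assemble_defect hU hW η k t α x β hy, mul_assoc]
    refine norm_sum_chi_le hη hx (mul_nonneg hC0 (Real.rpow_nonneg ht.1.le _)) fun w h hxw => ?_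
    rw [pow_zero, one_mul]
    exact hC ⟨w, ⟨α, h.1⟩, ⟨β, h.2⟩⟩ t ht _ hxw _ (coord_mem_Icc hy)
  bound := by
    obtain ⟨C, hC0, hC⟩ := exists_uniform_bound
      (ι := Σ w : V, Γ.EdgesAt w × Γ.EdgesAt w)
      (P := fun i C => ∀ t ∈ Ioc (0 : ℝ) 1, ∀ x ∈ Icc 0 (Γ.len i.2.1),
        ∀ y ∈ Icc 0 (Γ.len i.2.2), ‖vertexTerm bc W (cutParametrix k) 0 i.1 i.2.1 i.2.2 t x y‖ ≤
          C * (gaussKernel t x y + gaussKernel t x (-y)))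
      (fun i C C' hCC h t ht x hx y hy => (h t ht x hx y hy).trans
        (mul_le_mul_of_nonneg_right hCC
          (add_nonneg (gaussKernel_nonneg _ _ _) (gaussKernel_nonneg _ _ _))))
      (fun i => exists_vertexTerm_le hW k i.1 i.2.1 i.2.2)
    refine ⟨∑ _α : E, ∑ _w : V, C * 2, fun t ht β y hy => Finset.sum_le_sum fun α _ => ?_⟩
    have hGc (w : V) : Continuous fun x => C * (gaussKernel t (Γ.coord w α x) (Γ.coord w β y) +
        gaussKernel t (Γ.coord w α x) (-Γ.coord w β y)) := by
      have := continuous_coord (Γ := Γ) w α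
      unfold gaussKernel
      fun_prop
    have hpc : ContinuousOn (fun x => assemble bc W η (cutParametrix k) 0 t α x β y)
        (Icc 0 (Γ.len α)) :=
      (continuousOn_assemble hW hη.smooth.continuous
        (fun R W hR hW => continuousOn_cutParametrix hR hW k) 0 α β).comp
        (f := fun x : ℝ => (t, x, y)) (by fun_prop) fun q _ => ⟨ht.1, mem_univ _⟩
    calc ∫ x in (0 : ℝ)..Γ.len α, ‖assemble bc W η (cutParametrix k) 0 t α x β y‖ ≤
          ∫ x in (0 : ℝ)..Γ.len α, ∑ w : V, C * (gaussKernel t (Γ.coord w α x) (Γ.coord w β y) +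
            gaussKernel t (Γ.coord w α x) (-Γ.coord w β y)) := by
          refine intervalIntegral.integral_mono_on (Γ.len_pos α).le
            (ContinuousOn.intervalIntegrable_of_Icc (Γ.len_pos α).le hpc.norm)
            ((continuous_finsetSum _ fun w _ => hGc w).intervalIntegrable _ _) fun x hx => ?_
          refine (norm_sum_le _ _).trans (Finset.sum_le_sum fun w _ => ?_)
          have hpos := mul_nonneg hC0 (add_nonneg
            (gaussKernel_nonneg t (Γ.coord w α x) (Γ.coord w β y))
            (gaussKernel_nonneg t (Γ.coord w α x) (-Γ.coord w β y)))
          split_ifs with h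
          · rw [pow_zero, one_mul, norm_mul, Complex.norm_real]
            exact (mul_le_of_le_one_left (norm_nonneg _) (abs_chi_le_one hη w α x)).trans
              (hC ⟨w, ⟨α, h.1⟩, ⟨β, h.2⟩⟩ t ht _ (coord_mem_Icc hx) _ (coord_mem_Icc hy))
          · simpa using hpos
      _ = ∑ w : V, C * ((∫ x in (0 : ℝ)..Γ.len α, gaussKernel t x (Γ.coord w β y)) +
            ∫ x in (0 : ℝ)..Γ.len α, gaussKernel t x (-Γ.coord w β y)) := by
          rw [intervalIntegral.integral_finsetSum fun w _ => (hGc w).intervalIntegrable _ _]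
          refine Finset.sum_congr rfl fun w _ => ?_
          rw [intervalIntegral.integral_const_mul, integral_comp_coord (fun x =>
            gaussKernel t x (Γ.coord w β y) + gaussKernel t x (-Γ.coord w β y)) w α,
            intervalIntegral.integral_add (integrable_gaussKernel ht.1 _).intervalIntegrable
              (integrable_gaussKernel ht.1 _).intervalIntegrable]
      _ ≤ _ := by
          refine Finset.sum_le_sum fun w _ => mul_le_mul_of_nonneg_left ?_ hC0
          have h1 := intervalIntegral_gaussKernel_le ht.1 (Γ.len_pos α).le (Γ.coord w β y)
          have h2 := intervalIntegral_gaussKernel_le ht.1 (Γ.len_pos α).le (-Γ.coord w β y)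
          linarith

end MetricGraph

namespace MetricGraph

/-! ### Comparison of the two parametrices -/

variable {V : Type u} {E : Type v} {Γ : MetricGraph V E} [Fintype E]

theorem minLen_le (α : E) : Γ.minLen ≤ Γ.len α :=
  ciInf_le (Finite.bddBelow_range Γ.len) α

theorem minLen_pos [Nonempty E] : 0 < Γ.minLen := by
  obtain ⟨α, hα⟩ := exists_eq_ciInf_of_finite (f := Γ.len)
  rw [minLen, ← hα]
  exact Γ.len_pos α

variable [DecidableEq V] [DecidableEq E]

omit [Fintype E] [DecidableEq E] in
theorem distCutoff_mem_Icc {η : ℝ → ℝ} (hη : IsCutoff η) (α : E) (x : ℝ) (β : E) (y : ℝ) :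
    Γ.distCutoff η α x β y ∈ Icc (0 : ℝ) 1 := by
  unfold distCutoff
  split_ifs
  · exact ⟨le_rfl, zero_le_one⟩
  · exact hη.mem_Icc _

omit [DecidableEq E] in
theorem distCutoff_eq_one {η : ℝ → ℝ} (hη : IsCutoff η) {α : E} {x : ℝ} {β : E} {y r : ℝ}
    (hd : Γ.pointDist α x β y ≤ ENNReal.ofReal r) (hr : r ≤ Γ.minLen / 6) :
    Γ.distCutoff η α x β y = 1 := by
  have : Nonempty E := ⟨α⟩
  have hm := Γ.minLen_pos
  rw [distCutoff, if_neg (ne_top_of_le_ne_top ENNReal.ofReal_ne_top hd)]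
  refine hη.eq_one _ ?_
  have h1 : (Γ.pointDist α x β y).toReal ≤ Γ.minLen / 6 :=
    ENNReal.toReal_le_of_le_ofReal (by positivity) (hd.trans (ENNReal.ofReal_le_ofReal hr))
  calc 2 * (Γ.minLen)⁻¹ * (Γ.pointDist α x β y).toReal ≤ 2 * (Γ.minLen)⁻¹ * (Γ.minLen / 6) := by
        gcongr
    _ = 1 / 3 := by field_simp; norm_num

omit [Fintype E] [DecidableEq E] in
theorem pointDist_le_abs (α : E) (x y : ℝ) :
    Γ.pointDist α x α y ≤ ENNReal.ofReal |x - y| :=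
  inf_le_left.trans (by simp)

omit [Fintype E] [DecidableEq E] in
theorem pointDist_le_add {α β : E} {x y : ℝ} {w : V} (hα : Γ.Incident α w) (hβ : Γ.Incident β w)
    (hx : 0 ≤ Γ.coord w α x) (hy : 0 ≤ Γ.coord w β y) :
    Γ.pointDist α x β y ≤ ENNReal.ofReal (Γ.coord w α x + Γ.coord w β y) := by
  have h0 : Γ.vertexDist w w = 0 := by
    refine le_antisymm ?_ zero_le
    exact (iInf₂_le 0 (IsPathLength.refl w)).trans (by simp)
  refine inf_le_right.trans ((iInf₂_le w hα).trans ((iInf₂_le w hβ).trans ?_))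
  rw [h0, add_zero, ENNReal.ofReal_add hx hy]

omit [Fintype E] [DecidableEq E] in
theorem abs_coord_sub (w : V) (α : E) (x y : ℝ) :
    |Γ.coord w α x - Γ.coord w α y| = |x - y| := by
  unfold coord
  split_ifs
  · rfl
  · rw [show Γ.len α - x - (Γ.len α - y) = -(x - y) by ring, abs_neg]

variable {bc : Γ.BoundaryConditions}
  {W : ∀ w : V, Γ.EdgesAt w → Γ.EdgesAt w → ℝ → ℝ} {U : E → ℝ → ℝ}

theorem starParametrix_eq (hW : IsExtension Γ U W) (k : ℕ) (w : V) (t : ℝ) (α β : Γ.EdgesAt w)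
    {x y : ℝ} (hx : x ∈ Ico 0 (Γ.len α)) (hy : y ∈ Icc 0 (Γ.len β)) :
    bc.starParametrix U k w t α x β y =
      (if α = β then (lineParametrix (W w α α) k t x y : ℂ) else 0) +
        bc.sigma w α β * (lineParametrix (W w α β) k t x (-y) : ℂ) := by
  have la := Γ.len_pos α
  have lb := Γ.len_pos β
  have h1 : lineParametrix (Γ.glue U w α β) k t x (-y) = lineParametrix (W w α β) k t x (-y) := by
    simp only [lineParametrix, fun l => transportCoeff_congr (hW w α β).2 l
      (x := x) (y := -y) ⟨by linarith [hx.1], hx.2⟩ ⟨by linarith [hy.2], by linarith [hy.1]⟩]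
  rw [BoundaryConditions.starParametrix, h1]
  congr 1
  split_ifs with hab
  · subst hab
    simp only [lineParametrix, fun l => transportCoeff_congr (hW w α α).2 l
      (x := x) (y := y) ⟨by linarith [hx.1], hx.2⟩ ⟨by linarith [hy.1], hy.2⟩]
  · rfl

/-- The cut-off functions of the two parametrices only differ where the Gauss kernel is smaller than
any power of `t`. -/
theorem exists_star_sub_vertexTerm_le (hW : IsExtension Γ U W) {η : ℝ → ℝ} (hη : IsCutoff η)
    (k m : ℕ) (w : V) (α β : Γ.EdgesAt w) : ∃ C, ∀ t ∈ Ioc (0 : ℝ) 1,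
      ∀ x ∈ Ico 0 (2 / 3 * Γ.len α), ∀ y ∈ Icc 0 (Γ.len β),
      ‖(Γ.distCutoff η α (Γ.coord w α x) β (Γ.coord w β y) : ℂ) *
        bc.starParametrix U k w t α x β y - vertexTerm bc W (cutParametrix k) 0 w α β t x y‖ ≤
        C * t ^ m := by
  have la := Γ.len_pos α
  have lb := Γ.len_pos β
  have : Nonempty E := ⟨α⟩
  have hm := Γ.minLen_pos
  have hma := Γ.minLen_le α
  have hmb := Γ.minLen_le β
  obtain ⟨C₁, hC₁, h₁⟩ := exists_lineParametrix_le (hW w α α).1 k (Γ.len α + Γ.len β)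
  obtain ⟨C₂, hC₂, h₂⟩ := exists_lineParametrix_le (hW w α β).1 k (Γ.len α + Γ.len β)
  obtain ⟨C₃, hC₃, h₃⟩ := exists_gaussKernel_le_pow (δ := Γ.minLen / 30) (by positivity) m
  refine ⟨C₁ * C₃ + ‖bc.sigma w α β‖ * (C₂ * C₃), fun t ht x hx y hy => ?_⟩
  have ht0 := ht.1
  set d := Γ.distCutoff η α (Γ.coord w α x) β (Γ.coord w β y) with hd
  have hdI := distCutoff_mem_Icc (Γ := Γ) hη α (Γ.coord w α x) β (Γ.coord w β y)
  rw [← hd] at hdI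
  have hfI := farCutoff_mem_Icc (Γ.len β) y
  have hfac : |d - farCutoff (Γ.len β) y| ≤ 1 := by
    rw [abs_le]
    constructor <;> linarith [hdI.1, hdI.2, hfI.1, hfI.2]
  have heq : (d : ℂ) * bc.starParametrix U k w t α x β y -
      vertexTerm bc W (cutParametrix k) 0 w α β t x y =
      ((d - farCutoff (Γ.len β) y : ℝ) : ℂ) *
        ((if α = β then (lineParametrix (W w α α) k t x y : ℂ) else 0) +
        bc.sigma w α β * (lineParametrix (W w α β) k t x (-y) : ℂ)) := by
    rw [starParametrix_eq hW k w t α β ⟨hx.1, by linarith [hx.2]⟩ hy, vertexTerm]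
    simp only [cutParametrix, neg_neg]
    split_ifs <;> push_cast <;> ring
  have hfar (h : d = 1) (h' : y ≤ 7 / 10 * Γ.len β) : d - farCutoff (Γ.len β) y = 0 := by
    rw [h, farCutoff_eq_one lb h', sub_self]
  have hnear (h : d - farCutoff (Γ.len β) y = 0) : ‖(d : ℂ) * bc.starParametrix U k w t α x β y -
      vertexTerm bc W (cutParametrix k) 0 w α β t x y‖ ≤
      (C₁ * C₃ + ‖bc.sigma w α β‖ * (C₂ * C₃)) * t ^ m := by
    rw [heq, h, Complex.ofReal_zero, zero_mul, norm_zero]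
    positivity
  rcases lt_or_ge (x + y) (Γ.minLen / 30) with hxy | hxy
  · refine hnear (hfar (distCutoff_eq_one hη (pointDist_le_add (w := w) α.2 β.2 ?_ ?_) ?_) ?_)
    · rw [coord_coord]; exact hx.1
    · rw [coord_coord]; exact hy.1
    · rw [coord_coord, coord_coord]; linarith
    · linarith [hx.1]
  by_cases hab : α = β ∧ |x - y| < Γ.minLen / 30
  · obtain ⟨rfl, hxy'⟩ := hab
    refine hnear (hfar (distCutoff_eq_one hη (pointDist_le_abs _ _ _) ?_) ?_)
    · rw [abs_coord_sub]; linarith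
    · linarith [(abs_lt.1 hxy').1, hx.2]
  have hx' : x ∈ Icc (-(Γ.len α + Γ.len β)) (Γ.len α + Γ.len β) :=
    ⟨by linarith [hx.1], by linarith [hx.2]⟩
  have hy' : y ∈ Icc (-(Γ.len α + Γ.len β)) (Γ.len α + Γ.len β) :=
    ⟨by linarith [hy.1], by linarith [hy.2]⟩
  have hy'' : -y ∈ Icc (-(Γ.len α + Γ.len β)) (Γ.len α + Γ.len β) :=
    ⟨by linarith [hy.2], by linarith [hy.1]⟩
  rw [heq, norm_mul, Complex.norm_real]
  refine (mul_le_of_le_one_left (norm_nonneg _) hfac).trans ((norm_add_le _ _).trans ?_)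
  rw [add_mul, mul_assoc ‖_‖, mul_assoc C₁, mul_assoc C₂]
  refine add_le_add ?_ ?_
  · split_ifs with h
    · rw [Complex.norm_real]
      exact (h₁ t ht x hx' y hy').trans (mul_le_mul_of_nonneg_left
        (h₃ t ht x y (not_lt.1 fun h' => hab ⟨h, h'⟩)) hC₁)
    · rw [norm_zero]
      positivity
  · rw [norm_mul, Complex.norm_real]
    refine mul_le_mul_of_nonneg_left ((h₂ t ht x hx' (-y) hy'').trans (mul_le_mul_of_nonneg_left
        (h₃ t ht x (-y) ?_) hC₂)) (norm_nonneg _)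
    rw [sub_neg_eq_add, abs_of_nonneg (by linarith [hx.1, hy.1])]
    exact hxy

theorem exists_graphParametrix_sub_le [Fintype V] (hW : IsExtension Γ U W) {η : ℝ → ℝ}
    (hη : IsCutoff η) (k m : ℕ) : ∃ C, ∀ t ∈ Ioc (0 : ℝ) 1, ∀ α, ∀ x ∈ Icc 0 (Γ.len α), ∀ β,
      ∀ y ∈ Icc 0 (Γ.len β), ‖bc.graphParametrix U η k t α x β y -
        assemble bc W η (cutParametrix k) 0 t α x β y‖ ≤ C * t ^ m := by
  obtain ⟨C, hC0, hC⟩ := exists_uniform_bound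
    (ι := Σ w : V, Γ.EdgesAt w × Γ.EdgesAt w)
    (P := fun i C => ∀ t ∈ Ioc (0 : ℝ) 1, ∀ x ∈ Ico 0 (2 / 3 * Γ.len i.2.1),
      ∀ y ∈ Icc 0 (Γ.len i.2.2), ‖(Γ.distCutoff η i.2.1 (Γ.coord i.1 i.2.1 x) i.2.2
        (Γ.coord i.1 i.2.2 y) : ℂ) * bc.starParametrix U k i.1 t i.2.1 x i.2.2 y -
          vertexTerm bc W (cutParametrix k) 0 i.1 i.2.1 i.2.2 t x y‖ ≤ C * t ^ m)
    (fun i C C' hCC h t ht x hx y hy => (h t ht x hx y hy).trans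
      (mul_le_mul_of_nonneg_right hCC (pow_nonneg ht.1.le _)))
    (fun i => exists_star_sub_vertexTerm_le hW hη k m i.1 i.2.1 i.2.2)
  refine ⟨Fintype.card V * C, fun t ht α x hx β y hy => ?_⟩
  rw [BoundaryConditions.graphParametrix, assemble, Finset.mul_sum, ← Finset.sum_sub_distrib,
    mul_assoc]
  have key := norm_sum_chi_le (Γ := Γ) (β := β) hη hx (mul_nonneg hC0 (pow_nonneg ht.1.le m))
    (T := fun w h => (Γ.distCutoff η α x β y : ℂ) *
        bc.starParametrix U k w t ⟨α, h.1⟩ (Γ.coord w α x) ⟨β, h.2⟩ (Γ.coord w β y) -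
      vertexTerm bc W (cutParametrix k) 0 w ⟨α, h.1⟩ ⟨β, h.2⟩ t (Γ.coord w α x) (Γ.coord w β y))
    fun w h hxw => by
      have := hC ⟨w, ⟨α, h.1⟩, ⟨β, h.2⟩⟩ t ht _ hxw _ (coord_mem_Icc (w := w) hy)
      simpa only [coord_coord] using this
  refine le_of_eq_of_le (congrArg _ (Finset.sum_congr rfl fun w _ => ?_)) key
  split_ifs with h
  · ring
  · ring

/-- The heat kernel agrees with the parametrix up to `O(t^k)`, uniformly on the graph. -/
theorem BoundaryConditions.IsHeatKernel.exists_sub_graphParametrix_le [Fintype V]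
    {e : ℝ → E → ℝ → E → ℝ → ℂ} (he : bc.IsHeatKernel U e) (hU : Γ.IsSmoothPotential U)
    {η : ℝ → ℝ} (hη : IsCutoff η) {k : ℕ} (hk : 1 ≤ k) :
    ∃ C T : ℝ, 0 < T ∧ ∀ t ∈ Ioc 0 T,
      ∀ α, ∀ x ∈ Icc 0 (Γ.len α), ∀ β, ∀ y ∈ Icc 0 (Γ.len β),
        ‖e t α x β y - bc.graphParametrix U η k t α x β y‖ ≤ C * t ^ k := by
  obtain ⟨W, hW⟩ := hU.exists_isExtension
  obtain ⟨C₁, T, hT, hT1, h₁⟩ := (isParametrix_assemble (bc := bc) hU hW hη k).exists_norm_sub_le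
    (fun β => (hU.smooth β).continuousOn) he hk
  obtain ⟨C₂, h₂⟩ := exists_graphParametrix_sub_le (bc := bc) hW hη k k
  refine ⟨|C₁| + C₂, T, hT, fun t ht α x hx β y hy => ?_⟩
  have ht1 : t ∈ Ioc (0 : ℝ) 1 := ⟨ht.1, ht.2.trans hT1⟩
  have h3 : t ^ ((k : ℝ) + 1 / 2) ≤ t ^ k := by
    rw [← Real.rpow_natCast]
    exact Real.rpow_le_rpow_of_exponent_ge ht1.1 ht1.2 (by norm_num)
  have h4 : C₁ * t ^ ((k : ℝ) + 1 / 2) ≤ |C₁| * t ^ k :=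
    mul_le_mul (le_abs_self _) h3 (Real.rpow_nonneg ht1.1.le _) (abs_nonneg _)
  have h5 := h₁ t ht α x hx β y hy
  have h6 := h₂ t ht1 α x hx β y hy
  rw [norm_sub_rev] at h6
  calc _ ≤ _ := norm_sub_le_norm_sub_add_norm_sub _
        (assemble bc W η (cutParametrix k) 0 t α x β y) _
    _ ≤ _ := by rw [add_mul]; exact add_le_add (h5.trans h4) h6

end MetricGraph

/-! ### Universal polynomials for the transport coefficients -/

/-- The universal polynomials for the derivatives `∂_y^j u_l(x, y)` at `y = x`; the variable `X i`
stands for the `i`-th derivative of the potential at `x`. -/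
noncomputable def diagPoly : ℕ → ℕ → MvPolynomial ℕ ℝ
  | 0 => fun j => if j = 0 then 1 else 0
  | l + 1 => fun j => MvPolynomial.C (1 / ((l : ℝ) + j + 1)) * (diagPoly l (j + 2) +
      ∑ i ∈ Finset.range (j + 1),
        MvPolynomial.C (j.choose i : ℝ) * MvPolynomial.X i * diagPoly l (j - i))

/-- The polynomial of `∂_y^j u_l` has the parity of `j` under reversal of the direction. -/
theorem eval_diagPoly_neg (l j : ℕ) (J : ℕ → ℝ) :
    MvPolynomial.eval (fun i => (-1) ^ i * J i) (diagPoly l j) =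
      (-1) ^ j * MvPolynomial.eval J (diagPoly l j) := by
  induction l generalizing j with
  | zero =>
    by_cases h : j = 0 <;> simp [diagPoly, h]
  | succ l ih =>
    simp only [diagPoly, map_mul, map_add, map_sum, MvPolynomial.eval_C, MvPolynomial.eval_X, ih]
    have h : ∑ i ∈ Finset.range (j + 1), (j.choose i : ℝ) * ((-1) ^ i * J i) *
        ((-1) ^ (j - i) * MvPolynomial.eval J (diagPoly l (j - i))) =
        (-1) ^ j * ∑ i ∈ Finset.range (j + 1), (j.choose i : ℝ) * J i *
          MvPolynomial.eval J (diagPoly l (j - i)) := by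
      rw [Finset.mul_sum]
      refine Finset.sum_congr rfl fun i hi => ?_
      rw [← pow_mul_pow_sub (-1 : ℝ) (Nat.lt_succ_iff.1 (Finset.mem_range.1 hi))]
      ring
    rw [h, pow_add]
    ring

/-- All derivatives of `W` at `x`. -/
noncomputable def jet (W : ℝ → ℝ) (x : ℝ) : ℕ → ℝ := fun j => iteratedDeriv j W x

/-- The derivation of the polynomial ring that differentiates polynomials in `W, W', W'', …`. -/
noncomputable def jetDerivation : Derivation ℝ (MvPolynomial ℕ ℝ) (MvPolynomial ℕ ℝ) :=
  MvPolynomial.mkDerivation ℝ fun j => MvPolynomial.X (j + 1)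

/-- The universal polynomials for the derivatives of `s ↦ u_l(s, -s)` at `s = 0`, divided by
`n!`. -/
noncomputable def reflPoly (l n : ℕ) : MvPolynomial ℕ ℝ :=
  ∑ j ∈ Finset.range (n + 1), MvPolynomial.C ((-2) ^ j / (j.factorial * (n - j).factorial) : ℝ) *
    jetDerivation^[n - j] (diagPoly l j)

theorem abs_sub_taylor_le {f : ℝ → ℝ} (hf : ContDiff ℝ ∞ f) {a x L C : ℝ} (M : ℕ)
    (ha : a ∈ Icc (-L) L) (hx : x ∈ Icc (-L) L)
    (hC : ∀ y ∈ Icc (-L) L, |iteratedDeriv M f y| ≤ C) :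
    |f x - ∑ j ∈ Finset.range M, iteratedDeriv j f a / j.factorial * (x - a) ^ j| ≤
      C * |x - a| ^ M := by
  induction M generalizing f x with
  | zero => simpa using hC x hx
  | succ M ih =>
    have hf' := (contDiff_infty_iff_deriv.1 hf).2
    have hd (z : ℝ) : HasDerivAt (fun x => f x - ∑ j ∈ Finset.range (M + 1),
        iteratedDeriv j f a / j.factorial * (x - a) ^ j)
        (deriv f z - ∑ j ∈ Finset.range M,
          iteratedDeriv j (deriv f) a / j.factorial * (z - a) ^ j) z := by
      refine ((hf.differentiable (by simp)) z).hasDerivAt.sub ?_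
      have h1 (j : ℕ) : HasDerivAt (fun x => iteratedDeriv j f a / j.factorial * (x - a) ^ j)
          (iteratedDeriv j f a / j.factorial * (j * (z - a) ^ (j - 1))) z := by
        have := (((hasDerivAt_id z).sub_const a).pow j).const_mul
          (iteratedDeriv j f a / j.factorial)
        simpa using this
      refine (HasDerivAt.fun_sum (u := Finset.range (M + 1)) fun j _ => h1 j).congr_deriv ?_
      rw [Finset.sum_range_succ']
      simp only [Nat.cast_zero, zero_mul, mul_zero, add_zero, Nat.add_sub_cancel,
        Nat.factorial_succ, iteratedDeriv_succ']
      refine Finset.sum_congr rfl fun j _ => ?_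
      push_cast
      have := j.factorial_pos
      field_simp
    have hseg : uIcc a x ⊆ Icc (-L) L := uIcc_subset_Icc ha hx
    have hb : ∀ z ∈ uIcc a x, ‖deriv f z - ∑ j ∈ Finset.range M,
        iteratedDeriv j (deriv f) a / j.factorial * (z - a) ^ j‖ ≤ C * |x - a| ^ M := by
      intro z hz
      have hC0 : 0 ≤ C := (abs_nonneg _).trans (hC x hx)
      refine (ih hf' (hseg hz) fun y hy => by
        simpa only [iteratedDeriv_succ'] using hC y hy).trans ?_
      gcongr C * ?_ ^ M
      exact abs_sub_left_of_mem_uIcc hz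
    have key := (convex_uIcc a x).norm_image_sub_le_of_norm_hasDerivWithin_le
      (fun z _ => (hd z).hasDerivWithinAt) hb left_mem_uIcc right_mem_uIcc
    rw [show f a - ∑ j ∈ Finset.range (M + 1), iteratedDeriv j f a / j.factorial * (a - a) ^ j = 0
      by rw [Finset.sum_range_succ']; simp, sub_zero] at key
    rw [pow_succ, ← mul_assoc]
    exact key

section smooth

variable {W : ℝ → ℝ} (hW : ContDiff ℝ ∞ W)

include hW

theorem eval_diagPoly (l j : ℕ) (x : ℝ) :
    MvPolynomial.eval (jet W x) (diagPoly l j) = iteratedDeriv j (transportCoeff W l x) x := by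
  induction l generalizing j with
  | zero =>
    rw [show transportCoeff W 0 x = fun _ => (1 : ℝ) from rfl, iteratedDeriv_const]
    by_cases h : j = 0 <;> simp [diagPoly, h]
  | succ l ih =>
    have hu := (fiberSmooth_transportCoeff hW l).1 x
    have hu'' := (contDiff_infty_iff_deriv.1 (contDiff_infty_iff_deriv.1 hu).2).2
    rw [show transportCoeff W (l + 1) x = segAvg l (transportSource W l) x from
      funext (transportCoeff_succ W l x),
      iteratedDeriv_segAvg j l (fiberSmooth_transportSource hW l)]
    simp only [segAvg, sub_self, mul_zero, add_zero, intervalIntegral.integral_mul_const]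
    have h1 : iteratedDeriv j (transportSource W l x) x =
        iteratedDeriv (j + 2) (transportCoeff W l x) x + ∑ i ∈ Finset.range (j + 1),
        (j.choose i : ℝ) * iteratedDeriv i W x *
          iteratedDeriv (j - i) (transportCoeff W l x) x := by
      rw [show transportSource W l x = fun y => deriv (deriv (transportCoeff W l x)) y +
        W y * transportCoeff W l x y from rfl, iteratedDeriv_fun_add
          (hu''.contDiffAt.of_le (by exact_mod_cast le_top))
          ((hW.mul hu).contDiffAt.of_le (by exact_mod_cast le_top)),
        iteratedDeriv_fun_mul (hW.contDiffAt.of_le (by exact_mod_cast le_top))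
          (hu.contDiffAt.of_le (by exact_mod_cast le_top)), iteratedDeriv_succ',
        iteratedDeriv_succ']
    rw [h1, integral_pow]
    simp only [diagPoly, map_mul, map_add, map_sum, MvPolynomial.eval_C, MvPolynomial.eval_X, ih]
    simp [jet]

theorem hasDerivAt_eval_jet (P : MvPolynomial ℕ ℝ) (x : ℝ) :
    HasDerivAt (fun x => MvPolynomial.eval (jet W x) P)
      (MvPolynomial.eval (jet W x) (jetDerivation P)) x := by
  induction P using MvPolynomial.induction_on with
  | C a =>
    simpa [jetDerivation] using hasDerivAt_const x a
  | add P Q hP hQ =>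
    simp only [map_add]
    exact hP.add hQ
  | mul_X P i hP =>
    have h1 : HasDerivAt (fun x => jet W x i) (jet W x (i + 1)) x := by
      simp only [jet, iteratedDeriv_succ]
      exact ((hW.differentiable_iteratedDeriv i (by
        exact_mod_cast WithTop.coe_lt_top _)) x).hasDerivAt
    have h2 := hP.mul h1
    simp only [map_mul, MvPolynomial.eval_X]
    refine h2.congr_deriv ?_
    simp [jetDerivation, Derivation.leibniz, MvPolynomial.mkDerivation_X]
    ring

theorem iteratedDeriv_eval_jet (P : MvPolynomial ℕ ℝ) (n : ℕ) :
    iteratedDeriv n (fun x => MvPolynomial.eval (jet W x) P) =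
      fun x => MvPolynomial.eval (jet W x) (jetDerivation^[n] P) := by
  induction n generalizing P with
  | zero => simp
  | succ n ih =>
    rw [iteratedDeriv_succ', funext fun x => (hasDerivAt_eval_jet hW P x).deriv, ih,
      Function.iterate_succ_apply]

theorem contDiff_eval_jet (P : MvPolynomial ℕ ℝ) :
    ContDiff ℝ ∞ fun x => MvPolynomial.eval (jet W x) P := by
  refine contDiff_of_differentiable_iteratedDeriv fun n _ => ?_
  rw [iteratedDeriv_eval_jet hW]
  exact fun x => (hasDerivAt_eval_jet hW _ x).differentiableAt

/-- The Taylor expansion of the reflected transport coefficient `u_l(s, -s)` at the vertex. -/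
theorem exists_reflected_sub_le (l M : ℕ) (L : ℝ) :
    ∃ C, 0 ≤ C ∧ ∀ s ∈ Icc 0 L, |transportCoeff W l s (-s) -
      ∑ n ∈ Finset.range M, MvPolynomial.eval (jet W 0) (reflPoly l n) * s ^ n| ≤ C * s ^ M := by
  obtain ⟨C₁, hC₁, h₁⟩ := exists_bound_iteratedDeriv_transportCoeff hW l M L
  have hb (j : ℕ) : ∃ C, ∀ y ∈ Icc (-L) L,
      |iteratedDeriv (M - j) (fun x => MvPolynomial.eval (jet W x) (diagPoly l j)) y| ≤ C :=
    isCompact_Icc.exists_bound_of_continuousOn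
      ((contDiff_infty.1 (contDiff_eval_jet hW _) (M - j)).continuous_iteratedDeriv' _).continuousOn
  choose B hB using hb
  refine ⟨C₁ * 2 ^ M + ∑ j ∈ Finset.range M, |B j| * (2 ^ j / j.factorial), by positivity,
    fun s hs => ?_⟩
  have hs' : s ∈ Icc (-L) L := ⟨by linarith [hs.1, hs.2], hs.2⟩
  have h0' : (0 : ℝ) ∈ Icc (-L) L := ⟨by linarith [hs.1, hs.2], by linarith [hs.1, hs.2]⟩
  -- expansion in the second variable at the diagonal
  have h2 := abs_sub_taylor_le ((fiberSmooth_transportCoeff hW l).1 s) (a := s) (x := -s) M hs'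
    ⟨by linarith [hs.2], by linarith [hs.1, hs.2]⟩ (h₁ l le_rfl M le_rfl s hs')
  rw [show |-s - s| = 2 * s by rw [show -s - s = -(2 * s) by ring, abs_neg, abs_of_nonneg
    (by linarith [hs.1])]] at h2
  -- expansion of the coefficients along the diagonal
  have h3 (j : ℕ) : |iteratedDeriv j (transportCoeff W l s) s - ∑ m ∈ Finset.range (M - j),
      MvPolynomial.eval (jet W 0) (jetDerivation^[m] (diagPoly l j)) / m.factorial * s ^ m| ≤
      |B j| * s ^ (M - j) := by
    have := abs_sub_taylor_le (contDiff_eval_jet hW (diagPoly l j)) (M - j) h0' hs'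
      fun y hy => (hB j y hy).trans (le_abs_self _)
    simp only [iteratedDeriv_eval_jet hW, sub_zero, abs_of_nonneg hs.1] at this
    rwa [eval_diagPoly hW] at this
  have h4 : ∑ n ∈ Finset.range M, MvPolynomial.eval (jet W 0) (reflPoly l n) * s ^ n =
      ∑ j ∈ Finset.range M, (∑ m ∈ Finset.range (M - j),
        MvPolynomial.eval (jet W 0) (jetDerivation^[m] (diagPoly l j)) / m.factorial * s ^ m) /
          j.factorial * (-s - s) ^ j := by
    rw [← Finset.sum_congr rfl fun j _ => (by
      rw [Finset.sum_div, Finset.sum_mul] :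
        _ = (∑ m ∈ Finset.range (M - j), MvPolynomial.eval (jet W 0)
          (jetDerivation^[m] (diagPoly l j)) / m.factorial * s ^ m) /
          j.factorial * (-s - s) ^ j), ← Finset.sum_range_diag_flip M fun j m =>
        MvPolynomial.eval (jet W 0) (jetDerivation^[m] (diagPoly l j)) / m.factorial * s ^ m /
          j.factorial * (-s - s) ^ j]
    refine Finset.sum_congr rfl fun n _ => ?_
    simp only [reflPoly, map_sum, map_mul, MvPolynomial.eval_C, Finset.sum_mul]
    refine Finset.sum_congr rfl fun j hj => ?_
    rw [← pow_mul_pow_sub s (Nat.lt_succ_iff.1 (Finset.mem_range.1 hj)),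
      show -s - s = -2 * s by ring, mul_pow]
    field_simp
  have h5 : |∑ j ∈ Finset.range M, iteratedDeriv j (transportCoeff W l s) s / j.factorial *
      (-s - s) ^ j - ∑ n ∈ Finset.range M, MvPolynomial.eval (jet W 0) (reflPoly l n) * s ^ n| ≤
      (∑ j ∈ Finset.range M, |B j| * (2 ^ j / j.factorial)) * s ^ M := by
    rw [h4, ← Finset.sum_sub_distrib, Finset.sum_mul]
    refine (Finset.abs_sum_le_sum_abs _ _).trans (Finset.sum_le_sum fun j hj => ?_)
    rw [← sub_mul, ← sub_div, abs_mul, abs_div, abs_pow, Nat.abs_cast,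
      show |-s - s| = 2 * s by rw [show -s - s = -(2 * s) by ring, abs_neg, abs_of_nonneg
        (by linarith [hs.1])], ← pow_mul_pow_sub s (Finset.mem_range.1 hj).le, mul_pow]
    calc _ ≤ |B j| * s ^ (M - j) / j.factorial * (2 ^ j * s ^ j) := by
          have := hs.1
          gcongr
          exact h3 j
      _ = _ := by ring
  rw [add_mul]
  refine (abs_sub_le _ _ _).trans (add_le_add (h2.trans (le_of_eq ?_)) h5)
  rw [mul_pow, mul_assoc]

end smooth

/-! ### Moments of the reflected Gauss kernel -/

/-- The constants in `∫₀^∞ (4πt)^{-1/2} exp(-s²/t) sⁿ ds = gaussMoment n * t^{n/2}`. -/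
noncomputable def gaussMoment (n : ℕ) : ℝ :=
  Real.Gamma (((n : ℝ) + 1) / 2) / (4 * Real.sqrt Real.pi)

theorem gaussMoment_nonneg (n : ℕ) : 0 ≤ gaussMoment n :=
  div_nonneg (Real.Gamma_nonneg_of_nonneg (by positivity)) (by positivity)

theorem gaussKernel_neg_mul_pow {t s : ℝ} (n : ℕ) :
    gaussKernel t s (-s) * s ^ n =
      1 / Real.sqrt (4 * Real.pi * t) * (s ^ (n : ℝ) * Real.exp (-(1 / t) * s ^ (2 : ℝ))) := by
  rw [gaussKernel, Real.rpow_natCast, Real.rpow_two,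
    show -(s - -s) ^ 2 / (4 * t) = -(1 / t) * s ^ 2 by ring]
  ring

theorem integrableOn_gaussKernel_neg_mul_pow {t : ℝ} (ht : 0 < t) (n : ℕ) :
    IntegrableOn (fun s => gaussKernel t s (-s) * s ^ n) (Ioi 0) := by
  simp only [gaussKernel_neg_mul_pow]
  exact (integrableOn_rpow_mul_exp_neg_mul_rpow (by linarith [n.cast_nonneg (α := ℝ)]) two_pos
    (one_div_pos.2 ht)).const_mul _

theorem integral_gaussKernel_neg_mul_pow {t : ℝ} (ht : 0 < t) (n : ℕ) :
    ∫ s in Ioi (0 : ℝ), gaussKernel t s (-s) * s ^ n = gaussMoment n * t ^ ((n : ℝ) / 2) := by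
  simp only [gaussKernel_neg_mul_pow]
  rw [integral_const_mul, integral_rpow_mul_exp_neg_mul_rpow two_pos
    (by linarith [n.cast_nonneg (α := ℝ)]) (one_div_pos.2 ht), one_div t, Real.inv_rpow ht.le,
    ← Real.rpow_neg ht.le, show -(-((n : ℝ) + 1) / 2) = (n : ℝ) / 2 + 1 / 2 by ring,
    Real.rpow_add ht, ← Real.sqrt_eq_rpow, mul_assoc 4, Real.sqrt_mul (by norm_num : (0 : ℝ) ≤ 4),
    Real.sqrt_mul Real.pi_pos.le, show Real.sqrt 4 = 2 by
      rw [show (4 : ℝ) = 2 ^ 2 by norm_num]; exact Real.sqrt_sq (by norm_num), gaussMoment]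
  have h1 := (Real.sqrt_pos.2 ht).ne'
  have h2 := (Real.sqrt_pos.2 Real.pi_pos).ne'
  field_simp
  norm_num

/-- The contribution of a vertex to the heat trace: only the behaviour of `u_l(s, -s)` near `s = 0`
matters, so the integral over the edge may be replaced by moments over the half line. -/
theorem exists_reflected_integral_le {W q : ℝ → ℝ} (hW : ContDiff ℝ ∞ W) (hq : Continuous q)
    (hq01 : ∀ s, q s ∈ Icc (0 : ℝ) 1) {r ℓ : ℝ} (hr : 0 < r) (hrℓ : r ≤ ℓ)
    (hq1 : ∀ s ≤ r, q s = 1) (l M : ℕ) :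
    ∃ C, 0 ≤ C ∧ ∀ t > 0, |(∫ s in (0 : ℝ)..ℓ,
        q s * (gaussKernel t s (-s) * transportCoeff W l s (-s))) -
      ∑ n ∈ Finset.range M, gaussMoment n * MvPolynomial.eval (jet W 0) (reflPoly l n) *
        t ^ ((n : ℝ) / 2)| ≤ C * t ^ ((M : ℝ) / 2) := by
  obtain ⟨C₀, hC₀, h₀⟩ := exists_reflected_sub_le hW l M ℓ
  set c : ℕ → ℝ := fun n => MvPolynomial.eval (jet W 0) (reflPoly l n) with hc
  set u : ℝ → ℝ := fun s => transportCoeff W l s (-s) with hu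
  have huc : Continuous u :=
    (fiberSmooth_transportCoeff hW l).continuous.comp (f := fun s : ℝ => (s, -s)) (by fun_prop)
  set C := C₀ + ∑ n ∈ Finset.range M, |c n| * (1 / r) ^ (M - n) with hC
  have hC0 : 0 ≤ C := by positivity
  set Ψ : ℝ → ℝ := (Ioc 0 ℓ).indicator fun s => q s * u s with hΨ
  -- multiplication by a cut-off function costs at most `s ^ M`
  have hcut (p s : ℝ) (hs : 0 < s) (hp : p ∈ Icc (0 : ℝ) 1) (hp1 : s ≤ r → p = 1) :
      |(1 - p) * ∑ n ∈ Finset.range M, c n * s ^ n| ≤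
        (∑ n ∈ Finset.range M, |c n| * (1 / r) ^ (M - n)) * s ^ M := by
    rcases le_or_gt s r with h | h
    · rw [hp1 h, sub_self, zero_mul, abs_zero]
      positivity
    · rw [abs_mul, Finset.sum_mul]
      refine (mul_le_of_le_one_left (abs_nonneg _) ?_).trans
        ((Finset.abs_sum_le_sum_abs _ _).trans (Finset.sum_le_sum fun n hn => ?_))
      · rw [abs_of_nonneg (by linarith [hp.2])]
        linarith [hp.1]
      · rw [abs_mul, abs_of_nonneg (pow_nonneg hs.le n), mul_assoc,
          ← pow_sub_mul_pow s (Finset.mem_range.1 hn).le, ← mul_assoc ((1 / r) ^ _), ← mul_pow]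
        refine mul_le_mul_of_nonneg_left (le_mul_of_one_le_left (by positivity)
          (one_le_pow₀ ?_)) (abs_nonneg _)
        rw [one_div_mul_eq_div, one_le_div hr]
        exact h.le
  have hpt (s : ℝ) (hs : s ∈ Ioi (0 : ℝ)) :
      |Ψ s - ∑ n ∈ Finset.range M, c n * s ^ n| ≤ C * s ^ M := by
    have hs0 : 0 < s := hs
    by_cases hsℓ : s ∈ Ioc 0 ℓ
    · rw [hΨ, indicator_of_mem hsℓ, show q s * u s - ∑ n ∈ Finset.range M, c n * s ^ n =
        q s * (u s - ∑ n ∈ Finset.range M, c n * s ^ n) -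
          (1 - q s) * ∑ n ∈ Finset.range M, c n * s ^ n by ring, hC, add_mul]
      refine (abs_sub _ _).trans (add_le_add ?_ (hcut (q s) s hs0 (hq01 s) (hq1 s)))
      rw [abs_mul, abs_of_nonneg (hq01 s).1]
      exact (mul_le_of_le_one_left (abs_nonneg _) (hq01 s).2).trans
        (h₀ s (Ioc_subset_Icc_self hsℓ))
    · have hlt : ℓ < s := not_le.1 fun h => hsℓ ⟨hs0, h⟩
      have := hcut 0 s hs0 ⟨le_rfl, zero_le_one⟩ fun h => absurd (h.trans hrℓ) (not_le.2 hlt)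
      rw [hΨ, indicator_of_notMem hsℓ, zero_sub, abs_neg]
      rw [sub_zero, one_mul] at this
      exact this.trans (mul_le_mul_of_nonneg_right (le_add_of_nonneg_left hC₀) (by positivity))
  refine ⟨C * gaussMoment M, mul_nonneg hC0 (gaussMoment_nonneg M), fun t ht => ?_⟩
  have hG : Continuous fun s => gaussKernel t s (-s) := by
    unfold gaussKernel
    fun_prop
  have h1 : (∫ s in (0 : ℝ)..ℓ, q s * (gaussKernel t s (-s) * u s)) =
      ∫ s in Ioi (0 : ℝ), gaussKernel t s (-s) * Ψ s := by
    rw [intervalIntegral.integral_of_le (hr.le.trans hrℓ), show (Ioc 0 ℓ) = Ioi 0 ∩ Ioc 0 ℓ from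
      (inter_eq_self_of_subset_right fun s hs => hs.1).symm, ← setIntegral_indicator
        measurableSet_Ioc]
    congr 1
    ext s
    by_cases hs : s ∈ Ioc 0 ℓ
    · rw [hΨ, indicator_of_mem hs, indicator_of_mem hs]
      ring
    · rw [hΨ, indicator_of_notMem hs, indicator_of_notMem hs, mul_zero]
  have hΨi : IntegrableOn (fun s => gaussKernel t s (-s) * Ψ s) (Ioi 0) := by
    have : (fun s => gaussKernel t s (-s) * Ψ s) =
        (Ioc 0 ℓ).indicator fun s => gaussKernel t s (-s) * (q s * u s) := by
      ext s
      by_cases hs : s ∈ Ioc 0 ℓ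
      · rw [hΨ, indicator_of_mem hs, indicator_of_mem hs]
      · rw [hΨ, indicator_of_notMem hs, indicator_of_notMem hs, mul_zero]
    rw [this]
    refine (IntegrableOn.integrable_indicator ?_ measurableSet_Ioc).integrableOn
    exact ((hG.mul (hq.mul huc)).continuousOn.integrableOn_Icc).mono_set Ioc_subset_Icc_self
  have hsum (n : ℕ) : gaussMoment n * c n * t ^ ((n : ℝ) / 2) =
      ∫ s in Ioi (0 : ℝ), c n * (gaussKernel t s (-s) * s ^ n) := by
    rw [integral_const_mul, integral_gaussKernel_neg_mul_pow ht]
    ring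
  have hni (n : ℕ) : IntegrableOn (fun s => c n * (gaussKernel t s (-s) * s ^ n)) (Ioi 0) :=
    (integrableOn_gaussKernel_neg_mul_pow ht n).const_mul _
  rw [h1, Finset.sum_congr rfl fun n _ => hsum n, ← integral_finsetSum _ fun n _ => hni n,
    ← integral_sub hΨi (integrable_finsetSum _ fun n _ => hni n), mul_assoc,
    ← integral_gaussKernel_neg_mul_pow ht, ← integral_const_mul, ← Real.norm_eq_abs]
  refine norm_integral_le_of_norm_le ((integrableOn_gaussKernel_neg_mul_pow ht M).const_mul C)
    ((ae_restrict_iff' measurableSet_Ioi).2 (ae_of_all _ fun s hs => ?_))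
  rw [show gaussKernel t s (-s) * Ψ s - ∑ n ∈ Finset.range M, c n * (gaussKernel t s (-s) * s ^ n) =
    gaussKernel t s (-s) * (Ψ s - ∑ n ∈ Finset.range M, c n * s ^ n) by
      rw [mul_sub, Finset.mul_sum]
      congr 1
      exact Finset.sum_congr rfl fun n _ => mul_left_comm _ _ _,
    Real.norm_eq_abs, abs_mul, abs_of_nonneg (gaussKernel_nonneg _ _ _), mul_left_comm]
  exact mul_le_mul_of_nonneg_left (hpt s hs) (gaussKernel_nonneg _ _ _)

/-- The universal polynomials for the boundary contributions: `boundaryPoly m` collects the terms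
`u_l` and `sⁿ` with `2 l + n = m`. -/
noncomputable def boundaryPoly (m : ℕ) : MvPolynomial ℕ ℝ :=
  ∑ l ∈ Finset.range (m + 1), if 2 * l ≤ m then
    MvPolynomial.C (4 * gaussMoment (m - 2 * l)) * reflPoly l (m - 2 * l) else 0

theorem sum_range_sub_eq {R : Type*} [AddCommMonoid R] (f : ℕ → R) (a b : ℕ) :
    ∑ n ∈ Finset.range (a - b), f n =
      ∑ m ∈ Finset.range a, if b ≤ m then f (m - b) else 0 := by
  rw [← Finset.sum_filter]
  refine Finset.sum_bij' (fun n _ => n + b) (fun m _ => m - b) ?_ ?_ ?_ ?_ ?_ <;>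
    simp <;> omega

/-- The double sum over `l` and `n`, sorted by powers of `t`. -/
theorem sum_moments_eq_sum_boundaryPoly (J : ℕ → ℝ) {t : ℝ} (ht : 0 < t) (N : ℕ) :
    ∑ l ∈ Finset.range (2 * N + 2), t ^ l * ∑ n ∈ Finset.range (2 * N + 1 - 2 * l),
      gaussMoment n * MvPolynomial.eval J (reflPoly l n) * t ^ ((n : ℝ) / 2) =
    1 / 4 * ∑ m ∈ Finset.range (2 * N + 1),
      MvPolynomial.eval J (boundaryPoly m) * t ^ ((m : ℝ) / 2) := by
  simp only [sum_range_sub_eq, Finset.mul_sum]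
  rw [Finset.sum_comm]
  refine Finset.sum_congr rfl fun m hm => ?_
  have hm' := Finset.mem_range.1 hm
  rw [boundaryPoly, map_sum, Finset.sum_mul, Finset.mul_sum]
  rw [← Finset.sum_subset (s₁ := Finset.range (m + 1)) (Finset.range_mono (by omega))]
  · refine Finset.sum_congr rfl fun l _ => ?_
    split_ifs with h
    · rw [map_mul, MvPolynomial.eval_C, Nat.cast_sub h, show ((m : ℝ) / 2) =
        (l : ℝ) + ((m : ℝ) - ((2 * l : ℕ) : ℝ)) / 2 by push_cast; ring, Real.rpow_add ht,
        Real.rpow_natCast]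
      ring
    · simp
  · intro l _ hl
    rw [if_neg (by simp at hl; omega), mul_zero]

/-! ### The heat trace -/

theorem exists_isCutoff : ∃ η : ℝ → ℝ, IsCutoff η := by
  have hs (x : ℝ) : Real.smoothTransition (1 - x) = 1 - Real.smoothTransition x := by
    have := (Real.smoothTransition.pos_denom x).ne'
    rw [Real.smoothTransition, Real.smoothTransition, sub_sub_cancel, add_comm, eq_sub_iff_add_eq,
      ← add_div, add_comm, div_self this]
  refine ⟨fun x => Real.smoothTransition (2 - 3 * x),
    Real.smoothTransition.contDiff.comp (by fun_prop),
    fun x => ⟨Real.smoothTransition.nonneg _, Real.smoothTransition.le_one _⟩, fun x hx =>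
      Real.smoothTransition.one_of_one_le (by linarith), fun x hx =>
      Real.smoothTransition.zero_of_nonpos (by linarith), fun x => ?_⟩
  rw [← hs]
  congr 1
  ring

/-- The integral of the reflected part of the parametrix along an edge that starts at a vertex. -/
theorem exists_reflected_trace_le {W q : ℝ → ℝ} (hW : ContDiff ℝ ∞ W) (hq : Continuous q)
    (hq01 : ∀ s, q s ∈ Icc (0 : ℝ) 1) {r ℓ : ℝ} (hr : 0 < r) (hrℓ : r ≤ ℓ)
    (hq1 : ∀ s ≤ r, q s = 1) (N : ℕ) :
    ∃ C, ∀ t ∈ Ioc (0 : ℝ) 1, |(∫ s in (0 : ℝ)..ℓ,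
        q s * lineParametrix W (2 * N + 1) t s (-s)) -
      1 / 4 * ∑ m ∈ Finset.range (2 * N + 1),
        MvPolynomial.eval (jet W 0) (boundaryPoly m) * t ^ ((m : ℝ) / 2)| ≤
      C * t ^ ((N : ℝ) + 1 / 2) := by
  choose C hC0 hC using fun l =>
    exists_reflected_integral_le hW hq hq01 hr hrℓ hq1 l (2 * N + 1 - 2 * l)
  refine ⟨∑ l ∈ Finset.range (2 * N + 2), C l, fun t ht => ?_⟩
  have hc (l : ℕ) : Continuous fun s => transportCoeff W l s (-s) :=
    (fiberSmooth_transportCoeff hW l).continuous.comp (f := fun s : ℝ => (s, -s)) (by fun_prop)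
  have hG : Continuous fun s => gaussKernel t s (-s) := by
    unfold gaussKernel
    fun_prop
  have h1 : (∫ s in (0 : ℝ)..ℓ, q s * lineParametrix W (2 * N + 1) t s (-s)) =
      ∑ l ∈ Finset.range (2 * N + 2), t ^ l * ∫ s in (0 : ℝ)..ℓ,
        q s * (gaussKernel t s (-s) * transportCoeff W l s (-s)) := by
    simp only [← intervalIntegral.integral_const_mul]
    rw [← intervalIntegral.integral_finsetSum]
    · congr 1
      ext s
      rw [lineParametrix, Finset.mul_sum, Finset.mul_sum]
      refine Finset.sum_congr rfl fun l _ => ?_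
      ring
    · exact fun l _ =>
        (continuous_const.mul (hq.mul (hG.mul (hc l)))).intervalIntegrable _ _
  rw [h1, ← sum_moments_eq_sum_boundaryPoly _ ht.1, ← Finset.sum_sub_distrib, Finset.sum_mul]
  refine (Finset.abs_sum_le_sum_abs _ _).trans (Finset.sum_le_sum fun l _ => ?_)
  rw [← mul_sub, abs_mul, abs_of_nonneg (pow_nonneg ht.1.le l)]
  refine (mul_le_mul_of_nonneg_left (hC l t ht.1) (pow_nonneg ht.1.le l)).trans ?_
  rw [mul_left_comm, ← Real.rpow_natCast t l, ← Real.rpow_add ht.1]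
  refine mul_le_mul_of_nonneg_left (Real.rpow_le_rpow_of_exponent_ge ht.1 ht.2 ?_) (hC0 l)
  have : ((2 * N + 1 : ℕ) : ℝ) ≤ ((2 * N + 1 - 2 * l + 2 * l : ℕ) : ℝ) := by
    exact_mod_cast (by omega : 2 * N + 1 ≤ 2 * N + 1 - 2 * l + 2 * l)
  push_cast at this
  linarith

namespace MetricGraph

variable {V : Type u} {E : Type v} {Γ : MetricGraph V E} [DecidableEq V]

open scoped Pointwise in
theorem iteratedDerivWithin_atVertex (U : E → ℝ → ℝ) (w : V) (α : E) (j : ℕ) (s : ℝ) :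
    iteratedDerivWithin j (Γ.atVertex U w α) (Icc 0 (Γ.len α)) s =
      Γ.orient w α ^ j * iteratedDerivWithin j (U α) (Icc 0 (Γ.len α)) (Γ.coord w α s) := by
  by_cases h : Γ.src α = w
  · have : Γ.atVertex U w α = U α := by
      ext z
      rw [atVertex, coord, if_pos h]
    rw [this, orient, if_pos h, coord, if_pos h, one_pow, one_mul]
  · have h1 : Γ.atVertex U w α = fun z => U α (Γ.len α - z) := by
      ext z
      rw [atVertex, coord, if_neg h]
    have h2 : Γ.len α +ᵥ -Icc 0 (Γ.len α) = Icc 0 (Γ.len α) := by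
      ext z
      simp
    rw [h1, iteratedDerivWithin_comp_const_sub, h2, orient, if_neg h, coord, if_neg h]
    rfl

/-- The derivatives of the potential along the edge `α` at the point `x`. -/
noncomputable def edgeJet (Γ : MetricGraph V E) (U : E → ℝ → ℝ) (α : E) (x : ℝ) : ℕ → ℝ :=
  fun j => iteratedDerivWithin j (U α) (Icc 0 (Γ.len α)) x

variable {U : E → ℝ → ℝ} {W : ∀ w : V, Γ.EdgesAt w → Γ.EdgesAt w → ℝ → ℝ}

theorem IsExtension.jet_eq (hW : IsExtension Γ U W) {w : V} (α : Γ.EdgesAt w) {s : ℝ}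
    (hs : s ∈ Icc 0 (Γ.len α)) (j : ℕ) : jet (W w α α) s j =
      iteratedDerivWithin j (Γ.atVertex U w α) (Icc 0 (Γ.len α)) s := by
  rw [jet, ← iteratedDerivWithin_eq_iteratedDeriv (uniqueDiffOn_Icc (Γ.len_pos α))
    ((hW w α α).1.contDiffAt.of_le (by exact_mod_cast le_top)) hs]
  exact iteratedDerivWithin_congr (fun z hz => hW.eq_of_nonneg α α hz) hs

theorem IsExtension.eval_jet_diagPoly (hW : IsExtension Γ U W) {w : V} (α : Γ.EdgesAt w) {s : ℝ}
    (hs : s ∈ Icc 0 (Γ.len α)) (l : ℕ) : MvPolynomial.eval (jet (W w α α) s) (diagPoly l 0) =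
      MvPolynomial.eval (edgeJet Γ U α (Γ.coord w α s)) (diagPoly l 0) := by
  have h1 : jet (W w α α) s = fun j =>
      Γ.orient w α ^ j * edgeJet Γ U α (Γ.coord w α s) j := by
    ext j
    rw [hW.jet_eq α hs, iteratedDerivWithin_atVertex, edgeJet]
  rw [h1]
  by_cases h : Γ.src α = w
  · simp [orient, h]
  · simpa [orient, h] using eval_diagPoly_neg l 0 (edgeJet Γ U α (Γ.coord w α s))

theorem IsSmoothPotential.continuousOn_eval_edgeJet (hU : Γ.IsSmoothPotential U) (α : E)
    (P : MvPolynomial ℕ ℝ) :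
    ContinuousOn (fun x => MvPolynomial.eval (edgeJet Γ U α x) P) (Icc 0 (Γ.len α)) :=
  (MvPolynomial.continuous_eval P).comp_continuousOn (continuousOn_pi.2 fun j =>
    (hU.smooth α).continuousOn_iteratedDerivWithin (by exact_mod_cast le_top)
      (uniqueDiffOn_Icc (Γ.len_pos α)))

variable [Fintype E]

theorem sum_dite_incident {R : Type*} [AddCommMonoid R] (w : V) (f : Γ.EdgesAt w → R) :
    ∑ α : E, (if h : Γ.Incident α w then f ⟨α, h⟩ else 0) = ∑ α : Γ.EdgesAt w, f α := by
  have h1 : ∑ α : Γ.EdgesAt w, f α =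
      ∑ α : Γ.EdgesAt w, (fun α : E => if h : Γ.Incident α w then f ⟨α, h⟩ else 0) α :=
    Finset.sum_congr rfl fun α _ => by simp only [dif_pos α.2]
  rw [h1, ← Finset.sum_subtype (Finset.univ.filter fun β : E => Γ.Incident β w) (by simp)
    fun α : E => if h : Γ.Incident α w then f ⟨α, h⟩ else 0, Finset.sum_filter]
  refine Finset.sum_congr rfl fun α _ => ?_
  split_ifs <;> rfl

variable [DecidableEq E] {bc : Γ.BoundaryConditions}

/-- The trace of the parametrix, as a sum over the vertices and their adjacent edges. -/
theorem integral_assemble_diag [Fintype V] (hW : IsExtension Γ U W) {η : ℝ → ℝ} (hη : IsCutoff η)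
    (k : ℕ) (t : ℝ) :
    (Γ.integral fun α x => assemble bc W η (cutParametrix k) 0 t α x α x) =
      ∑ w : V, ∑ α : Γ.EdgesAt w,
        (((∫ s in (0 : ℝ)..Γ.len α, η ((Γ.len α)⁻¹ * s) * lineParametrix (W w α α) k t s s : ℝ) : ℂ)
        + bc.sigma w α α * ((∫ s in (0 : ℝ)..Γ.len α,
          η ((Γ.len α)⁻¹ * s) * lineParametrix (W w α α) k t s (-s) : ℝ) : ℂ)) := by
  have hηc := hη.smooth.continuous
  have hL (w : V) (α β : Γ.EdgesAt w) {f g : ℝ → ℝ} (hf : Continuous f) (hg : Continuous g) :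
      Continuous fun s => lineParametrix (W w α β) k t (f s) (g s) := by
    unfold lineParametrix gaussKernel
    refine Continuous.mul (by fun_prop) (continuous_finsetSum _ fun l _ => Continuous.mul ?_
      continuous_const)
    exact (fiberSmooth_transportCoeff (hW w α β).1 l).continuous.comp (hf.prodMk hg)
  have hterm (w : V) (α : Γ.EdgesAt w) (s : ℝ) :
      (η ((Γ.len α)⁻¹ * s) : ℂ) * vertexTerm bc W (cutParametrix k) 0 w α α t s s =
      ((η ((Γ.len α)⁻¹ * s) * lineParametrix (W w α α) k t s s : ℝ) : ℂ) +
        bc.sigma w α α * ((η ((Γ.len α)⁻¹ * s) * lineParametrix (W w α α) k t s (-s) : ℝ) : ℂ) := by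
    have la := Γ.len_pos α
    rcases le_or_gt s (7 / 10 * Γ.len α) with h | h
    · simp only [vertexTerm, cutParametrix, if_true, neg_neg, farCutoff_eq_one la h]
      push_cast
      ring
    · have h0 : η ((Γ.len α)⁻¹ * s) = 0 := by
        refine hη.eq_zero _ ?_
        rw [inv_mul_eq_div, le_div_iff₀ la]
        linarith
      simp [h0]
  have hint (w : V) (α : E) : (∫ x in (0 : ℝ)..Γ.len α,
      if h : Γ.Incident α w ∧ Γ.Incident α w then (Γ.chi η w α x : ℂ) *
        ((Γ.orient w α : ℂ) ^ 0 * vertexTerm bc W (cutParametrix k) 0 w ⟨α, h.1⟩ ⟨α, h.2⟩ t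
          (Γ.coord w α x) (Γ.coord w α x)) else 0) =
      if h : Γ.Incident α w then
        (((∫ s in (0 : ℝ)..Γ.len α, η ((Γ.len α)⁻¹ * s) *
          lineParametrix (W w ⟨α, h⟩ ⟨α, h⟩) k t s s : ℝ) : ℂ) +
        bc.sigma w ⟨α, h⟩ ⟨α, h⟩ * ((∫ s in (0 : ℝ)..Γ.len α,
          η ((Γ.len α)⁻¹ * s) * lineParametrix (W w ⟨α, h⟩ ⟨α, h⟩) k t s (-s) : ℝ) : ℂ))
      else 0 := by
    by_cases h : Γ.Incident α w
    · simp only [h, and_self, dif_pos, pow_zero, one_mul, chi]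
      rw [integral_comp_coord (fun s => (η ((Γ.len α)⁻¹ * s) : ℂ) *
        vertexTerm bc W (cutParametrix k) 0 w ⟨α, h⟩ ⟨α, h⟩ t s s) w α]
      simp only [fun s => hterm w ⟨α, h⟩ s]
      have c1 := hL w ⟨α, h⟩ ⟨α, h⟩ continuous_id continuous_id
      have c2 := hL w ⟨α, h⟩ ⟨α, h⟩ continuous_id continuous_neg
      rw [intervalIntegral.integral_add, intervalIntegral.integral_const_mul,
        intervalIntegral.integral_ofReal, intervalIntegral.integral_ofReal]
      · refine Continuous.intervalIntegrable (Complex.continuous_ofReal.comp ?_) _ _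
        exact Continuous.mul (by fun_prop) c1
      · refine Continuous.intervalIntegrable (continuous_const.mul
          (Complex.continuous_ofReal.comp ?_)) _ _
        exact Continuous.mul (by fun_prop) c2
    · simp [h]
  simp only [← sum_dite_incident]
  rw [Finset.sum_comm]
  refine Finset.sum_congr rfl fun α _ => ?_
  simp only [assemble]
  rw [intervalIntegral.integral_finsetSum]
  · exact Finset.sum_congr rfl fun w _ => hint w α
  · intro w _
    by_cases h : Γ.Incident α w
    · have hcc := continuous_coord (Γ := Γ) w α
      have hχ := continuous_chi (Γ := Γ) hηc w α
      have hf1 := (contDiff_farCutoff (Γ.len α)).continuous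
      have hf2 := (contDiff_farCutoff_neg (Γ.len α)).continuous
      have c1 := hL w ⟨α, h⟩ ⟨α, h⟩ hcc hcc
      have c2 := hL w ⟨α, h⟩ ⟨α, h⟩ hcc hcc.neg
      simp only [h, and_self, dif_pos, vertexTerm, cutParametrix, if_true]
      refine Continuous.intervalIntegrable ?_ _ _
      refine (Complex.continuous_ofReal.comp hχ).mul (continuous_const.mul (Continuous.add
        (Complex.continuous_ofReal.comp ((hf1.comp hcc).mul c1)) (continuous_const.mul
          (continuous_const.mul (Complex.continuous_ofReal.comp ((hf2.comp hcc.neg).mul c2))))))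
    · simp [h]

omit [DecidableEq E] in
/-- The two cut-off functions on an edge add up to `1`, and the direct part of the parametrix does
not depend on the direction of the edge, so the direct parts give the integral over the graph. -/
theorem sum_integral_direct [Fintype V] (hU : Γ.IsSmoothPotential U) (hW : IsExtension Γ U W)
    {η : ℝ → ℝ} (hη : IsCutoff η) (k : ℕ) (t : ℝ) :
    ∑ w : V, ∑ α : Γ.EdgesAt w,
      (∫ s in (0 : ℝ)..Γ.len α, η ((Γ.len α)⁻¹ * s) * lineParametrix (W w α α) k t s s) =
    1 / Real.sqrt (4 * Real.pi * t) * ∑ l ∈ Finset.range (k + 1),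
      (Γ.integral fun α x => MvPolynomial.eval (edgeJet Γ U α x) (diagPoly l 0)) * t ^ l := by
  set F : E → ℝ → ℝ := fun α x => 1 / Real.sqrt (4 * Real.pi * t) *
    ∑ l ∈ Finset.range (k + 1), MvPolynomial.eval (edgeJet Γ U α x) (diagPoly l 0) * t ^ l with hF
  have hFc (α : E) : ContinuousOn (F α) (Icc 0 (Γ.len α)) :=
    continuousOn_const.mul (continuousOn_finsetSum _ fun l _ =>
      (hU.continuousOn_eval_edgeJet α _).mul continuousOn_const)
  have h1 (w : V) (α : Γ.EdgesAt w) :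
      (∫ s in (0 : ℝ)..Γ.len α, η ((Γ.len α)⁻¹ * s) * lineParametrix (W w α α) k t s s) =
      ∫ x in (0 : ℝ)..Γ.len α, Γ.chi η w α x * F α x := by
    rw [← integral_comp_coord (Γ := Γ) (fun x => Γ.chi η w α x * F α x) w (α : E)]
    refine intervalIntegral.integral_congr fun s hs => ?_
    rw [uIcc_of_le (Γ.len_pos α).le] at hs
    have hG : gaussKernel t s s = 1 / Real.sqrt (4 * Real.pi * t) := by simp [gaussKernel]
    simp only [chi, coord_coord, hF, lineParametrix, hG, ← hW.eval_jet_diagPoly α hs,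
      eval_diagPoly (hW w α α).1, iteratedDeriv_zero]
  have hi (w : V) (α : E) : IntervalIntegrable (fun x => Γ.chi η w α x * F α x) volume 0
      (Γ.len α) :=
    ContinuousOn.intervalIntegrable_of_Icc (Γ.len_pos α).le
      ((continuous_chi hη.smooth.continuous w α).continuousOn.mul (hFc α))
  simp only [h1]
  rw [sum_edgesAt fun w α => ∫ x in (0 : ℝ)..Γ.len α, Γ.chi η w α x * F α x]
  have h2 (α : E) : (∫ x in (0 : ℝ)..Γ.len α, Γ.chi η (Γ.src α) α x * F α x) +
      (∫ x in (0 : ℝ)..Γ.len α, Γ.chi η (Γ.tgt α) α x * F α x) =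
      1 / Real.sqrt (4 * Real.pi * t) * ∑ l ∈ Finset.range (k + 1),
        (∫ x in (0 : ℝ)..Γ.len α, MvPolynomial.eval (edgeJet Γ U α x) (diagPoly l 0)) * t ^ l := by
    rw [← intervalIntegral.integral_add (hi _ α) (hi _ α)]
    simp only [← add_mul, chi_src_add_chi_tgt hη, one_mul, hF, intervalIntegral.integral_const_mul]
    rw [intervalIntegral.integral_finsetSum]
    · simp only [intervalIntegral.integral_mul_const]
    · exact fun l _ => ContinuousOn.intervalIntegrable_of_Icc (Γ.len_pos α).le
        ((hU.continuousOn_eval_edgeJet α _).mul continuousOn_const)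
  simp only [h2, MetricGraph.integral, Finset.sum_mul]
  rw [← Finset.mul_sum, Finset.sum_comm]

/-- The terms of order above `N` in the interior part of the expansion. -/
theorem exists_sum_range_sub_le (A : ℕ → ℝ) {N k : ℕ} (hN : N ≤ k) :
    ∃ C, ∀ t ∈ Ioc (0 : ℝ) 1, |1 / Real.sqrt (4 * Real.pi * t) *
      ∑ l ∈ Finset.range (k + 1), A l * t ^ l - 1 / Real.sqrt (4 * Real.pi * t) *
        ∑ l ∈ Finset.range (N + 1), A l * t ^ l| ≤ C * t ^ ((N : ℝ) + 1 / 2) := by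
  refine ⟨∑ l ∈ Finset.Ico (N + 1) (k + 1), |A l|, fun t ht => ?_⟩
  have ht0 := ht.1
  rw [← mul_sub, ← Finset.sum_Ico_eq_sub _ (by omega : N + 1 ≤ k + 1), abs_mul,
    abs_of_nonneg (by positivity)]
  have h1 : |∑ l ∈ Finset.Ico (N + 1) (k + 1), A l * t ^ l| ≤
      (∑ l ∈ Finset.Ico (N + 1) (k + 1), |A l|) * t ^ (N + 1) := by
    rw [Finset.sum_mul]
    refine (Finset.abs_sum_le_sum_abs _ _).trans (Finset.sum_le_sum fun l hl => ?_)
    rw [abs_mul, abs_of_nonneg (pow_nonneg ht0.le l)]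
    exact mul_le_mul_of_nonneg_left (pow_le_pow_of_le_one ht0.le ht.2 (Finset.mem_Ico.1 hl).1)
      (abs_nonneg _)
  refine (mul_le_mul (inv_sqrt_four_pi_le ht0) h1 (abs_nonneg _)
    (Real.rpow_nonneg ht0.le _)).trans (le_of_eq ?_)
  rw [mul_left_comm, ← Real.rpow_natCast, ← Real.rpow_add ht0]
  congr 2
  push_cast
  ring

omit [DecidableEq E] in
theorem sum_add_mul_sub_eq [Fintype V] (σ : ∀ w, Γ.EdgesAt w → ℂ) (D R B : ∀ w, Γ.EdgesAt w → ℝ)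
    (X : ℝ) : (∑ w : V, ∑ α : Γ.EdgesAt w, ((D w α : ℂ) + σ w α * (R w α : ℂ))) -
      ((X : ℂ) + 1 / 4 * ∑ w : V, ∑ α : Γ.EdgesAt w, σ w α * (B w α : ℂ)) =
    ((∑ w : V, ∑ α : Γ.EdgesAt w, D w α - X : ℝ) : ℂ) +
      ∑ w : V, ∑ α : Γ.EdgesAt w, σ w α * ((R w α - 1 / 4 * B w α : ℝ) : ℂ) := by
  push_cast
  simp only [mul_sub, Finset.sum_sub_distrib, Finset.sum_add_distrib, mul_left_comm _ (1 / 4 : ℂ),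
    ← Finset.mul_sum]
  ring

theorem exists_trace_sub_trace_le [Fintype V] {e p pt py pyy : ℝ → E → ℝ → E → ℝ → ℂ}
    (hU : Γ.IsSmoothPotential U) (he : bc.IsHeatKernel U e) {k : ℕ} (hk : 1 ≤ k)
    (hp : IsParametrix bc U k p pt py pyy) :
    ∃ C T : ℝ, 0 < T ∧ T ≤ 1 ∧ ∀ t ∈ Ioc 0 T,
      ‖(Γ.integral fun α x => e t α x α x) - Γ.integral fun α x => p t α x α x‖ ≤
        C * t ^ ((k : ℝ) + 1 / 2) := by
  obtain ⟨C, T, hT, hT1, h⟩ := hp.exists_norm_sub_le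
    (fun β => (hU.smooth β).continuousOn) he hk
  refine ⟨C * Γ.integral fun _ _ => (1 : ℝ), T, hT, hT1, fun t ht => ?_⟩
  have ht0 := ht.1
  have hec (α : E) : ContinuousOn (fun x => e t α x α x) (Icc 0 (Γ.len α)) :=
    (he.continuous α α).comp (f := fun x : ℝ => (t, x, x)) (by fun_prop)
      fun x hx => ⟨ht0, hx, hx⟩
  have hpc (α : E) : ContinuousOn (fun x => p t α x α x) (Icc 0 (Γ.len α)) :=
    (hp.cont t ht0 α α).comp (f := fun x : ℝ => (x, x)) (by fun_prop) fun x hx => ⟨hx, hx⟩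
  rw [← integral_sub
    (fun α => (hec α).intervalIntegrable_of_Icc (Γ.len_pos α).le)
    (fun α => (hpc α).intervalIntegrable_of_Icc (Γ.len_pos α).le), mul_right_comm,
    ← integral_const_mul]
  refine norm_integral_le (fun α x hx => ?_) fun α => intervalIntegrable_const
  rw [mul_one]
  exact h t ht α x hx α x hx

theorem exists_sum_reflected_le [Fintype V] (hW : IsExtension Γ U W) {η : ℝ → ℝ}
    (hη : IsCutoff η) (N : ℕ) : ∃ C, ∀ t ∈ Ioc (0 : ℝ) 1,
      ‖∑ w : V, ∑ α : Γ.EdgesAt w, bc.sigma w α α * (((∫ s in (0 : ℝ)..Γ.len α,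
        η ((Γ.len α)⁻¹ * s) * lineParametrix (W w α α) (2 * N + 1) t s (-s)) -
        1 / 4 * ∑ m ∈ Finset.range (2 * N + 1),
          MvPolynomial.eval (jet (W w α α) 0) (boundaryPoly m) * t ^ ((m : ℝ) / 2) : ℝ) : ℂ)‖ ≤
      C * t ^ ((N : ℝ) + 1 / 2) := by
  have h (w : V) (α : Γ.EdgesAt w) : ∃ C, ∀ t ∈ Ioc (0 : ℝ) 1, |(∫ s in (0 : ℝ)..Γ.len α,
        η ((Γ.len α)⁻¹ * s) * lineParametrix (W w α α) (2 * N + 1) t s (-s)) -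
        1 / 4 * ∑ m ∈ Finset.range (2 * N + 1),
          MvPolynomial.eval (jet (W w α α) 0) (boundaryPoly m) * t ^ ((m : ℝ) / 2)| ≤
      C * t ^ ((N : ℝ) + 1 / 2) := by
    have la := Γ.len_pos α
    refine exists_reflected_trace_le (r := 1 / 3 * Γ.len α) (hW w α α).1
      (q := fun s => η ((Γ.len α)⁻¹ * s)) (hη.smooth.continuous.comp (by fun_prop))
      (fun s => hη.mem_Icc _) (by positivity) (by linarith) (fun s hs => hη.eq_one _ ?_) N
    rw [inv_mul_eq_div, div_le_iff₀ la]
    exact hs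
  choose C hC using h
  refine ⟨∑ w : V, ∑ α : Γ.EdgesAt w, ‖bc.sigma w α α‖ * C w α, fun t ht => ?_⟩
  rw [Finset.sum_mul]
  refine (norm_sum_le _ _).trans (Finset.sum_le_sum fun w _ => ?_)
  rw [Finset.sum_mul]
  refine (norm_sum_le _ _).trans (Finset.sum_le_sum fun α _ => ?_)
  rw [norm_mul, Complex.norm_real, mul_assoc]
  exact mul_le_mul_of_nonneg_left (hC w α t ht) (norm_nonneg _)

theorem exists_trace_assemble_sub_le [Fintype V] (hU : Γ.IsSmoothPotential U)
    (hW : IsExtension Γ U W) {η : ℝ → ℝ} (hη : IsCutoff η) (N : ℕ) :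
    ∃ C, ∀ t ∈ Ioc (0 : ℝ) 1, ‖(Γ.integral fun α x =>
        assemble bc W η (cutParametrix (2 * N + 1)) 0 t α x α x) -
      bc.traceExpansion U (fun n => diagPoly n 0) boundaryPoly N t‖ ≤
        C * t ^ ((N : ℝ) + 1 / 2) := by
  obtain ⟨C₁, h₁⟩ := exists_sum_range_sub_le (fun l => Γ.integral fun α x =>
    MvPolynomial.eval (edgeJet Γ U α x) (diagPoly l 0)) (by omega : N ≤ 2 * N + 1)
  obtain ⟨C₂, h₂⟩ := exists_sum_reflected_le (bc := bc) hW hη N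
  refine ⟨C₁ + C₂, fun t ht => ?_⟩
  have k₁ := h₁ t ht
  rw [← sum_integral_direct hU hW hη (2 * N + 1) t] at k₁
  have hvd (w : V) (α : Γ.EdgesAt w) : (fun j => Γ.vertexDeriv U w α j) = jet (W w α α) 0 :=
    funext fun j => (hW.jet_eq α ⟨le_rfl, (Γ.len_pos α).le⟩ j).symm
  rw [integral_assemble_diag hW hη (2 * N + 1) t, BoundaryConditions.traceExpansion]
  simp only [hvd]
  rw [sum_add_mul_sub_eq, add_mul]
  refine (norm_add_le _ _).trans (add_le_add ?_ (h₂ t ht))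
  rw [Complex.norm_real]
  exact k₁

/-- The expansion of the heat trace, with the explicit universal polynomials. -/
theorem BoundaryConditions.IsHeatKernel.exists_trace_sub_le [Fintype V]
    {e : ℝ → E → ℝ → E → ℝ → ℂ} (he : bc.IsHeatKernel U e) (hU : Γ.IsSmoothPotential U) (N : ℕ) :
    ∃ C T : ℝ, 0 < T ∧ ∀ t ∈ Ioc 0 T, ‖(Γ.integral fun α x => e t α x α x) -
      bc.traceExpansion U (fun n => diagPoly n 0) boundaryPoly N t‖ ≤
        C * t ^ ((N : ℝ) + 1 / 2) := by
  obtain ⟨η, hη⟩ := exists_isCutoff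
  obtain ⟨W, hW⟩ := hU.exists_isExtension
  obtain ⟨C₁, T, hT, hT1, h₁⟩ := exists_trace_sub_trace_le hU he (by omega : 1 ≤ 2 * N + 1)
    (isParametrix_assemble (bc := bc) hU hW hη (2 * N + 1))
  obtain ⟨C₂, h₂⟩ := exists_trace_assemble_sub_le (bc := bc) hU hW hη N
  refine ⟨|C₁| + C₂, T, hT, fun t ht => ?_⟩
  have ht1 : t ∈ Ioc (0 : ℝ) 1 := ⟨ht.1, ht.2.trans hT1⟩
  refine (norm_sub_le_norm_sub_add_norm_sub _ (Γ.integral fun α x =>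
      assemble bc W η (cutParametrix (2 * N + 1)) 0 t α x α x) _).trans ?_
  rw [add_mul]
  refine add_le_add ((h₁ t ht).trans (mul_le_mul (le_abs_self _)
    (Real.rpow_le_rpow_of_exponent_ge ht.1 ht1.2 ?_) (Real.rpow_nonneg ht.1.le _) (abs_nonneg _)))
    (h₂ t ht1)
  push_cast
  linarith [N.cast_nonneg (α := ℝ)]

end MetricGraph

/-- First part: the heat kernel agrees with the parametrix up to `O(t^k)`, uniformly on the graph.
Second part: the heat trace has an asymptotic expansion whose coefficients are local and universal:
they are polynomials, the same for all graphs, potentials and boundary conditions, in the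
derivatives of the potential at the point. The condition on `a` says that `a_n(x)` does not depend
on the direction in which the edge is parametrized. -/
theorem theorem6p1 :
    (∀ (V : Type u) (E : Type v) [Fintype V] [Fintype E] [DecidableEq V] [DecidableEq E]
      (Γ : MetricGraph V E) (bc : Γ.BoundaryConditions) (U : E → ℝ → ℝ)
      (e : ℝ → E → ℝ → E → ℝ → ℂ),
      Γ.IsSmoothPotential U → bc.IsHeatKernel U e →
      ∀ η : ℝ → ℝ, IsCutoff η → ∀ k : ℕ, 1 ≤ k →
        ∃ C T : ℝ, 0 < T ∧ ∀ t ∈ Ioc 0 T,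
          ∀ α, ∀ x ∈ Icc 0 (Γ.len α), ∀ β, ∀ y ∈ Icc 0 (Γ.len β),
            ‖e t α x β y - bc.graphParametrix U η k t α x β y‖ ≤ C * t ^ k) ∧
    ∃ a b : ℕ → MvPolynomial ℕ ℝ,
      (∀ (n : ℕ) (J : ℕ → ℝ),
        MvPolynomial.eval (fun j => (-1) ^ j * J j) (a n) = MvPolynomial.eval J (a n)) ∧
      ∀ (V : Type u) (E : Type v) [Fintype V] [Fintype E] [DecidableEq V] [DecidableEq E]
        (Γ : MetricGraph V E) (bc : Γ.BoundaryConditions) (U : E → ℝ → ℝ)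
        (e : ℝ → E → ℝ → E → ℝ → ℂ),
        Γ.IsSmoothPotential U → bc.IsHeatKernel U e →
        ∀ N : ℕ, ∃ C T : ℝ, 0 < T ∧ ∀ t ∈ Ioc 0 T,
          ‖(Γ.integral fun α x => e t α x α x) - bc.traceExpansion U a b N t‖ ≤
            C * t ^ ((N : ℝ) + 1 / 2) := by
  refine ⟨?_, fun n => diagPoly n 0, boundaryPoly, fun n J => ?_, ?_⟩
  · intro V E _ _ _ _ Γ bc U e hU he η hη k hk
    exact he.exists_sub_graphParametrix_le hU hη hk
  · simpa using eval_diagPoly_neg n 0 J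
  · intro V E _ _ _ _ Γ bc U e hU he N
    exact he.exists_trace_sub_le hU N
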